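/- Let $X$ be a compact complex manifold and $f(T)=\sum_n c_nT^n$ a power series with complex coefficients which converges for all $T\in\mathbb{C}$. Write $\mathcal{A}^{\bullet}(X)$, $\mathcal{A}^{p,q}(X)$ for the smooth complex differential forms, $d=\partial+\bar\partial$, and set $\omega^*=(-1)^{k(k+1)/2}\,\overline{\omega}$ for a $k$-form $\omega$. A Hermitian cohesive module $(E^\bullet,\mathbb{E}'',h)$ on $X$ consists of a smooth $\mathbb{Z}$-graded complex vector bundle $E^\bullet$ of finite rank, a Hermitian metric $h$ on it for which $E^k\perp E^l$ for $k\ne l$, and a $\mathbb{C}$-linear operator $\mathbb{E}''$ of total degree $1$ on $\mathcal{A}^{0,\bullet}(X,E^\bullet)$ with $\mathbb{E}''(e\otimes\omega)=(\mathbb{E}''e)\wedge\omega+(-1)^{|e|}e\otimes\bar\partial\omega$ for homogeneous $e\in\mathcal{A}^0(X,E^\bullet)$, and $\mathbb{E}''\circ\mathbb{E}''=0$. By the same rule $\mathbb{E}''$ extends to $\mathcal{A}^{\bullet}(X,E^\bullet)$. Extend $h$ by $h(e\otimes\omega,e'\otimes\eta)=\omega^*\wedge h(e,e')\wedge\eta$,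 where $h$ is conjugate linear in its first argument. The Chern superconnection is $\mathbb{E}=\mathbb{E}'+\mathbb{E}''$, where $\mathbb{E}'$ is the $\partial$-superconnection (same Leibniz rule with $\partial$) mapping $\mathcal{A}^0(X,E^\bullet)$ to $\mathcal{A}^{\bullet,0}(X,E^\bullet)$, of degree $-1$ for the grading in which $\mathcal{A}^{p,q}(X,E^k)$ has degree $-p+q+k$, such that $(-1)^{|s|}d\,h(s,t)=-h(\mathbb{E}s,t)+h(s,\mathbb{E}t)$ for all $s,t$. For a superconnection $\mathbb{F}$ on $E^\bullet$ the curvature $\mathbb{F}^2$ is given by a form with values in $\mathrm{End}\,E$, and we put $f(E,\mathbb{F})=\operatorname{tr}f(\mathbb{F}^2)$ with $\operatorname{tr}$ the supertrace. Let $\nabla^E=\mathbb{E}_1$ be the component of $\mathbb{E}$ that raises the form degree by exactly one, let $A=\mathbb{E}-\nabla^E$ (an $\mathrm{End}\,E$-valued form), $\mathbb{E}_t=(1-t)\nabla^E+t\mathbb{E}$ and $\mathcal{R}_t=\mathbb{E}_t^2$. Then: 1. The characteristic form $f(E,\mathbb{E})$ is a well defined smooth form and $d f(E,\mathbb{E})=0$.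 2. The forms $\operatorname{tr}\{A\,f'(\mathcal{R}_t)\}$ are well defined and continuous in $t$, $\int_0^1\operatorname{tr}\{A\,f'(\mathcal{R}_t)\}\,dt$ is a smooth form, and $$f(E,\mathbb{E})-f(E,\nabla^E)=d\int_0^1\operatorname{tr}\{A\,f'(\mathcal{R}_t)\}\,dt .$$ In particular both forms are closed and have the same de Rham cohomology class. 3. The de Rham class of $f(E,\mathbb{E})$ depends only on the $\mathbb{Z}_2$-graded topological bundle underlying $E^\bullet$: if $(E^\bullet,\mathbb{E}'',h)$ and $(F^\bullet,\mathbb{F}'',k)$ are Hermitian cohesive modules on $X$ with Chern superconnections $\mathbb{E}$, $\mathbb{F}$, and there is an isomorphism of topological complex vector bundles $\bigoplus_k E^k\cong\bigoplus_k F^k$ preserving the grading modulo $2$, then $f(E,\mathbb{E})$ and $f(F,\mathbb{F})$ define the same class in de Rham cohomology. -/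

import Mathlib

open scoped Manifold ContDiff TensorProduct ComplexOrder

noncomputable section

namespace Cohesive

/-! ### Exterior algebra of a complexified cotangent space -/

section LinearAlgebra

variable (V : Type*) [NormedAddCommGroup V] [NormedSpace ℂ V] [FiniteDimensional ℂ V]

/-- `Λ^•(V* ⊗ ℂ) = ℂ ⊗ Λ^•(V*)`, the algebra of complex valued alternating forms on the real
vector space underlying the finite dimensional complex vector space `V`. -/
def FormAlg : Type _ := ℂ ⊗[ℝ] ExteriorAlgebra ℝ (V →L[ℝ] ℝ)

/-- The algebra structure, with an algebra norm (on a finite dimensional space all norms are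
equivalent): the operator norm of left multiplication in some basis. -/
def normedRingFormAlg : NormedRing (FormAlg V) :=
  letI : NormedRing (Matrix (Finset (Fin (Module.finrank ℝ (V →L[ℝ] ℝ))))
    (Finset (Fin (Module.finrank ℝ (V →L[ℝ] ℝ)))) ℂ) := Matrix.linftyOpNormedRing
  NormedRing.induced (ℂ ⊗[ℝ] ExteriorAlgebra ℝ (V →L[ℝ] ℝ)) _
    (Algebra.leftMulMatrix (Algebra.TensorProduct.basis ℂ
      (Module.finBasis ℝ (V →L[ℝ] ℝ)).ExteriorAlgebra))
    (Algebra.leftMulMatrix_injective _)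

instance : NormedRing (FormAlg V) := normedRingFormAlg V

/-- The complex algebra structure. -/
def normedAlgebraFormAlg : NormedAlgebra ℂ (FormAlg V) :=
  letI : NormedRing (Matrix (Finset (Fin (Module.finrank ℝ (V →L[ℝ] ℝ))))
    (Finset (Fin (Module.finrank ℝ (V →L[ℝ] ℝ)))) ℂ) := Matrix.linftyOpNormedRing
  letI : NormedAlgebra ℂ (Matrix (Finset (Fin (Module.finrank ℝ (V →L[ℝ] ℝ))))
    (Finset (Fin (Module.finrank ℝ (V →L[ℝ] ℝ)))) ℂ) := Matrix.linftyOpNormedAlgebra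
  NormedAlgebra.induced ℂ (ℂ ⊗[ℝ] ExteriorAlgebra ℝ (V →L[ℝ] ℝ)) _
    (Algebra.leftMulMatrix (Algebra.TensorProduct.basis ℂ
      (Module.finBasis ℝ (V →L[ℝ] ℝ)).ExteriorAlgebra))

instance : NormedAlgebra ℂ (FormAlg V) := normedAlgebraFormAlg V

instance : FiniteDimensional ℂ (FormAlg V) :=
  Module.Finite.of_basis (Algebra.TensorProduct.basis ℂ
    (Module.finBasis ℝ (V →L[ℝ] ℝ)).ExteriorAlgebra)

variable {V}

/-- The degree one element given by a complex valued real linear functional. -/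
def oneForm (α : V →L[ℝ] ℂ) : FormAlg V :=
  (1 : ℂ) ⊗ₜ[ℝ] ExteriorAlgebra.ι ℝ (Complex.reCLM ∘L α) +
    Complex.I ⊗ₜ[ℝ] ExteriorAlgebra.ι ℝ (Complex.imCLM ∘L α)

/-- Pullback of alternating forms along a real linear map. -/
def pull (A : V →L[ℝ] V) : FormAlg V →ₐ[ℂ] FormAlg V :=
  Algebra.TensorProduct.map (AlgHom.id ℂ ℂ)
    (ExteriorAlgebra.map ((ContinuousLinearMap.compL ℝ V V ℝ).flip A).toLinearMap)

/-- The projection onto `k`-forms. -/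
def degProj (k : ℕ) : FormAlg V →ₗ[ℂ] FormAlg V :=
  LinearMap.baseChange ℂ
    (GradedAlgebra.proj (fun i : ℕ => ⋀[ℝ]^i (V →L[ℝ] ℝ)) k)

/-- The parity automorphism, multiplication by `(-1)^k` on `k`-forms. -/
def parity : FormAlg V →ₗ[ℂ] FormAlg V :=
  LinearMap.baseChange ℂ (CliffordAlgebra.involute (Q := (0 : QuadraticForm ℝ (V →L[ℝ] ℝ)))).toLinearMap

/-- The conjugate linear anti-involution `η ↦ (-1)^{k(k+1)/2} conj η` on `k`-forms:
complex conjugation, composed with reversal (which is `(-1)^{k(k-1)/2}`) and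
parity (which is `(-1)^k`). -/
def starForm : FormAlg V →ₗ[ℝ] FormAlg V :=
  TensorProduct.map Complex.conjAe.toLinearMap
    (CliffordAlgebra.reverse (Q := (0 : QuadraticForm ℝ (V →L[ℝ] ℝ))) ∘ₗ
      (CliffordAlgebra.involute (Q := (0 : QuadraticForm ℝ (V →L[ℝ] ℝ)))).toLinearMap)

variable (V) in
/-- Forms of bidegree `(p, q)`: spanned by products of `p` complex linear and `q` conjugate linear
functionals. -/
def bideg (p q : ℕ) : Submodule ℂ (FormAlg V) :=
  (Submodule.span ℂ (oneForm '' {α : V →L[ℝ] ℂ | ∀ v, α (Complex.I • v) = Complex.I * α v})) ^ p *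
  (Submodule.span ℂ (oneForm '' {α : V →L[ℝ] ℂ | ∀ v, α (Complex.I • v) = -(Complex.I * α v)})) ^ q

/-- Exterior multiplication `V* ⊗ Λ → Λ`: if `L = α ⊗ η` then `wedgeL L = α ∧ η`. -/
def wedgeL (L : V →L[ℝ] FormAlg V) : FormAlg V :=
  ∑ i, oneForm (Complex.ofRealCLM ∘L
      LinearMap.toContinuousLinearMap ((Module.finBasis ℝ V).coord i)) *
    L (Module.finBasis ℝ V i)

/-- The complex linear part of a real linear map. -/
def linPart (L : V →L[ℝ] FormAlg V) : V →L[ℝ] FormAlg V :=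
  (1 / 2 : ℂ) • (L - Complex.I • (L ∘L ((Complex.I • ContinuousLinearMap.id ℂ V).restrictScalars ℝ)))

/-- The conjugate linear part of a real linear map. -/
def antiPart (L : V →L[ℝ] FormAlg V) : V →L[ℝ] FormAlg V :=
  (1 / 2 : ℂ) • (L + Complex.I • (L ∘L ((Complex.I • ContinuousLinearMap.id ℂ V).restrictScalars ℝ)))

end LinearAlgebra

/-! ### Differential forms on a complex manifold

A differential form is a function `X → FormAlg V`, its value at `x` being an element of
`Λ^•(T_x^*X ⊗ ℂ)`; recall that `TangentSpace 𝓘(ℝ, V) x` is by definition `V`, identified with the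
tangent space through the preferred chart at `x`. -/

section Forms

variable {V : Type*} [NormedAddCommGroup V] [NormedSpace ℂ V] [FiniteDimensional ℂ V]
variable {X : Type*} [TopologicalSpace X] [ChartedSpace V X]

/-- The expression of a form in the chart at `p`: its pullback along the inverse of that chart. -/
def rep (p : X) (η : X → FormAlg V) (y : V) : FormAlg V :=
  pull (V := V) (mfderiv 𝓘(ℝ, V) 𝓘(ℝ, V) (chartAt V p).symm y) (η ((chartAt V p).symm y))

/-- Smoothness of a form on the set `U`, in all preferred charts. -/
def IsSmoothOn (η : X → FormAlg V) (U : Set X) : Prop :=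
  ∀ p : X, ContDiffOn ℝ ∞ (rep p η) ((chartAt V p).target ∩ (chartAt V p).symm ⁻¹' U)

/-- The exterior derivative `d`. -/
def extD (η : X → FormAlg V) (x : X) : FormAlg V :=
  wedgeL (fderiv ℝ (rep x η) (chartAt V x x))

/-- The Dolbeault operator `∂`. -/
def del (η : X → FormAlg V) (x : X) : FormAlg V :=
  wedgeL (linPart (fderiv ℝ (rep x η) (chartAt V x x)))

/-- The Dolbeault operator `∂̄`. -/
def delbar (η : X → FormAlg V) (x : X) : FormAlg V :=
  wedgeL (antiPart (fderiv ℝ (rep x η) (chartAt V x x)))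

lemma rep_add (p : X) (η τ : X → FormAlg V) : rep p (η + τ) = rep p η + rep p τ := by
  funext y; simp [rep]

lemma rep_smul (p : X) (c : ℂ) (η : X → FormAlg V) : rep p (c • η) = c • rep p η := by
  funext y; simp [rep]

lemma rep_mul (p : X) (η τ : X → FormAlg V) : rep p (η * τ) = rep p η * rep p τ := by
  funext y; simp [rep]

lemma IsSmoothOn.add {η τ : X → FormAlg V} {U : Set X} (h : IsSmoothOn η U)
    (h' : IsSmoothOn τ U) : IsSmoothOn (η + τ) U := fun p => by
  rw [rep_add]; exact (h p).add (h' p)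

lemma IsSmoothOn.smul {η : X → FormAlg V} {U : Set X} (c : ℂ) (h : IsSmoothOn η U) :
    IsSmoothOn (c • η) U := fun p => by
  rw [rep_smul]; exact (h p).const_smul c

lemma IsSmoothOn.mul {η τ : X → FormAlg V} {U : Set X} (h : IsSmoothOn η U)
    (h' : IsSmoothOn τ U) : IsSmoothOn (η * τ) U := fun p => by
  rw [rep_mul]; exact (h p).mul (h' p)

lemma isSmoothOn_zero (U : Set X) : IsSmoothOn (0 : X → FormAlg V) U := fun p => by
  have : rep p (0 : X → FormAlg V) = fun _ => 0 := by funext y; simp [rep]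
  rw [this]; exact contDiffOn_const

lemma IsSmoothOn.mono {η : X → FormAlg V} {U W : Set X} (h : IsSmoothOn η U) (hW : W ⊆ U) :
    IsSmoothOn η W := fun p => (h p).mono fun _ hy => ⟨hy.1, hW hy.2⟩

lemma degProj_pull (k : ℕ) (A : V →L[ℝ] V) (w : FormAlg V) :
    degProj k (pull A w) = pull A (degProj k w) := by
  have key : ∀ y : ExteriorAlgebra ℝ (V →L[ℝ] ℝ),
      GradedAlgebra.proj (fun i : ℕ => ⋀[ℝ]^i (V →L[ℝ] ℝ)) k
        (ExteriorAlgebra.map ((ContinuousLinearMap.compL ℝ V V ℝ).flip A).toLinearMap y) =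
      ExteriorAlgebra.map ((ContinuousLinearMap.compL ℝ V V ℝ).flip A).toLinearMap
        (GradedAlgebra.proj (fun i : ℕ => ⋀[ℝ]^i (V →L[ℝ] ℝ)) k y) := by
    intro y
    induction y using DirectSum.Decomposition.inductionOn
      (fun i : ℕ => ⋀[ℝ]^i (V →L[ℝ] ℝ)) with
    | zero => simp
    | add a b ha hb => simp only [map_add, ha, hb]
    | @homogeneous i m =>
      have hm : ExteriorAlgebra.map ((ContinuousLinearMap.compL ℝ V V ℝ).flip A).toLinearMap m.1 ∈
          ⋀[ℝ]^i (V →L[ℝ] ℝ) := by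
        have h2 : Submodule.map (ExteriorAlgebra.map
            ((ContinuousLinearMap.compL ℝ V V ℝ).flip A).toLinearMap).toLinearMap
            (⋀[ℝ]^i (V →L[ℝ] ℝ)) ≤ ⋀[ℝ]^i (V →L[ℝ] ℝ) := by
          rw [ExteriorAlgebra.exteriorPower, Submodule.map_pow]
          refine pow_le_pow_left' ?_ i
          rintro _ ⟨_, ⟨u, rfl⟩, rfl⟩
          exact ⟨_, (ExteriorAlgebra.map_apply_ι _ u).symm⟩
        exact h2 ⟨m.1, m.2, rfl⟩
      by_cases hik : i = k
      · subst hik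
        rw [GradedAlgebra.proj_apply, GradedAlgebra.proj_apply,
          DirectSum.decompose_of_mem_same (fun i : ℕ => ⋀[ℝ]^i (V →L[ℝ] ℝ)) hm, 
          DirectSum.decompose_of_mem_same (fun i : ℕ => ⋀[ℝ]^i (V →L[ℝ] ℝ)) m.2]
      · rw [GradedAlgebra.proj_apply, GradedAlgebra.proj_apply,
          DirectSum.decompose_of_mem_ne (fun i : ℕ => ⋀[ℝ]^i (V →L[ℝ] ℝ)) hm hik, 
          DirectSum.decompose_of_mem_ne (fun i : ℕ => ⋀[ℝ]^i (V →L[ℝ] ℝ)) m.2 hik, map_zero]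
  refine TensorProduct.induction_on (motive := fun w : ℂ ⊗[ℝ] ExteriorAlgebra ℝ (V →L[ℝ] ℝ) =>
    degProj k (pull A (w : FormAlg V)) = pull A (degProj k (w : FormAlg V))) w ?_ ?_ ?_
  · exact (congrArg (degProj k) (map_zero (pull A))).trans ((map_zero (degProj k)).trans
      ((congrArg (pull A) (map_zero (degProj k))).trans (map_zero (pull A))).symm)
  · intro z y
    exact congrArg (fun u => z ⊗ₜ[ℝ] u) (key y)
  · intro a b ha hb
    have h1 := map_add (pull A) (a : FormAlg V) (b : FormAlg V)
    have h2 := map_add (degProj k) (a : FormAlg V) (b : FormAlg V)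
    refine (congrArg (degProj k) h1).trans ((map_add (degProj k) _ _).trans ?_)
    refine Eq.trans ?_ (congrArg (pull A) h2).symm
    refine Eq.trans ?_ (map_add (pull A) _ _).symm
    exact congrArg₂ (fun u v : FormAlg V => u + v) ha hb

lemma IsSmoothOn.degProj {η : X → FormAlg V} {U : Set X} (k : ℕ) (h : IsSmoothOn η U) :
    IsSmoothOn (fun x => degProj k (η x)) U := fun p => by
  have : rep p (fun x => Cohesive.degProj k (η x)) =
      fun y => LinearMap.toContinuousLinearMap ((Cohesive.degProj (V := V) k).restrictScalars ℝ)
        (rep p η y) := by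
    funext y; exact (degProj_pull k _ _).symm
  rw [this]
  exact (ContinuousLinearMap.contDiff _).comp_contDiffOn (h p)

variable (V X) in
/-- `A^•(X)`: smooth complex valued differential forms on `X`. -/
def smoothForms : Submodule ℂ (X → FormAlg V) where
  carrier := {η | IsSmoothOn η Set.univ}
  add_mem' h h' := h.add h'
  zero_mem' := isSmoothOn_zero _
  smul_mem' c _ h := h.smul c

lemma differentiableAt_rep (η : smoothForms V X) (x : X) :
    DifferentiableAt ℝ (rep x η.1) (chartAt V x x) := by
  have h := η.2 x
  simp only [Set.preimage_univ, Set.inter_univ] at h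
  exact (h.contDiffAt ((chartAt V x).open_target.mem_nhds (mem_chart_target V x))).differentiableAt
    (by simp)

variable (V X) in
/-- The exterior derivative as a linear map on smooth forms. -/
def extDLin : smoothForms V X →ₗ[ℂ] (X → FormAlg V) where
  toFun η := extD η.1
  map_add' η τ := by
    funext x
    simp only [extD, wedgeL, Submodule.coe_add, Pi.add_apply, rep_add,
      fderiv_add (differentiableAt_rep η x) (differentiableAt_rep τ x),
      add_apply, mul_add, Finset.sum_add_distrib]
  map_smul' c η := by
    funext x
    simp only [extD, wedgeL, Submodule.coe_smul, Pi.smul_apply, rep_smul,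
      fderiv_const_smul (differentiableAt_rep η x), RingHom.id_apply,
      smul_apply, mul_smul_comm, Finset.smul_sum]

variable (V X) in
/-- Smooth forms `η` with `d η = 0`. -/
def closedForms : Submodule ℂ (X → FormAlg V) :=
  (LinearMap.ker (extDLin V X)).map (smoothForms V X).subtype

variable (V X) in
/-- De Rham cohomology of `X` with complex coefficients (all degrees together): closed forms
modulo exact forms. -/
abbrev DeRham : Type _ :=
  closedForms V X ⧸ (LinearMap.range (extDLin V X)).submoduleOf (closedForms V X)

/-- The form `η` is smooth and closed, and `c` is its de Rham cohomology class. -/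
def HasDeRhamClass (η : X → FormAlg V) (c : DeRham V X) : Prop :=
  ∃ h : η ∈ closedForms V X, Submodule.Quotient.mk ⟨η, h⟩ = c

end Forms

/-! ### Graded vector bundles -/

section Bundles

variable (V : Type*) [NormedAddCommGroup V] [NormedSpace ℂ V] [FiniteDimensional ℂ V]
variable (X : Type*) [TopologicalSpace X] [ChartedSpace V X]

/-- A smooth `ℤ`-graded complex vector bundle of finite (locally constant) rank, given by a
homogeneous local frame on an open neighbourhood `dom p` of each point `p` and by the smooth,
degree preserving transition matrices between these frames. `trans p q x` turns
coordinates in the frame `q` into coordinates in the frame `p`, and `deg p a` is the degree of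
the `a`-th vector of the frame `p`. The fibre at `x` is `Fin (rank x) → ℂ`, through
the frame `x`. -/
structure GradedBundle where
  rank : X → ℕ
  deg : ∀ p, Fin (rank p) → ℤ
  dom : X → Set X
  isOpen_dom : ∀ p, IsOpen (dom p)
  mem_dom : ∀ p, p ∈ dom p
  trans : ∀ p q, X → Matrix (Fin (rank p)) (Fin (rank q)) ℂ
  trans_smooth : ∀ p q a b,
    ContMDiffOn 𝓘(ℝ, V) 𝓘(ℝ, ℂ) ∞ (fun x => trans p q x a b) (dom p ∩ dom q)
  trans_self : ∀ p, ∀ x ∈ dom p, trans p p x = 1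
  trans_mul : ∀ p q r, ∀ x ∈ dom p ∩ dom q ∩ dom r, trans p q x * trans q r x = trans p r x
  trans_deg : ∀ p q, ∀ x ∈ dom p ∩ dom q, ∀ a b, deg p a ≠ deg q b → trans p q x a b = 0

variable {V X}

namespace GradedBundle

variable (E : GradedBundle V X)

/-- The coordinates in the frame `p` of a (not necessarily smooth) `E`-valued form
`s = ∑_a e_a ⊗ s^a`, which is given at each `x` by its coordinates in the frame `x`. -/
def coord (p : X) (s : ∀ x, Fin (E.rank x) → FormAlg V) (a : Fin (E.rank p)) (x : X) :
    FormAlg V := ∑ b, E.trans p x x a b • s x b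

/-- `A^•(X, E)`: the smooth `E`-valued differential forms. -/
def Forms : Submodule ℂ (∀ x, Fin (E.rank x) → FormAlg V) where
  carrier := {s | ∀ p a, IsSmoothOn (E.coord p s a) (E.dom p)}
  add_mem' {s t} hs ht p a := by
    have : E.coord p (s + t) a = E.coord p s a + E.coord p t a := by
      funext x; simp [coord, Finset.sum_add_distrib]
    rw [this]; exact (hs p a).add (ht p a)
  zero_mem' p a := by
    have : E.coord p 0 a = 0 := by funext x; simp [coord]
    rw [this]; exact isSmoothOn_zero _
  smul_mem' c s hs p a := by
    have : E.coord p (c • s) a = c • E.coord p s a := by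
      funext x; simp [coord, Finset.smul_sum, smul_comm c]
    rw [this]; exact (hs p a).smul c

/-- Right multiplication `s ↦ s ∧ η` by a differential form. -/
def rmul (s : E.Forms) (η : smoothForms V X) : E.Forms :=
  ⟨fun x a => s.1 x a * η.1 x, fun p a => by
    have : E.coord p (fun x a => s.1 x a * η.1 x) a = E.coord p s.1 a * η.1 := by
      funext x; simp [coord, Finset.sum_mul]
    rw [this]; exact (s.2 p a).mul (IsSmoothOn.mono η.2 (Set.subset_univ _))⟩

/-- The component of form degree `k` of an `E`-valued form. -/
def formPart (k : ℕ) : E.Forms →ₗ[ℂ] E.Forms where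
  toFun s := ⟨fun x a => degProj k (s.1 x a), fun p a => by
    have : E.coord p (fun x a => degProj k (s.1 x a)) a =
        fun x => degProj k (E.coord p s.1 a x) := by
      funext x; simp [coord]
    rw [this]; exact (s.2 p a).degProj k⟩
  map_add' s t := by ext x a; simp
  map_smul' c s := by ext x a; simp

/-- `s ∈ A^0(X, E^•)`. -/
def IsSection (s : E.Forms) : Prop := ∀ x a, ∀ k ≠ 0, degProj k (s.1 x a) = 0

/-- `s` is homogeneous of total degree `m`: a sum of elements of `A^k(X, E^{m-k})`. -/
def HasTotalDegree (m : ℤ) (s : E.Forms) : Prop :=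
  ∀ x a, ∀ k : ℕ, (k : ℤ) + E.deg x a ≠ m → degProj k (s.1 x a) = 0

/-- `s` is of exotic degree `m`: a sum of elements of `A^{p,q}(X, E^k)` with `-p + q + k = m`. -/
def HasExoticDegree (m : ℤ) (s : E.Forms) : Prop :=
  ∀ x a, s.1 x a ∈ ⨆ (p : ℕ) (q : ℕ) (_ : -(p : ℤ) + q + E.deg x a = m), bideg V p q

/-- `s ∈ A^{0,•}(X, E^•)`. -/
def IsAntiHolType (s : E.Forms) : Prop := ∀ x a, s.1 x a ∈ ⨆ q : ℕ, bideg V 0 q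

/-- `s ∈ A^{•,0}(X, E^•)`. -/
def IsHolType (s : E.Forms) : Prop := ∀ x a, s.1 x a ∈ ⨆ p : ℕ, bideg V p 0

/-- The Leibniz rule `T(e ⊗ η) = (T e) ∧ η + (-1)^k e ⊗ D η` for `e ∈ A^0(X, E^k)`, where `D`
is one of `d`, `∂`, `∂̄`. -/
def Leibniz (D : (X → FormAlg V) → X → FormAlg V) (T : E.Forms →ₗ[ℂ] E.Forms) : Prop :=
  ∀ (k : ℤ) (e : E.Forms) (η : smoothForms V X), E.IsSection e → E.HasTotalDegree k e →
    ∀ x a, (T (E.rmul e η)).1 x a = (T e).1 x a * η.1 x + (-1 : ℂ) ^ k • (e.1 x a * D η.1 x)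

/-- The value at each point of a (possibly inhomogeneous) `End E`-valued form, as a matrix of
forms in the frame at that point: `L ⊗ τ` acts by `e ⊗ η ↦ (-1)^{|τ||e|} L e ⊗ τ ∧ η`. `Represents M T`
says that the operator `T` on `A^•(X, E)` is the action of `M`. -/
def Represents (M : ∀ x, Matrix (Fin (E.rank x)) (Fin (E.rank x)) (FormAlg V))
    (T : E.Forms →ₗ[ℂ] E.Forms) : Prop :=
  ∀ s x, (T s).1 x = (M x).mulVec (s.1 x)

/-- `T` is the action of a (unique) `End E`-valued form. -/
def IsTensorial (T : E.Forms →ₗ[ℂ] E.Forms) : Prop := ∃! M, E.Represents M T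

open Classical in
/-- The `End E`-valued form by which the operator `T` acts. -/
def endForm (T : E.Forms →ₗ[ℂ] E.Forms) :
    ∀ x, Matrix (Fin (E.rank x)) (Fin (E.rank x)) (FormAlg V) :=
  if h : ∃ M, E.Represents M T then h.choose else 0

/-- The curvature `T²` of a superconnection `T`, as an `End E`-valued form. -/
def curvature (T : E.Forms →ₗ[ℂ] E.Forms) :
    ∀ x, Matrix (Fin (E.rank x)) (Fin (E.rank x)) (FormAlg V) :=
  E.endForm (T ∘ₗ T)

/-- The supertrace, `str(L ⊗ τ) = str(L) τ`. In the matrix by which `L ⊗ τ` acts, the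
diagonal entries are `(-1)^{|τ||e_a|} L_aa τ`, whence the parity automorphism in odd degrees. -/
def str (x : X) (M : Matrix (Fin (E.rank x)) (Fin (E.rank x)) (FormAlg V)) : FormAlg V :=
  ∑ a, if Even (E.deg x a) then M a a else - parity (M a a)

/-- The value `∑ c_n Mⁿ` of the power series `f = ∑ c_n Tⁿ`. -/
def evalAt {n : ℕ} (f : PowerSeries ℂ) (M : Matrix (Fin n) (Fin n) (FormAlg V)) :
    Matrix (Fin n) (Fin n) (FormAlg V) :=
  ∑' k, PowerSeries.coeff k f • M ^ k

/-- The characteristic form `tr f(T²)` of a superconnection `T`. -/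
def charForm (f : PowerSeries ℂ) (T : E.Forms →ₗ[ℂ] E.Forms) (x : X) : FormAlg V :=
  E.str x (evalAt f (E.curvature T x))

/-- The connection component `T_1 : A^k(X, E) → A^{k+1}(X, E)` of `T = ∑_j T_j`, where `T_j`
raises the form degree by `j`. -/
def connPart (T : E.Forms →ₗ[ℂ] E.Forms) : E.Forms →ₗ[ℂ] E.Forms :=
  ∑ k ∈ Finset.range (Module.finrank ℝ V + 1), E.formPart (k + 1) ∘ₗ T ∘ₗ E.formPart k

/-- The path `(1 - t) T_1 + t T` from the connection component to `T`. -/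
def path (T : E.Forms →ₗ[ℂ] E.Forms) (t : ℝ) : E.Forms →ₗ[ℂ] E.Forms :=
  (1 - t : ℂ) • E.connPart T + (t : ℂ) • T

/-- The form `tr (A f'(R_t))` at `x`, where `A = T - T_1`, and `R_t` is the curvature of
`(1 - t) T_1 + t T`. -/
def transgressionIntegrand (f : PowerSeries ℂ) (T : E.Forms →ₗ[ℂ] E.Forms) (t : ℝ) (x : X) :
    FormAlg V :=
  E.str x (E.endForm (T - E.connPart T) x *
    evalAt (PowerSeries.derivative ℂ f) (E.curvature (E.path T t) x))

/-- `∫_0^1 tr (A f'(R_t)) dt`. -/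
def transgression (f : PowerSeries ℂ) (T : E.Forms →ₗ[ℂ] E.Forms) (x : X) : FormAlg V :=
  ∫ t in (0 : ℝ)..1, E.transgressionIntegrand f T t x

/-- `E` and `F` are isomorphic as `ℤ/2`-graded topological complex vector bundles: there is a
fibrewise linear isomorphism `φ`, preserving the parity of degrees, whose matrices in local
frames are continuous. -/
def Z2TopIso (E F : GradedBundle V X) : Prop :=
  ∃ (φ : ∀ x, Matrix (Fin (F.rank x)) (Fin (E.rank x)) ℂ)
    (ψ : ∀ x, Matrix (Fin (E.rank x)) (Fin (F.rank x)) ℂ),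
    (∀ x, φ x * ψ x = 1) ∧ (∀ x, ψ x * φ x = 1) ∧
    (∀ x a b, ¬ (Even (F.deg x a) ↔ Even (E.deg x b)) → φ x a b = 0) ∧
    (∀ p q, ContinuousOn (fun x => F.trans p x x * φ x * E.trans x q x) (F.dom p ∩ E.dom q))

end GradedBundle

variable (V X) in
/-- A Hermitian cohesive module `(E^•, E'', h)`. The operator `E''` on `A^{0,•}(X, E)` is
regarded as defined on all of `A^•(X, E)` through the Leibniz rule. The metric is given
at each `x` by its Gram matrix in the frame `x`. -/
structure HermitianCohesiveModule extends GradedBundle V X where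
  antiOp : toGradedBundle.Forms →ₗ[ℂ] toGradedBundle.Forms
  antiOp_leibniz : toGradedBundle.Leibniz delbar antiOp
  antiOp_type : ∀ s, toGradedBundle.IsAntiHolType s → toGradedBundle.IsAntiHolType (antiOp s)
  antiOp_degree : ∀ m s, toGradedBundle.IsAntiHolType s → toGradedBundle.HasTotalDegree m s →
    toGradedBundle.HasTotalDegree (m + 1) (antiOp s)
  antiOp_flat : antiOp ∘ₗ antiOp = 0
  metric : ∀ x, Matrix (Fin (rank x)) (Fin (rank x)) ℂ
  metric_posDef : ∀ x, (metric x).PosDef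
  metric_orthogonal : ∀ x a b, deg x a ≠ deg x b → metric x a b = 0
  metric_smooth : ∀ p a b, ContMDiffOn 𝓘(ℝ, V) 𝓘(ℝ, ℂ) ∞
    (fun x => ((trans x p x).conjTranspose * metric x * trans x p x) a b) (dom p)

namespace HermitianCohesiveModule

variable (E : HermitianCohesiveModule V X)

/-- The pairing `h(e ⊗ η, f ⊗ τ) = η^* ∧ h(e, f) ∧ τ` of `E`-valued forms. -/
def pairing (s t : E.Forms) (x : X) : FormAlg V :=
  ∑ a, ∑ b, E.metric x a b • (starForm (s.1 x a) * t.1 x b)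

/-- `T` is the Chern superconnection `E' + E''`, where `E'` is the `∂`-superconnection of exotic degree
`-1` for which `E' + E''` is unitary. -/
structure IsChern (T : E.Forms →ₗ[ℂ] E.Forms) : Prop where
  leibniz : E.Leibniz del (T - E.antiOp)
  type : ∀ s, E.IsSection s → E.IsHolType ((T - E.antiOp) s)
  exoticDegree : ∀ m s, E.IsSection s → E.HasExoticDegree m s →
    E.HasExoticDegree (m - 1) ((T - E.antiOp) s)
  unitary : ∀ m s t, E.HasTotalDegree m s → ∀ x,
    (-1 : ℂ) ^ m • extD (E.pairing s t) x = - E.pairing (T s) t x + E.pairing s (T t) x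

end HermitianCohesiveModule

end Bundles

end Cohesive

end

/-!
A superconnection `T` differs from the exterior derivative by an operator of order zero. In a local
frame with vectors of degrees `d a` it has the form `ε d + Γ`, where `ε` is the sign `(-1)^{d a}` and
`Γ` is an odd matrix of smooth forms (`GradedBundle.exists_hasLocalForm`): the Leibniz rule makes `T`
a local operator, so it is determined near a point by its values on frame vectors that are cut off
to global sections. Hence `T²` acts through the even matrix `R = ε dΓ + Γ²`
(`GradedBundle.HasLocalForm.coord_sq`), and since the supertrace is invariant under even changes of
frame (`superTr_conj`, `matSeries_conj`), the characteristic form is locally `str f(R)`. Entire series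
of matrices of forms converge and depend smoothly on the matrix, because these matrices form a finite
dimensional Banach algebra.

The form `str f(R)` is closed by the Bianchi identity `ε dR + [Γ, R] = 0`: it passes to `f(R)`, and
the supertrace of the commutator `[Γ, f(R)]` vanishes (`extD_superTr_matSeries`). For two
superconnections with difference `A` and the segment between them, whose curvatures are `R_t`, the
derivative of `R_t` in `t` is the covariant derivative of `A`. By the cyclic symmetry of the
supertrace the derivative of `str f(R_t)` is the supertrace of that covariant derivative times
`f'(R_t)`, and by the Bianchi identity this is `d str (A f'(R_t))`. Integration over `[0, 1]` gives
the transgression formula (`extD_transgression`, `GradedBundle.IsSuperconn.transgression`). It holds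
for any two superconnections on the same bundle; the connection component of a superconnection is
again one (`GradedBundle.IsSuperconn.connPart`).

To compare two bundles, a topological isomorphism `φ` that preserves the parity is replaced by a
smooth one (`GradedBundle.exists_smooth_iso`): near `p` the map that is constantly `φ p` in local
frames satisfies `Re h(φ v, φ_p v) > 0` for `v ≠ 0`, and this condition is preserved when such maps
are glued with a partition of unity, which makes the glued map invertible. The superconnection of the
second bundle is transported to the first one along the smooth isomorphism, with the same
characteristic form (`GradedBundle.IsSuperconn.transport`,
`GradedBundle.IsSuperconn.charForm_transport`), and there the transgression formula applies.
-/

noncomputable section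

namespace Cohesive

set_option linter.unusedSectionVars false

/-! ### The algebra of forms at a point -/

section FormAlgebra

variable {V : Type*} [NormedAddCommGroup V] [NormedSpace ℂ V] [FiniteDimensional ℂ V]

/-- The degree one form given by a real covector. -/
def realForm (α : V →L[ℝ] ℝ) : FormAlg V := (1 : ℂ) ⊗ₜ[ℝ] ExteriorAlgebra.ι ℝ α

/-- The inclusion of real forms. -/
def ofExterior : ExteriorAlgebra ℝ (V →L[ℝ] ℝ) →+* FormAlg V :=
  (Algebra.TensorProduct.includeRight :
    ExteriorAlgebra ℝ (V →L[ℝ] ℝ) →ₐ[ℝ] ℂ ⊗[ℝ] ExteriorAlgebra ℝ (V →L[ℝ] ℝ)).toRingHom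

lemma tmul_eq_smul_ofExterior (z : ℂ) (y : ExteriorAlgebra ℝ (V →L[ℝ] ℝ)) :
    (z ⊗ₜ[ℝ] y : FormAlg V) = z • ofExterior y := by
  change _ = (z • ((1 : ℂ) ⊗ₜ[ℝ] y) : ℂ ⊗[ℝ] ExteriorAlgebra ℝ (V →L[ℝ] ℝ))
  rw [TensorProduct.smul_tmul', smul_eq_mul, mul_one]

lemma ofExterior_ι (α : V →L[ℝ] ℝ) : ofExterior (ExteriorAlgebra.ι ℝ α) = realForm α := rfl

lemma ofExterior_algebraMap (r : ℝ) :
    ofExterior (V := V) (algebraMap ℝ _ r) = algebraMap ℂ (FormAlg V) r := by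
  change ((1 : ℂ) ⊗ₜ[ℝ] algebraMap ℝ _ r : ℂ ⊗[ℝ] ExteriorAlgebra ℝ (V →L[ℝ] ℝ)) =
    ((r : ℂ) ⊗ₜ[ℝ] 1 : ℂ ⊗[ℝ] ExteriorAlgebra ℝ (V →L[ℝ] ℝ))
  rw [Algebra.algebraMap_eq_smul_one, ← TensorProduct.smul_tmul, Algebra.smul_def, mul_one]
  rfl

/-- A property of forms that is stable under sums and complex multiples holds for all forms if it
holds for the real ones. -/
lemma formAlg_tensor_induction {P : FormAlg V → Prop}
    (tmul : ∀ y : ExteriorAlgebra ℝ (V →L[ℝ] ℝ), P (ofExterior y))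
    (smul : ∀ (z : ℂ) w, P w → P (z • w))
    (add : ∀ u w, P u → P w → P (u + w)) (w : FormAlg V) : P w := by
  refine TensorProduct.induction_on
    (motive := fun w : ℂ ⊗[ℝ] ExteriorAlgebra ℝ (V →L[ℝ] ℝ) => P (w : FormAlg V)) w ?_ ?_ ?_
  · have h := tmul 0
    rw [map_zero] at h
    exact h
  · intro z y
    have h := smul z _ (tmul y)
    rwa [← tmul_eq_smul_ofExterior] at h
  · intro a b ha hb
    exact add a b ha hb

/-- The algebra of forms is generated over `ℂ` by real covectors. -/
lemma formAlg_induction {P : FormAlg V → Prop}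
    (scalar : ∀ z : ℂ, P (algebraMap ℂ _ z)) (form : ∀ α : V →L[ℝ] ℝ, P (realForm α))
    (mul : ∀ u w, P u → P w → P (u * w)) (add : ∀ u w, P u → P w → P (u + w))
    (w : FormAlg V) : P w := by
  refine formAlg_tensor_induction ?_ ?_ add w
  · intro y
    induction y using ExteriorAlgebra.induction with
    | algebraMap r => rw [ofExterior_algebraMap]; exact scalar r
    | ι α => exact form α
    | mul a b ha hb => rw [map_mul]; exact mul _ _ ha hb
    | add a b ha hb => rw [map_add]; exact add _ _ ha hb
  · intro z w hw
    rw [Algebra.smul_def]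
    exact mul _ _ (scalar z) hw

lemma realForm_add (α β : V →L[ℝ] ℝ) : realForm (α + β) = realForm α + realForm β := by
  simp only [← ofExterior_ι, map_add]

lemma realForm_smul (r : ℝ) (α : V →L[ℝ] ℝ) : realForm (r • α) = (r : ℂ) • realForm α := by
  rw [← ofExterior_ι, map_smul, Algebra.smul_def, map_mul, ofExterior_algebraMap, ofExterior_ι,
    Algebra.smul_def]

/-- `realForm` as a real linear map. -/
def realFormLin : (V →L[ℝ] ℝ) →ₗ[ℝ] FormAlg V where
  toFun := realForm
  map_add' := realForm_add
  map_smul' r α := by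
    rw [realForm_smul]; rfl

lemma realForm_mul_self (α : V →L[ℝ] ℝ) : realForm α * realForm α = 0 := by
  rw [← ofExterior_ι, ← map_mul, ExteriorAlgebra.ι_sq_zero, map_zero]

lemma realForm_mul_swap (α β : V →L[ℝ] ℝ) :
    realForm α * realForm β = -(realForm β * realForm α) := by
  have h := realForm_mul_self (α + β)
  rw [realForm_add, add_mul, mul_add, mul_add, realForm_mul_self, realForm_mul_self] at h
  rw [eq_neg_iff_add_eq_zero]
  simpa using h

lemma oneForm_eq (α : V →L[ℝ] ℂ) :
    oneForm α = realForm (Complex.reCLM ∘L α) + Complex.I • realForm (Complex.imCLM ∘L α) := by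
  have := tmul_eq_smul_ofExterior (V := V) Complex.I (ExteriorAlgebra.ι ℝ (Complex.imCLM ∘L α))
  rw [ofExterior_ι] at this
  rw [← this]
  rfl

lemma oneForm_ofReal (α : V →L[ℝ] ℝ) : oneForm (Complex.ofRealCLM ∘L α) = realForm α := by
  rw [oneForm_eq]
  have h1 : Complex.reCLM ∘L (Complex.ofRealCLM ∘L α) = α := by ext; simp
  have h2 : Complex.imCLM ∘L (Complex.ofRealCLM ∘L α) = 0 := by ext; simp
  rw [h1, h2, ← ofExterior_ι (0 : V →L[ℝ] ℝ)]
  simp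

/-! ### Pullback of forms -/

lemma pull_realForm (A : V →L[ℝ] V) (α : V →L[ℝ] ℝ) : pull A (realForm α) = realForm (α ∘L A) := by
  change (Algebra.TensorProduct.map (AlgHom.id ℂ ℂ)
    (ExteriorAlgebra.map ((ContinuousLinearMap.compL ℝ V V ℝ).flip A).toLinearMap))
      ((1 : ℂ) ⊗ₜ[ℝ] ExteriorAlgebra.ι ℝ α) = (1 : ℂ) ⊗ₜ[ℝ] ExteriorAlgebra.ι ℝ (α ∘L A)
  rw [Algebra.TensorProduct.map_tmul, ExteriorAlgebra.map_apply_ι]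
  rfl

lemma pull_pull (A B : V →L[ℝ] V) (w : FormAlg V) : pull A (pull B w) = pull (B ∘L A) w := by
  induction w using formAlg_induction with
  | scalar z => simp
  | form α => rw [pull_realForm, pull_realForm, pull_realForm]; rfl
  | mul u w hu hw => rw [map_mul, map_mul, map_mul, hu, hw]
  | add u w hu hw => rw [map_add, map_add, map_add, hu, hw]

lemma pull_id (w : FormAlg V) : pull (ContinuousLinearMap.id ℝ V) w = w := by
  induction w using formAlg_induction with
  | scalar z => simp
  | form α => rw [pull_realForm]; rfl
  | mul u w hu hw => rw [map_mul, hu, hw]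
  | add u w hu hw => rw [map_add, hu, hw]

/-- Pullback as a continuous linear map. -/
def pullL (A : V →L[ℝ] V) : FormAlg V →L[ℂ] FormAlg V :=
  LinearMap.toContinuousLinearMap (pull A).toLinearMap

@[simp] lemma pullL_apply (A : V →L[ℝ] V) (w : FormAlg V) : pullL A w = pull A w := rfl

instance : CompleteSpace (FormAlg V) := FiniteDimensional.complete ℂ (FormAlg V)

lemma contDiff_pull_apply (w : FormAlg V) : ContDiff ℝ ∞ fun A : V →L[ℝ] V => pull A w := by
  induction w using formAlg_induction with
  | scalar z => simpa using contDiff_const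
  | form α =>
    simp only [pull_realForm]
    let L : (V →L[ℝ] V) →ₗ[ℝ] FormAlg V :=
      realFormLin ∘ₗ ((ContinuousLinearMap.compL ℝ V V ℝ) α).toLinearMap
    exact (LinearMap.toContinuousLinearMap L).contDiff
  | mul u w hu hw => simpa only [map_mul] using hu.mul hw
  | add u w hu hw => simpa only [map_add] using hu.add hw

/-- The pullback `A^* w` depends smoothly on `A` and `w` together. -/
lemma contDiff_pull : ContDiff ℝ ∞ fun z : (V →L[ℝ] V) × FormAlg V => pull z.1 z.2 := by
  let b := Module.finBasis ℂ (FormAlg V)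
  have : (fun z : (V →L[ℝ] V) × FormAlg V => pull z.1 z.2) =
      fun z => ∑ i, b.coord i z.2 • pull z.1 (b i) := by
    funext z
    conv_lhs => rw [← b.sum_repr z.2, map_sum]
    simp only [map_smul, Module.Basis.coord_apply]
  rw [this]
  refine ContDiff.sum fun i _ => ContDiff.fun_smul (𝕜 := ℝ) (𝕜' := ℂ) ?_
    ((contDiff_pull_apply (b i)).comp contDiff_fst)
  exact ((LinearMap.toContinuousLinearMap
    ((b.coord i).restrictScalars ℝ)).contDiff).comp contDiff_snd

/-! ### The parity automorphism -/

/-- The parity automorphism as an algebra homomorphism. -/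
def parityHom : FormAlg V →ₐ[ℂ] FormAlg V :=
  Algebra.TensorProduct.map (AlgHom.id ℂ ℂ)
    (CliffordAlgebra.involute (Q := (0 : QuadraticForm ℝ (V →L[ℝ] ℝ))))

@[simp] lemma parity_mul (u w : FormAlg V) : parity (u * w) = parity u * parity w :=
  map_mul parityHom u w

@[simp] lemma parity_one : parity (1 : FormAlg V) = 1 := map_one (parityHom (V := V))

@[simp] lemma parity_algebraMap (z : ℂ) :
    parity (algebraMap ℂ (FormAlg V) z) = algebraMap ℂ (FormAlg V) z := parityHom.commutes z

@[simp] lemma parity_realForm (α : V →L[ℝ] ℝ) : parity (realForm α) = -realForm α := by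
  change (Algebra.TensorProduct.map (AlgHom.id ℂ ℂ)
    (CliffordAlgebra.involute (Q := (0 : QuadraticForm ℝ (V →L[ℝ] ℝ)))))
      ((1 : ℂ) ⊗ₜ[ℝ] CliffordAlgebra.ι _ α) = -((1 : ℂ) ⊗ₜ[ℝ] CliffordAlgebra.ι _ α)
  rw [Algebra.TensorProduct.map_tmul, CliffordAlgebra.involute_ι, TensorProduct.tmul_neg]
  rfl

lemma parity_oneForm (α : V →L[ℝ] ℂ) : parity (oneForm α) = -oneForm α := by
  rw [oneForm_eq, map_add, map_smul, parity_realForm, parity_realForm, smul_neg, neg_add]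

lemma parity_pull (A : V →L[ℝ] V) (w : FormAlg V) : parity (pull A w) = pull A (parity w) := by
  induction w using formAlg_induction with
  | scalar z => simp
  | form α => simp [pull_realForm]
  | mul u w hu hw => simp [hu, hw]
  | add u w hu hw => simp [hu, hw]

lemma realForm_mul (α : V →L[ℝ] ℝ) (w : FormAlg V) :
    realForm α * w = parity w * realForm α := by
  induction w using formAlg_induction with
  | scalar z => rw [parity_algebraMap]; exact (Algebra.commutes z _).symm
  | form β => rw [parity_realForm, realForm_mul_swap, neg_mul]
  | mul u w hu hw => rw [← mul_assoc, hu, mul_assoc, hw, parity_mul, mul_assoc]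
  | add u w hu hw => rw [mul_add, hu, hw, map_add, add_mul]

/-- Even forms are central. -/
lemma mul_comm_of_even (u : FormAlg V) {w : FormAlg V} (hw : parity w = w) : u * w = w * u := by
  induction u using formAlg_induction with
  | scalar z => exact Algebra.commutes z w
  | form α => rw [realForm_mul, hw]
  | mul a b ha hb => rw [mul_assoc, hb, ← mul_assoc, ha, mul_assoc]
  | add a b ha hb => rw [add_mul, ha, hb, mul_add]

/-- Odd forms commute with all forms up to the parity automorphism. -/
lemma mul_comm_of_odd (u : FormAlg V) {w : FormAlg V} (hw : parity w = -w) :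
    u * w = w * parity u := by
  induction u using formAlg_induction with
  | scalar z => rw [parity_algebraMap]; exact Algebra.commutes z w
  | form α => rw [realForm_mul, hw, parity_realForm, neg_mul, mul_neg]
  | mul a b ha hb => rw [mul_assoc, hb, ← mul_assoc, ha, parity_mul, mul_assoc]
  | add a b ha hb => rw [add_mul, ha, hb, map_add, mul_add]

/-- The parity automorphism as a continuous linear map. -/
def parityL : FormAlg V →L[ℂ] FormAlg V := LinearMap.toContinuousLinearMap parity

@[simp] lemma parityL_apply (w : FormAlg V) : parityL w = parity w := rfl

/-! ### Components of a given degree -/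

lemma degProj_ofExterior (k : ℕ) (y : ExteriorAlgebra ℝ (V →L[ℝ] ℝ)) :
    degProj k (ofExterior y) =
      ofExterior (GradedAlgebra.proj (fun i : ℕ => ⋀[ℝ]^i (V →L[ℝ] ℝ)) k y) := rfl

lemma realForm_mem (α : V →L[ℝ] ℝ) : ExteriorAlgebra.ι ℝ α ∈ ⋀[ℝ]^1 (V →L[ℝ] ℝ) := by
  rw [ExteriorAlgebra.exteriorPower, pow_one]
  exact ⟨α, rfl⟩

lemma degProj_realForm_mul (k : ℕ) (α : V →L[ℝ] ℝ) (w : FormAlg V) :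
    degProj (k + 1) (realForm α * w) = realForm α * degProj k w := by
  induction w using formAlg_tensor_induction with
  | tmul y =>
    rw [← ofExterior_ι, ← map_mul, degProj_ofExterior, degProj_ofExterior, ← map_mul]
    congr 1
    rw [add_comm k 1, GradedAlgebra.proj_apply, GradedAlgebra.proj_apply]
    exact DirectSum.coe_decompose_mul_add_of_left_mem _ (realForm_mem α)
  | smul z w hw => rw [mul_smul_comm, map_smul, hw, map_smul, mul_smul_comm]
  | add u w hu hw => rw [mul_add, map_add, hu, hw, map_add, mul_add]

/-- The component of degree `i + j` of a product with a `j`-form on the right only involves the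
component of degree `i` on the left. -/
lemma degProj_mul_degProj (i j : ℕ) (u w : FormAlg V) :
    degProj (i + j) (u * degProj j w) = degProj i u * degProj j w := by
  induction w using formAlg_tensor_induction with
  | tmul y =>
    induction u using formAlg_tensor_induction with
    | tmul x =>
      rw [degProj_ofExterior, degProj_ofExterior, ← map_mul, degProj_ofExterior, ← map_mul]
      congr 1
      simp only [GradedAlgebra.proj_apply]
      exact DirectSum.coe_decompose_mul_add_of_right_mem _ (SetLike.coe_mem _)
    | smul z w hw => rw [smul_mul_assoc, map_smul, hw, map_smul, smul_mul_assoc]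
    | add a b ha hb => rw [add_mul, map_add, ha, hb, map_add, add_mul]
  | smul z w hw => rw [map_smul, mul_smul_comm, map_smul, hw, mul_smul_comm]
  | add a b ha hb => rw [map_add, mul_add, map_add, ha, hb, mul_add]

lemma degProj_degProj (j k : ℕ) (w : FormAlg V) :
    degProj j (degProj k w) = if j = k then degProj k w else 0 := by
  induction w using formAlg_tensor_induction with
  | tmul y =>
    rw [degProj_ofExterior, degProj_ofExterior]
    split_ifs with h
    · subst h
      congr 1
      rw [GradedAlgebra.proj_apply]
      exact DirectSum.decompose_of_mem_same _ (SetLike.coe_mem _)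
    · rw [GradedAlgebra.proj_apply, GradedAlgebra.proj_apply,
        DirectSum.decompose_of_mem_ne _ (SetLike.coe_mem _) (Ne.symm h), map_zero]
  | smul z w hw => rw [map_smul, map_smul, hw]; split_ifs <;> simp
  | add a b ha hb => rw [map_add, map_add, ha, hb]; split_ifs <;> simp

/-- The automorphism `parity` is defined on the exterior algebra by `α ↦ -α`; on `k`-forms it is the
sign `(-1)^k`. -/
lemma parity_degProj (k : ℕ) (w : FormAlg V) :
    parity (degProj k w) = (-1 : ℂ) ^ k • degProj k w := by
  induction w using formAlg_tensor_induction with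
  | tmul y =>
    rw [degProj_ofExterior, GradedAlgebra.proj_apply]
    have hm := SetLike.coe_mem (DirectSum.decompose (fun i : ℕ => ⋀[ℝ]^i (V →L[ℝ] ℝ)) y k)
    revert hm
    generalize (DirectSum.decompose (fun i : ℕ => ⋀[ℝ]^i (V →L[ℝ] ℝ)) y k :
      ExteriorAlgebra ℝ (V →L[ℝ] ℝ)) = m
    intro hm
    rw [← ExteriorAlgebra.ιMulti_span_fixedDegree] at hm
    induction hm using Submodule.span_induction with
    | mem x hx =>
      obtain ⟨v, rfl⟩ := hx
      induction k with
      | zero => simp [ExteriorAlgebra.ιMulti_zero_apply]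
      | succ k ih =>
        rw [ExteriorAlgebra.ιMulti_succ_apply, map_mul, parity_mul, ih, ofExterior_ι,
          parity_realForm, pow_succ, mul_smul_comm, neg_mul, smul_neg, mul_neg_one, neg_smul]
    | zero => simp
    | add a b _ _ ha hb => rw [map_add, map_add, ha, hb, smul_add]
    | smul r a _ ha =>
      rw [Algebra.smul_def, map_mul, ofExterior_algebraMap, parity_mul, parity_algebraMap, ha,
        mul_smul_comm]
  | smul z w hw => rw [map_smul, map_smul, hw, smul_comm]
  | add a b ha hb => rw [map_add, map_add, ha, hb, smul_add]

lemma exteriorPower_eq_bot {k : ℕ} (hk : Module.finrank ℝ V < k) :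
    ⋀[ℝ]^k (V →L[ℝ] ℝ) = ⊥ := by
  rw [← ExteriorAlgebra.ιMulti_span_fixedDegree, Submodule.span_eq_bot]
  rintro _ ⟨v, rfl⟩
  refine AlternatingMap.map_linearDependent _ _ fun h => ?_
  have h1 := h.fintype_card_le_finrank
  have h2 : Module.finrank ℝ (V →L[ℝ] ℝ) = Module.finrank ℝ V := by
    rw [← LinearEquiv.finrank_eq (LinearMap.toContinuousLinearMap (𝕜 := ℝ) (E := V) (F' := ℝ))]
    exact Subspace.dual_finrank_eq
  rw [Fintype.card_fin, h2] at h1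
  omega

lemma degProj_eq_zero_of_lt {k : ℕ} (hk : Module.finrank ℝ V < k) (w : FormAlg V) :
    degProj k w = 0 := by
  induction w using formAlg_tensor_induction with
  | tmul y =>
    rw [degProj_ofExterior, GradedAlgebra.proj_apply]
    have hm := SetLike.coe_mem (DirectSum.decompose (fun i : ℕ => ⋀[ℝ]^i (V →L[ℝ] ℝ)) y k)
    have hm := (exteriorPower_eq_bot hk).le hm
    rw [Submodule.mem_bot] at hm
    rw [hm, map_zero]
  | smul z w hw => rw [map_smul, hw, smul_zero]
  | add a b ha hb => rw [map_add, ha, hb, add_zero]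

/-- All form degrees are bounded by the real dimension of `V`. -/
lemma sum_degProj (w : FormAlg V) :
    ∑ k ∈ Finset.range (Module.finrank ℝ V + 1), degProj k w = w := by
  induction w using formAlg_tensor_induction with
  | tmul y =>
    simp only [degProj_ofExterior, GradedAlgebra.proj_apply, ← map_sum]
    congr 1
    classical
    conv_rhs => rw [← DirectSum.sum_support_decompose (fun i : ℕ => ⋀[ℝ]^i (V →L[ℝ] ℝ)) y]
    symm
    refine Finset.sum_subset_zero_on_sdiff ?_ ?_ (fun _ _ => rfl)
    · intro k hk
      rw [Finset.mem_range, Nat.lt_succ_iff]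
      by_contra hlt
      have hm := SetLike.coe_mem (DirectSum.decompose (fun i : ℕ => ⋀[ℝ]^i (V →L[ℝ] ℝ)) y k)
      have hm := (exteriorPower_eq_bot (not_le.mp hlt)).le hm
      rw [Submodule.mem_bot] at hm
      rw [DFinsupp.mem_support_iff] at hk
      exact hk (Subtype.ext hm)
    · intro k hk
      have := (Finset.mem_sdiff.mp hk).2
      rw [DFinsupp.notMem_support_iff] at this
      rw [this]; rfl
  | smul z w hw => simp only [map_smul, ← Finset.smul_sum, hw]
  | add a b ha hb => simp only [map_add, Finset.sum_add_distrib, ha, hb]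

lemma degProj_algebraMap (k : ℕ) (z : ℂ) :
    degProj k (algebraMap ℂ (FormAlg V) z) = if k = 0 then algebraMap ℂ (FormAlg V) z else 0 := by
  have h1 : (1 : ExteriorAlgebra ℝ (V →L[ℝ] ℝ)) ∈ ⋀[ℝ]^0 (V →L[ℝ] ℝ) := by
    rw [ExteriorAlgebra.exteriorPower, pow_zero]; exact Submodule.one_le.mp le_rfl
  rw [Algebra.algebraMap_eq_smul_one, map_smul, ← map_one ofExterior, degProj_ofExterior,
    GradedAlgebra.proj_apply]
  split_ifs with h
  · subst h
    rw [DirectSum.decompose_of_mem_same (fun i : ℕ => ⋀[ℝ]^i (V →L[ℝ] ℝ)) h1]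
  · rw [DirectSum.decompose_of_mem_ne (fun i : ℕ => ⋀[ℝ]^i (V →L[ℝ] ℝ)) h1 (Ne.symm h), map_zero, smul_zero]

lemma degProj_zero_mem (w : FormAlg V) : ∃ z : ℂ, degProj 0 w = algebraMap ℂ (FormAlg V) z := by
  induction w using formAlg_tensor_induction with
  | tmul y =>
    rw [degProj_ofExterior, GradedAlgebra.proj_apply]
    have hm := SetLike.coe_mem (DirectSum.decompose (fun i : ℕ => ⋀[ℝ]^i (V →L[ℝ] ℝ)) y 0)
    have hm := (pow_zero (ExteriorAlgebra.ι ℝ (M := V →L[ℝ] ℝ)).range).le hm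
    rw [Submodule.mem_one] at hm
    obtain ⟨r, hr⟩ := hm
    exact ⟨r, by rw [← hr, ofExterior_algebraMap]⟩
  | smul z w hw => obtain ⟨c, hc⟩ := hw; exact ⟨z * c, by rw [map_smul, hc, map_mul, Algebra.smul_def]⟩
  | add a b ha hb =>
    obtain ⟨c, hc⟩ := ha
    obtain ⟨d, hd⟩ := hb
    exact ⟨c + d, by rw [map_add, hc, hd, map_add]⟩

/-- A form all of whose components of positive degree vanish is a scalar. -/
lemma exists_scalar_of_degProj {w : FormAlg V} (h : ∀ k ≠ 0, degProj k w = 0) :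
    ∃ z : ℂ, w = algebraMap ℂ (FormAlg V) z := by
  obtain ⟨z, hz⟩ := degProj_zero_mem w
  refine ⟨z, ?_⟩
  rw [← hz]
  conv_lhs => rw [← sum_degProj w]
  rw [Finset.sum_eq_single 0 (fun k _ hk => h k hk) (fun h0 => (h0 (by simp)).elim)]

/-- The sign of a form of bidegree `(p, q)` under the parity automorphism is `(-1)^{p+q}`. -/
lemma parity_of_mem_bideg {p q : ℕ} {w : FormAlg V} (hw : w ∈ bideg V p q) :
    parity w = (-1 : ℂ) ^ (p + q) • w := by
  have key : ∀ (S : Set (V →L[ℝ] ℂ)) (n : ℕ), ∀ u ∈ (Submodule.span ℂ (oneForm '' S)) ^ n,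
      parity u = (-1 : ℂ) ^ n • u := by
    intro S n
    induction n with
    | zero =>
      intro u hu
      rw [pow_zero, Submodule.mem_one] at hu
      obtain ⟨z, rfl⟩ := hu
      simp
    | succ n ih =>
      intro u hu
      rw [pow_succ] at hu
      induction hu using Submodule.mul_induction_on' with
      | mem_mul_mem a ha b hb =>
        have hb' : parity b = -b := by
          induction hb using Submodule.span_induction with
          | mem x hx => obtain ⟨α, _, rfl⟩ := hx; exact parity_oneForm α
          | zero => simp
          | add x y _ _ hx hy => rw [map_add, hx, hy, neg_add]
          | smul r x _ hx => rw [map_smul, hx, smul_neg]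
        rw [parity_mul, ih a ha, hb', smul_mul_assoc, mul_neg, smul_neg, pow_succ, mul_neg_one,
          neg_smul]
      | add a _ b _ ha hb => rw [map_add, ha, hb, smul_add]
  induction hw using Submodule.mul_induction_on' with
  | mem_mul_mem a ha b hb =>
    rw [parity_mul, key _ p a ha, key _ q b hb, smul_mul_smul_comm, pow_add]
  | add a _ b _ ha hb => rw [map_add, ha, hb, smul_add]

end FormAlgebra

/-! ### The exterior derivative on a vector space -/

section FlatCalculus

open Filter Topology

variable {V : Type*} [NormedAddCommGroup V] [NormedSpace ℂ V] [FiniteDimensional ℂ V]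

/-- The covectors dual to the real basis of `V` that enters the definition of `wedgeL`. -/
def coordForm (i : Fin (Module.finrank ℝ V)) : V →L[ℝ] ℝ :=
  LinearMap.toContinuousLinearMap ((Module.finBasis ℝ V).coord i)

lemma wedgeL_eq (L : V →L[ℝ] FormAlg V) :
    wedgeL L = ∑ i, realForm (coordForm i) * L (Module.finBasis ℝ V i) := by
  simp only [wedgeL, coordForm, oneForm_ofReal]

/-- The expansion of a covector in the dual basis. -/
lemma realForm_eq_sum (α : V →L[ℝ] ℝ) :
    realForm α = ∑ i, (α (Module.finBasis ℝ V i) : ℂ) • realForm (coordForm i) := by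
  have h : α = ∑ i, α (Module.finBasis ℝ V i) • coordForm i := by
    ext v
    conv_lhs => rw [← (Module.finBasis ℝ V).sum_repr v, map_sum]
    simp [coordForm, mul_comm]
  conv_lhs => rw [h]
  rw [show realForm (∑ i, α (Module.finBasis ℝ V i) • coordForm i) =
    realFormLin (∑ i, α (Module.finBasis ℝ V i) • coordForm i) from rfl, map_sum]
  exact Finset.sum_congr rfl fun i _ => realForm_smul _ _

lemma wedgeL_add (L M : V →L[ℝ] FormAlg V) : wedgeL (L + M) = wedgeL L + wedgeL M := by
  simp [wedgeL_eq, mul_add, Finset.sum_add_distrib]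

lemma wedgeL_smul (c : ℂ) (L : V →L[ℝ] FormAlg V) : wedgeL (c • L) = c • wedgeL L := by
  simp [wedgeL_eq, Finset.smul_sum]

/-- Exterior multiplication as a continuous linear map. -/
def wedgeCLM : (V →L[ℝ] FormAlg V) →L[ℝ] FormAlg V :=
  ∑ i, (ContinuousLinearMap.mul ℝ (FormAlg V) (realForm (coordForm i))) ∘L
    (ContinuousLinearMap.apply ℝ (FormAlg V) (Module.finBasis ℝ V i))

@[simp] lemma wedgeCLM_apply (L : V →L[ℝ] FormAlg V) : wedgeCLM L = wedgeL L := by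
  simp [wedgeCLM, wedgeL_eq]

/-- Exterior multiplication kills symmetric bilinear maps. -/
lemma sum_wedge_symm (B : Fin (Module.finrank ℝ V) → Fin (Module.finrank ℝ V) → FormAlg V)
    (hB : ∀ i j, B i j = B j i) :
    ∑ i, ∑ j, realForm (coordForm i) * (realForm (coordForm j) * B i j) = 0 := by
  have h : ∑ i, ∑ j, realForm (coordForm i) * (realForm (coordForm j) * B i j) =
      -∑ i, ∑ j, realForm (coordForm i) * (realForm (coordForm j) * B i j) := by
    conv_lhs => rw [Finset.sum_comm]
    rw [← Finset.sum_neg_distrib]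
    refine Finset.sum_congr rfl fun i _ => ?_
    rw [← Finset.sum_neg_distrib]
    refine Finset.sum_congr rfl fun j _ => ?_
    rw [hB j i, ← mul_assoc, ← mul_assoc, realForm_mul_swap, neg_mul]
  rw [eq_neg_iff_add_eq_zero, ← two_smul ℂ] at h
  exact (smul_eq_zero.mp h).resolve_left two_ne_zero

/-- The exterior derivative of a form on the vector space `V`. -/
def flatD (g : V → FormAlg V) (y : V) : FormAlg V := wedgeL (fderiv ℝ g y)

lemma flatD_congr {g h : V → FormAlg V} {y : V} (hgh : g =ᶠ[𝓝 y] h) : flatD g y = flatD h y := by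
  rw [flatD, flatD, hgh.fderiv_eq]

lemma flatD_add {g h : V → FormAlg V} {y : V} (hg : DifferentiableAt ℝ g y)
    (hh : DifferentiableAt ℝ h y) : flatD (g + h) y = flatD g y + flatD h y := by
  rw [flatD, fderiv_add hg hh, wedgeL_add]; rfl

lemma flatD_mul {g h : V → FormAlg V} {y : V} (hg : DifferentiableAt ℝ g y)
    (hh : DifferentiableAt ℝ h y) :
    flatD (g * h) y = flatD g y * h y + parity (g y) * flatD h y := by
  rw [flatD, (hg.hasFDerivAt.mul' hh.hasFDerivAt).fderiv, flatD, flatD]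
  simp only [wedgeL_eq, Finset.sum_mul, Finset.mul_sum, ← Finset.sum_add_distrib]
  refine Finset.sum_congr rfl fun i _ => ?_
  simp only [add_apply, smul_apply, smul_eq_mul, MulOpposite.smul_eq_mul_unop,
    MulOpposite.unop_op, mul_add]
  rw [← mul_assoc, ← mul_assoc, ← mul_assoc, realForm_mul, add_comm]

lemma fderiv_complexLinear_comp (S : FormAlg V →L[ℂ] FormAlg V) {g : V → FormAlg V} {y : V}
    (hg : DifferentiableAt ℝ g y) :
    fderiv ℝ (fun z => S (g z)) y = (S.restrictScalars ℝ) ∘L fderiv ℝ g y :=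
  ((S.restrictScalars ℝ).hasFDerivAt.comp y hg.hasFDerivAt).fderiv

lemma flatD_parity {g : V → FormAlg V} {y : V} (hg : DifferentiableAt ℝ g y) :
    flatD (fun z => parity (g z)) y = -parity (flatD g y) := by
  have h := fderiv_complexLinear_comp parityL hg
  simp only [parityL_apply] at h
  rw [flatD, h, flatD, wedgeL_eq, wedgeL_eq, map_sum, ← Finset.sum_neg_distrib]
  refine Finset.sum_congr rfl fun i _ => ?_
  rw [parity_mul, parity_realForm, neg_mul, neg_neg]
  rfl

lemma flatD_degProj (k : ℕ) {g : V → FormAlg V} {y : V} (hg : DifferentiableAt ℝ g y) :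
    flatD (fun z => degProj k (g z)) y = degProj (k + 1) (flatD g y) := by
  have h := fderiv_complexLinear_comp (LinearMap.toContinuousLinearMap (degProj (V := V) k)) hg
  simp only [LinearMap.coe_toContinuousLinearMap'] at h
  rw [flatD, h, flatD, wedgeL_eq, wedgeL_eq, map_sum]
  refine Finset.sum_congr rfl fun i _ => ?_
  rw [degProj_realForm_mul]
  rfl

lemma minSmoothness_two_le : minSmoothness ℝ 2 ≤ (∞ : WithTop ℕ∞) := by
  rw [minSmoothness_of_isRCLikeNormedField]
  exact WithTop.coe_le_coe.mpr le_top

/-- The second derivative is symmetric, so it is killed by exterior multiplication. -/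
lemma flatD_flatD {g : V → FormAlg V} {y : V} (hg : ContDiffAt ℝ ∞ g y) :
    flatD (flatD g) y = 0 := by
  have hs := hg.isSymmSndFDerivAt minSmoothness_two_le
  have hd : DifferentiableAt ℝ (fderiv ℝ g) y :=
    (hg.fderiv_right (m := 1) (by exact WithTop.coe_le_coe.mpr le_top)).differentiableAt (by simp)
  have h1 : fderiv ℝ (flatD g) y = wedgeCLM ∘L fderiv ℝ (fderiv ℝ g) y := by
    have : flatD g = fun z => wedgeCLM (fderiv ℝ g z) := by funext z; simp [flatD]
    rw [this]
    exact (wedgeCLM.hasFDerivAt.comp y hd.hasFDerivAt).fderiv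
  rw [flatD, h1, wedgeL_eq]
  simp only [ContinuousLinearMap.comp_apply, wedgeCLM_apply, wedgeL_eq, Finset.mul_sum]
  exact sum_wedge_symm (fun i j => fderiv ℝ (fderiv ℝ g) y (Module.finBasis ℝ V i)
    (Module.finBasis ℝ V j)) fun i j => hs _ _

lemma differentiableAt_pull_fderiv {τ : V → V} {y : V} (hτ : ContDiffAt ℝ ∞ τ y)
    (w : FormAlg V) : DifferentiableAt ℝ (fun z => pull (fderiv ℝ τ z) w) y := by
  have hd : DifferentiableAt ℝ (fderiv ℝ τ) y :=
    (hτ.fderiv_right (m := 1) (by exact WithTop.coe_le_coe.mpr le_top)).differentiableAt (by simp)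
  exact (((contDiff_pull_apply w).differentiable (by simp)) _).comp y hd

/-- The pullback of a constant form is closed. On covectors this is the symmetry of the second
derivative of `τ`; the general case follows since forms are generated by covectors. -/
lemma flatD_pull_const {τ : V → V} {y : V} (hτ : ContDiffAt ℝ ∞ τ y) (w : FormAlg V) :
    flatD (fun z => pull (fderiv ℝ τ z) w) y = 0 := by
  induction w using formAlg_induction with
  | scalar z =>
    simp only [AlgHom.commutes]
    rw [flatD, fderiv_fun_const]
    simp [wedgeL_eq]
  | form α =>
    have hs := hτ.isSymmSndFDerivAt minSmoothness_two_le
    have hd : DifferentiableAt ℝ (fderiv ℝ τ) y :=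
      (hτ.fderiv_right (m := 1) (by exact WithTop.coe_le_coe.mpr le_top)).differentiableAt
        (by simp)
    simp only [pull_realForm]
    let L : (V →L[ℝ] V) →L[ℝ] FormAlg V := LinearMap.toContinuousLinearMap
      (realFormLin ∘ₗ ((ContinuousLinearMap.compL ℝ V V ℝ) α).toLinearMap)
    have h1 : fderiv ℝ (fun z => realForm (α ∘L fderiv ℝ τ z)) y =
        L ∘L fderiv ℝ (fderiv ℝ τ) y := (L.hasFDerivAt.comp y hd.hasFDerivAt).fderiv
    rw [flatD, h1, wedgeL_eq]
    have h2 : ∀ B, L B = realForm (α ∘L B) := fun _ => rfl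
    simp only [ContinuousLinearMap.comp_apply, h2]
    have h3 : ∀ i, realForm (coordForm i) *
        realForm (α ∘L fderiv ℝ (fderiv ℝ τ) y (Module.finBasis ℝ V i)) =
        ∑ j, realForm (coordForm i) * (realForm (coordForm j) *
          algebraMap ℂ _ (α (fderiv ℝ (fderiv ℝ τ) y (Module.finBasis ℝ V i)
            (Module.finBasis ℝ V j)))) := by
      intro i
      rw [realForm_eq_sum (α ∘L _), Finset.mul_sum]
      refine Finset.sum_congr rfl fun j _ => ?_
      rw [Algebra.smul_def, Algebra.commutes]
      rfl
    rw [Finset.sum_congr rfl fun i _ => h3 i]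
    exact sum_wedge_symm (fun i j => algebraMap ℂ _ (α (fderiv ℝ (fderiv ℝ τ) y
      (Module.finBasis ℝ V i) (Module.finBasis ℝ V j)) : ℂ)) fun i j => by rw [hs]
  | mul u w hu hw =>
    simp only [map_mul]
    have := flatD_mul (differentiableAt_pull_fderiv hτ u) (differentiableAt_pull_fderiv hτ w)
    rw [hu, hw, zero_mul, mul_zero, add_zero] at this
    exact this
  | add u w hu hw =>
    simp only [map_add]
    have := flatD_add (differentiableAt_pull_fderiv hτ u) (differentiableAt_pull_fderiv hτ w)
    rw [hu, hw, add_zero] at this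
    exact this

/-- Exterior multiplication is natural under linear changes of coordinates. -/
lemma wedgeL_comp (A : V →L[ℝ] V) (L : V →L[ℝ] FormAlg V) :
    wedgeL (((pullL A).restrictScalars ℝ) ∘L L ∘L A) = pull A (wedgeL L) := by
  simp only [wedgeL_eq, map_sum, map_mul, pull_realForm, ContinuousLinearMap.comp_apply]
  have h1 : ∀ i, A (Module.finBasis ℝ V i) =
      ∑ j, coordForm j (A (Module.finBasis ℝ V i)) • Module.finBasis ℝ V j := fun i =>
    ((Module.finBasis ℝ V).sum_repr _).symm
  have h2 : ∀ i, realForm (coordForm i) * ((pullL A).restrictScalars ℝ)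
      (L (A (Module.finBasis ℝ V i))) = ∑ j, (coordForm j (A (Module.finBasis ℝ V i)) : ℂ) •
        (realForm (coordForm i) * pull A (L (Module.finBasis ℝ V j))) := by
    intro i
    conv_lhs => rw [h1 i]
    simp only [map_sum, map_smul, Finset.mul_sum, mul_smul_comm]
    rfl
  rw [Finset.sum_congr rfl fun i _ => h2 i, Finset.sum_comm]
  refine Finset.sum_congr rfl fun j _ => ?_
  rw [realForm_eq_sum (coordForm j ∘L A), Finset.sum_mul]
  refine Finset.sum_congr rfl fun i _ => ?_
  rw [smul_mul_assoc]
  rfl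

/-- The exterior derivative commutes with the pullback along a smooth map. -/
lemma flatD_pull {τ : V → V} {y : V} (hτ : ContDiffAt ℝ ∞ τ y) {g : V → FormAlg V}
    (hg : DifferentiableAt ℝ g (τ y)) :
    flatD (fun z => pull (fderiv ℝ τ z) (g (τ z))) y = pull (fderiv ℝ τ y) (flatD g (τ y)) := by
  have hd : DifferentiableAt ℝ (fderiv ℝ τ) y :=
    (hτ.fderiv_right (m := 1) (by exact WithTop.coe_le_coe.mpr le_top)).differentiableAt (by simp)
  have hτd : DifferentiableAt ℝ τ y := hτ.differentiableAt (by simp)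
  have hΦ := (contDiff_pull (V := V)).differentiable (by simp) (fderiv ℝ τ y, g (τ y))
  have hw : DifferentiableAt ℝ (fun z => g (τ z)) y := hg.comp y hτd
  -- The product rule: the term that differentiates the pullback is closed by `flatD_pull_const`.
  have e1 : fderiv ℝ (fun z => pull (fderiv ℝ τ z) (g (τ z))) y =
      fderiv ℝ (fun z => pull (fderiv ℝ τ z) (g (τ y))) y +
        ((pullL (fderiv ℝ τ y)).restrictScalars ℝ) ∘L fderiv ℝ g (τ y) ∘L fderiv ℝ τ y := by
    have a1 := (hΦ.hasFDerivAt.comp y (hd.hasFDerivAt.prodMk hw.hasFDerivAt)).fderiv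
    have a2 := (hΦ.hasFDerivAt.comp y (hd.hasFDerivAt.prodMk
      (hasFDerivAt_const (g (τ y)) y))).fderiv
    have a3 := (hΦ.hasFDerivAt.comp (g (τ y)) ((hasFDerivAt_const (fderiv ℝ τ y) (g (τ y))).prodMk
      (hasFDerivAt_id (g (τ y)))))
    have a4 := (((pullL (fderiv ℝ τ y)).restrictScalars ℝ).hasFDerivAt (x := g (τ y))).unique a3
    have a5 : fderiv ℝ (fun z => g (τ z)) y = fderiv ℝ g (τ y) ∘L fderiv ℝ τ y :=
      fderiv_comp y hg hτd
    change fderiv ℝ ((fun z : (V →L[ℝ] V) × FormAlg V => pull z.1 z.2) ∘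
      fun z => (fderiv ℝ τ z, g (τ z))) y = fderiv ℝ ((fun z : (V →L[ℝ] V) × FormAlg V =>
        pull z.1 z.2) ∘ fun z => (fderiv ℝ τ z, g (τ y))) y + _
    rw [a1, a2, a4, a5]
    ext v
    simp only [ContinuousLinearMap.comp_apply, ContinuousLinearMap.prod_apply, add_apply,
      zero_apply, ContinuousLinearMap.id_apply, ← map_add, Prod.mk_add_mk, add_zero, zero_add]
  rw [flatD, e1, wedgeL_add, wedgeL_comp]
  have := flatD_pull_const hτ (g (τ y))
  rw [flatD] at this
  rw [this, zero_add]
  rfl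

end FlatCalculus

/-! ### The exterior derivative on a complex manifold -/

section ManifoldCalculus

open Filter Topology

variable {V : Type*} [NormedAddCommGroup V] [NormedSpace ℂ V] [FiniteDimensional ℂ V]
variable {X : Type*} [TopologicalSpace X] [ChartedSpace V X] [IsManifold 𝓘(ℂ, V) ω X]

lemma contDiffOn_transition {e e' : OpenPartialHomeomorph X V} (he : e ∈ atlas V X)
    (he' : e' ∈ atlas V X) : ContDiffOn ℝ ∞ (e' ∘ e.symm) (e.symm ≫ₕ e').source := by
  have h := StructureGroupoid.compatible (contDiffGroupoid ω 𝓘(ℂ, V)) he he'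
  have h2 := (contDiffGroupoid ω 𝓘(ℂ, V)).mem_of_eqOnSource h (Setoid.refl _)
  rw [contDiffGroupoid, mem_groupoid_of_pregroupoid] at h2
  have h3 : ContDiffOn ℂ ω (e' ∘ e.symm) (e.symm ≫ₕ e').source := by
    simpa [contDiffPregroupoid] using h2.1
  exact (h3.of_le le_top).restrict_scalars ℝ

/-- The real smooth structure underlying the complex structure. -/
instance isManifold_real : IsManifold 𝓘(ℝ, V) ∞ X :=
  isManifold_of_contDiffOn 𝓘(ℝ, V) ∞ X fun e e' he he' => by
    simpa using contDiffOn_transition he he'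

instance isManifold_real_one : IsManifold 𝓘(ℝ, V) 1 X := IsManifold.of_le (n := ∞) (by simp)

/-- The coordinate change from the chart at `p` to the chart at `q`. -/
def chartChange (p q : X) : V → V := chartAt V q ∘ (chartAt V p).symm

lemma contDiffAt_chartChange {p q : X} {y : V} (hy : y ∈ (chartAt V p).target)
    (hq : (chartAt V p).symm y ∈ (chartAt V q).source) :
    ContDiffAt ℝ ∞ (chartChange p q) y :=
  (contDiffOn_transition (chart_mem_atlas V p) (chart_mem_atlas V q)).contDiffAt
    (((chartAt V p).symm ≫ₕ chartAt V q).open_source.mem_nhds ⟨hy, hq⟩)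

lemma mfderiv_chart_symm {p : X} {y : V} (hy : y ∈ (chartAt V p).target) :
    mfderiv 𝓘(ℝ, V) 𝓘(ℝ, V) (chartAt V p).symm y =
      fderiv ℝ (chartChange p ((chartAt V p).symm y)) y := by
  have h := mdifferentiableAt_atlas_symm (I := 𝓘(ℝ, V)) (chart_mem_atlas V p) hy
  rw [h.mfderiv]
  simp only [writtenInExtChartAt, mfld_simps, fderivWithin_univ]
  rfl

lemma rep_eq {p : X} {y : V} (hy : y ∈ (chartAt V p).target) (η : X → FormAlg V) :
    rep p η y = pull (fderiv ℝ (chartChange p ((chartAt V p).symm y)) y)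
      (η ((chartAt V p).symm y)) := by
  rw [rep, mfderiv_chart_symm hy]

/-- The expressions of a form in two charts differ by the pullback along the coordinate change. -/
lemma rep_change {p q : X} {y : V} (hy : y ∈ (chartAt V p).target)
    (hq : (chartAt V p).symm y ∈ (chartAt V q).source) (η : X → FormAlg V) :
    rep p η y = pull (fderiv ℝ (chartChange p q) y) (rep q η (chartChange p q y)) := by
  have hx : (chartAt V q).symm (chartChange p q y) = (chartAt V p).symm y := by
    simp only [chartChange, Function.comp_apply]
    exact (chartAt V q).left_inv hq
  have hy' : chartChange p q y ∈ (chartAt V q).target := (chartAt V q).map_source hq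
  rw [rep_eq hy, rep_eq hy', hx, pull_pull]
  congr 2
  rw [← fderiv_comp]
  · refine Filter.EventuallyEq.fderiv_eq ?_
    have := ((chartAt V p).symm ≫ₕ chartAt V q).open_source.mem_nhds ⟨hy, hq⟩
    filter_upwards [this] with z hz
    have hz2 : (chartAt V p).symm z ∈ (chartAt V q).source := hz.2
    simp only [chartChange, Function.comp_apply]
    rw [(chartAt V q).left_inv hz2]
  · refine (contDiffAt_chartChange hy' ?_).differentiableAt (by simp)
    rw [hx]
    exact mem_chart_source V _
  · exact (contDiffAt_chartChange hy hq).differentiableAt (by simp)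

lemma chartChange_self {p : X} {y : V} (hy : y ∈ (chartAt V p).target) :
    chartChange p p =ᶠ[𝓝 y] id := by
  filter_upwards [(chartAt V p).open_target.mem_nhds hy] with z hz
  exact (chartAt V p).right_inv hz

@[simp] lemma rep_self (x : X) (η : X → FormAlg V) : rep x η (chartAt V x x) = η x := by
  have h := mem_chart_target V x
  rw [rep_eq h, (chartAt V x).left_inv (mem_chart_source V x), (chartChange_self h).fderiv_eq,
    fderiv_id, pull_id]

lemma rep_congr {p x : X} (hx : x ∈ (chartAt V p).source) {η τ : X → FormAlg V}
    (h : η =ᶠ[𝓝 x] τ) : rep p η =ᶠ[𝓝 (chartAt V p x)] rep p τ := by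
  have hc := (chartAt V p).continuousAt_symm ((chartAt V p).map_source hx)
  rw [ContinuousAt, (chartAt V p).left_inv hx] at hc
  filter_upwards [hc.eventually h] with y hy
  rw [rep, rep, hy]

/-- Smoothness of a form at a point. -/
def SmAt (η : X → FormAlg V) (x : X) : Prop := ContDiffAt ℝ ∞ (rep x η) (chartAt V x x)

lemma SmAt.congr {x : X} {η τ : X → FormAlg V} (hη : SmAt η x) (h : η =ᶠ[𝓝 x] τ) : SmAt τ x :=
  ContDiffAt.congr_of_eventuallyEq hη (rep_congr (mem_chart_source V x) h.symm)

lemma mem_transition {p q x : X} (hp : x ∈ (chartAt V p).source)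
    (hq : x ∈ (chartAt V q).source) :
    chartAt V p x ∈ ((chartAt V p).symm ≫ₕ chartAt V q).source := by
  refine ⟨(chartAt V p).map_source hp, ?_⟩
  change (chartAt V p).symm (chartAt V p x) ∈ (chartAt V q).source
  rwa [(chartAt V p).left_inv hp]

lemma rep_eventuallyEq {p q x : X} (hp : x ∈ (chartAt V p).source)
    (hq : x ∈ (chartAt V q).source) (η : X → FormAlg V) :
    rep p η =ᶠ[𝓝 (chartAt V p x)]
      fun y => pull (fderiv ℝ (chartChange p q) y) (rep q η (chartChange p q y)) := by
  filter_upwards [((chartAt V p).symm ≫ₕ chartAt V q).open_source.mem_nhds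
    (mem_transition hp hq)] with y hy
  exact rep_change hy.1 hy.2 η

lemma chartChange_apply {p q x : X} (hp : x ∈ (chartAt V p).source) :
    chartChange p q (chartAt V p x) = chartAt V q x := by
  simp only [chartChange, Function.comp_apply]
  rw [(chartAt V p).left_inv hp]

lemma contDiffAt_chartChange' {p q x : X} (hp : x ∈ (chartAt V p).source)
    (hq : x ∈ (chartAt V q).source) : ContDiffAt ℝ ∞ (chartChange p q) (chartAt V p x) :=
  contDiffAt_chartChange ((chartAt V p).map_source hp) (by rwa [(chartAt V p).left_inv hp])

lemma contDiffAt_rep_change {p q x : X} (hp : x ∈ (chartAt V p).source)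
    (hq : x ∈ (chartAt V q).source) {η : X → FormAlg V} {n : ℕ∞}
    (h : ContDiffAt ℝ n (rep q η) (chartAt V q x)) :
    ContDiffAt ℝ n (rep p η) (chartAt V p x) := by
  refine ContDiffAt.congr_of_eventuallyEq ?_ (rep_eventuallyEq hp hq η)
  have hτ := contDiffAt_chartChange' hp hq
  have h1 : ContDiffAt ℝ n (fderiv ℝ (chartChange p q)) (chartAt V p x) :=
    hτ.fderiv_right (m := n) (by exact_mod_cast (le_top : n + 1 ≤ ⊤))
  have h2 : ContDiffAt ℝ n (fun y => rep q η (chartChange p q y)) (chartAt V p x) := by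
    have h0 : ContDiffAt ℝ n (chartChange p q) (chartAt V p x) :=
      hτ.of_le (by exact_mod_cast (le_top : n ≤ ⊤))
    refine ContDiffAt.comp (chartAt V p x) (g := Cohesive.rep q η) ?_ h0
    rwa [chartChange_apply hp]
  have h3 : ContDiffAt ℝ n (fun z : (V →L[ℝ] V) × FormAlg V => pull z.1 z.2)
      (fderiv ℝ (chartChange p q) (chartAt V p x), rep q η (chartChange p q (chartAt V p x))) :=
    (contDiff_pull (V := V)).contDiffAt.of_le (by exact_mod_cast (le_top : n ≤ ⊤))
  exact ContDiffAt.comp (chartAt V p x) h3 (h1.prodMk h2)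

lemma SmAt.rep {x p : X} (hp : x ∈ (chartAt V p).source) {η : X → FormAlg V} (h : SmAt η x) :
    ContDiffAt ℝ ∞ (rep p η) (chartAt V p x) :=
  contDiffAt_rep_change hp (mem_chart_source V x) h

lemma SmAt.of_isSmoothOn {η : X → FormAlg V} {U : Set X} (h : IsSmoothOn η U) (hU : IsOpen U)
    {x : X} (hx : x ∈ U) : SmAt η x :=
  (h x).contDiffAt (((chartAt V x).isOpen_inter_preimage_symm hU).mem_nhds
    ⟨mem_chart_target V x, by rwa [Set.mem_preimage, (chartAt V x).left_inv (mem_chart_source V x)]⟩)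

lemma isSmoothOn_of_smAt {η : X → FormAlg V} {U : Set X} (h : ∀ x ∈ U, SmAt η x) :
    IsSmoothOn η U := by
  intro p y hy
  have h1 := (h _ hy.2).rep ((chartAt V p).map_target hy.1)
  rw [(chartAt V p).right_inv hy.1] at h1
  exact h1.contDiffWithinAt

lemma mem_smoothForms_iff {η : X → FormAlg V} : η ∈ smoothForms V X ↔ ∀ x, SmAt η x :=
  ⟨fun h _ => SmAt.of_isSmoothOn h isOpen_univ (Set.mem_univ _),
    fun h => isSmoothOn_of_smAt fun x _ => h x⟩

lemma SmAt.add {η τ : X → FormAlg V} {x : X} (h : SmAt η x) (h' : SmAt τ x) :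
    SmAt (η + τ) x := by
  rw [SmAt, rep_add]; exact ContDiffAt.add h h'

lemma SmAt.mul {η τ : X → FormAlg V} {x : X} (h : SmAt η x) (h' : SmAt τ x) :
    SmAt (η * τ) x := by
  rw [SmAt, rep_mul]; exact ContDiffAt.mul h h'

lemma SmAt.smul {η : X → FormAlg V} {x : X} (c : ℂ) (h : SmAt η x) : SmAt (c • η) x := by
  rw [SmAt, rep_smul]; exact ContDiffAt.const_smul c h

lemma smAt_const_algebraMap (z : ℂ) (x : X) : SmAt (fun _ : X => algebraMap ℂ (FormAlg V) z) x := by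
  have : rep x (fun _ : X => algebraMap ℂ (FormAlg V) z) = fun _ => algebraMap ℂ (FormAlg V) z := by
    funext y; simp [Cohesive.rep]
  rw [SmAt, this]
  exact contDiffAt_const

lemma SmAt.zero {x : X} : SmAt (0 : X → FormAlg V) x := by
  simpa using! smAt_const_algebraMap (V := V) 0 x

lemma SmAt.sum {ι : Type*} (s : Finset ι) {η : ι → X → FormAlg V} {x : X}
    (h : ∀ i ∈ s, SmAt (η i) x) : SmAt (fun x' => ∑ i ∈ s, η i x') x := by
  classical
  induction s using Finset.induction_on with
  | empty => simpa using! SmAt.zero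
  | insert i s hi ih =>
    have : (fun x' => ∑ j ∈ insert i s, η j x') = η i + fun x' => ∑ j ∈ s, η j x' := by
      funext x'; simp [Finset.sum_insert hi]
    rw [this]
    exact (h i (Finset.mem_insert_self i s)).add
      (ih fun j hj => h j (Finset.mem_insert_of_mem hj))

lemma rep_parity (p : X) (η : X → FormAlg V) :
    rep p (fun x => parity (η x)) = fun y => parity (rep p η y) := by
  funext y; exact (parity_pull _ _).symm

lemma SmAt.parity {η : X → FormAlg V} {x : X} (h : SmAt η x) :
    SmAt (fun x' => parity (η x')) x := by
  rw [SmAt, rep_parity]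
  exact (((parityL (V := V)).restrictScalars ℝ).contDiff.contDiffAt).comp _ h

lemma rep_degProj (k : ℕ) (p : X) (η : X → FormAlg V) :
    rep p (fun x => degProj k (η x)) = fun y => degProj k (rep p η y) := by
  funext y; exact (degProj_pull k _ _).symm

/-- A complex valued function, viewed as a form of degree zero. -/
def funForm (g : X → ℂ) : X → FormAlg V := fun x => algebraMap ℂ (FormAlg V) (g x)

lemma smAt_funForm {g : X → ℂ} {x : X} (h : ContMDiffAt 𝓘(ℝ, V) 𝓘(ℝ, ℂ) ∞ g x) :
    SmAt (funForm (V := V) g) x := by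
  have h1 : rep x (funForm (V := V) g) =
      fun y => ((Algebra.linearMap ℂ (FormAlg V)).restrictScalars ℝ).toContinuousLinearMap
        (g ((chartAt V x).symm y)) := by
    funext y; simp [Cohesive.rep, funForm]
  have h2 := (contMDiffAt_iff.mp h).2
  simp only [mfld_simps, contDiffWithinAt_univ] at h2
  rw [SmAt, h1]
  exact (ContinuousLinearMap.contDiff _).contDiffAt.comp _ h2

lemma SmAt.differentiableAt {η : X → FormAlg V} {x p : X} (hp : x ∈ (chartAt V p).source)
    (h : SmAt η x) : DifferentiableAt ℝ (Cohesive.rep p η) (chartAt V p x) :=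
  (h.rep hp).differentiableAt (by simp)

/-- The exterior derivative can be computed in any chart. -/
lemma rep_extD {p x : X} (hp : x ∈ (chartAt V p).source) {η : X → FormAlg V}
    (h : DifferentiableAt ℝ (rep p η) (chartAt V p x)) :
    rep p (extD η) (chartAt V p x) = flatD (rep p η) (chartAt V p x) := by
  have hx := mem_chart_source V x
  have hy := (chartAt V p).map_source hp
  have e1 : extD η x = pull (fderiv ℝ (chartChange x p) (chartAt V x x))
      (flatD (rep p η) (chartAt V p x)) := by
    change flatD (rep x η) (chartAt V x x) = _
    rw [flatD_congr (rep_eventuallyEq hx hp η), flatD_pull (contDiffAt_chartChange' hx hp),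
      chartChange_apply hx]
    rwa [chartChange_apply hx]
  rw [rep_eq hy, (chartAt V p).left_inv hp, e1, pull_pull]
  have e2 : fderiv ℝ (chartChange x p) (chartAt V x x) ∘L
      fderiv ℝ (chartChange p x) (chartAt V p x) = ContinuousLinearMap.id ℝ V := by
    rw [← chartChange_apply hp (q := x), ← fderiv_comp]
    · rw [← fderiv_id (𝕜 := ℝ) (x := chartAt V p x)]
      refine Filter.EventuallyEq.fderiv_eq ?_
      filter_upwards [((chartAt V p).symm ≫ₕ chartAt V x).open_source.mem_nhds
        (mem_transition hp hx)] with z hz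
      have hz2 : (chartAt V p).symm z ∈ (chartAt V x).source := hz.2
      simp only [chartChange, Function.comp_apply]
      rw [(chartAt V x).left_inv hz2]
      exact (chartAt V p).right_inv hz.1
    · rw [chartChange_apply hp]
      exact (contDiffAt_chartChange' hx hp).differentiableAt (by simp)
    · exact (contDiffAt_chartChange' hp hx).differentiableAt (by simp)
  rw [e2, pull_id]

lemma rep_extD_eventuallyEq {x : X} {η : X → FormAlg V} (h : SmAt η x) :
    rep x (extD η) =ᶠ[𝓝 (chartAt V x x)] flatD (rep x η) := by
  have h1 : ∀ᶠ y in 𝓝 (chartAt V x x), DifferentiableAt ℝ (rep x η) y := by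
    have h2 : ContDiffAt ℝ 1 (rep x η) (chartAt V x x) := ContDiffAt.of_le h (by simp)
    filter_upwards [h2.eventually (by simp)] with y hy
    exact hy.differentiableAt (by simp)
  filter_upwards [h1, (chartAt V x).open_target.mem_nhds (mem_chart_target V x)] with y hy hy'
  have h3 := rep_extD (p := x) (x := (chartAt V x).symm y) ((chartAt V x).map_target hy')
    (η := η) (by rwa [(chartAt V x).right_inv hy'])
  rwa [(chartAt V x).right_inv hy'] at h3

lemma SmAt.extD {η : X → FormAlg V} {x : X} (h : SmAt η x) : SmAt (extD η) x := by
  refine ContDiffAt.congr_of_eventuallyEq ?_ (rep_extD_eventuallyEq h)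
  have h1 : flatD (Cohesive.rep x η) = fun y => wedgeCLM (fderiv ℝ (Cohesive.rep x η) y) := by
    funext y; simp [flatD]
  rw [h1]
  exact wedgeCLM.contDiff.contDiffAt.comp _ (ContDiffAt.fderiv_right (m := ∞) h (by
    exact_mod_cast (le_top : (⊤ : ℕ∞) + 1 ≤ ⊤)))

lemma extD_congr {η τ : X → FormAlg V} {x : X} (h : η =ᶠ[𝓝 x] τ) : extD η x = extD τ x :=
  flatD_congr (rep_congr (mem_chart_source V x) h)

lemma extD_extD {η : X → FormAlg V} {x : X} (h : SmAt η x) : extD (extD η) x = 0 := by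
  change flatD (rep x (extD η)) (chartAt V x x) = 0
  rw [flatD_congr (rep_extD_eventuallyEq h), flatD_flatD h]

lemma extD_add {η τ : X → FormAlg V} {x : X} (h : SmAt η x) (h' : SmAt τ x) :
    extD (η + τ) x = extD η x + extD τ x := by
  change flatD (rep x (η + τ)) _ = _
  rw [rep_add]
  exact flatD_add (h.differentiableAt (mem_chart_source V x))
    (h'.differentiableAt (mem_chart_source V x))

/-- The graded Leibniz rule for the exterior derivative. -/
lemma extD_mul {η τ : X → FormAlg V} {x : X} (h : SmAt η x) (h' : SmAt τ x) :
    extD (η * τ) x = extD η x * τ x + parity (η x) * extD τ x := by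
  change flatD (rep x (η * τ)) _ = _
  rw [rep_mul, flatD_mul (h.differentiableAt (mem_chart_source V x))
    (h'.differentiableAt (mem_chart_source V x)), rep_self, rep_self]
  rfl

lemma extD_const_algebraMap (z : ℂ) (x : X) :
    extD (fun _ : X => algebraMap ℂ (FormAlg V) z) x = 0 := by
  have : rep x (fun _ : X => algebraMap ℂ (FormAlg V) z) = fun _ => algebraMap ℂ (FormAlg V) z := by
    funext y; simp [rep]
  rw [extD, this, fderiv_fun_const]
  simp [wedgeL_eq]

lemma extD_smul (c : ℂ) {η : X → FormAlg V} {x : X} (h : SmAt η x) :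
    extD (c • η) x = c • extD η x := by
  rw [extD, rep_smul, fderiv_const_smul (h.differentiableAt (mem_chart_source V x)), wedgeL_smul]
  rfl

lemma extD_sum {ι : Type*} (s : Finset ι) {η : ι → X → FormAlg V} {x : X}
    (h : ∀ i ∈ s, SmAt (η i) x) :
    extD (fun x' => ∑ i ∈ s, η i x') x = ∑ i ∈ s, extD (η i) x := by
  classical
  induction s using Finset.induction_on with
  | empty => simpa using extD_const_algebraMap (V := V) 0 x
  | insert i s hi ih =>
    have : (fun x' => ∑ j ∈ insert i s, η j x') = η i + fun x' => ∑ j ∈ s, η j x' := by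
      funext x'; simp [Finset.sum_insert hi]
    rw [this, extD_add (h i (Finset.mem_insert_self i s))
      (SmAt.sum s fun j hj => h j (Finset.mem_insert_of_mem hj)), Finset.sum_insert hi,
      ih fun j hj => h j (Finset.mem_insert_of_mem hj)]

lemma extD_parity {η : X → FormAlg V} {x : X} (h : SmAt η x) :
    extD (fun x' => parity (η x')) x = -parity (extD η x) := by
  change flatD (rep x _) _ = _
  rw [rep_parity, flatD_parity (h.differentiableAt (mem_chart_source V x))]
  rfl

lemma extD_degProj (k : ℕ) {η : X → FormAlg V} {x : X} (h : SmAt η x) :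
    extD (fun x' => degProj k (η x')) x = degProj (k + 1) (extD η x) := by
  change flatD (rep x _) _ = _
  rw [rep_degProj, flatD_degProj k (h.differentiableAt (mem_chart_source V x))]
  rfl

lemma del_add_delbar (η : X → FormAlg V) (x : X) : del η x + delbar η x = extD η x := by
  rw [del, delbar, ← wedgeL_add, extD]
  congr 1
  ext v
  simp only [linPart, antiPart, add_apply, smul_apply, sub_apply]
  module

end ManifoldCalculus

/-! ### Entire functions on Banach algebras -/

section Analysis

open Filter Topology

lemma summable_norm_mul_pow {c : ℕ → ℂ} (hc : ∀ z : ℂ, Summable fun n => c n * z ^ n) (r : ℝ) :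
    Summable fun n => ‖c n‖ * |r| ^ n := by
  have := (hc r).norm
  simpa using this

/-- A crude bound that reduces the convergence of the derived series at radius `r` to that of the
series itself at radius `2 (r + 1)`. -/
lemma nat_mul_pow_le (n : ℕ) {r : ℝ} (hr : 0 ≤ r) :
    (n : ℝ) * r ^ (n - 1) ≤ (2 * (r + 1)) ^ n := by
  rw [mul_pow]
  have h1 : (n : ℝ) ≤ 2 ^ n := by exact_mod_cast Nat.lt_two_pow_self.le
  have h2 : r ^ (n - 1) ≤ (r + 1) ^ n := by
    calc r ^ (n - 1) ≤ (r + 1) ^ (n - 1) := by gcongr; linarith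
      _ ≤ (r + 1) ^ n := pow_le_pow_right₀ (by linarith) (Nat.sub_le _ _)
  gcongr

lemma summable_deriv_bound {c : ℕ → ℂ} (hc : ∀ z : ℂ, Summable fun n => c n * z ^ n) {r : ℝ}
    (hr : 0 ≤ r) : Summable fun n => ‖c n‖ * (n * r ^ (n - 1)) := by
  refine Summable.of_nonneg_of_le (fun n => by positivity) (fun n => ?_)
    (summable_norm_mul_pow hc (2 * (r + 1)))
  rw [abs_of_nonneg (by positivity)]
  gcongr
  exact nat_mul_pow_le n hr

lemma summable_derivative {f : PowerSeries ℂ}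
    (hf : ∀ z : ℂ, Summable fun n => PowerSeries.coeff n f * z ^ n) (z : ℂ) :
    Summable fun n => PowerSeries.coeff n (PowerSeries.derivative ℂ f) * z ^ n := by
  have h := (summable_nat_add_iff 1).mpr (summable_deriv_bound hf (norm_nonneg z))
  refine Summable.of_norm_bounded h fun n => le_of_eq ?_
  rw [PowerSeries.coeff_derivative]
  simp only [norm_mul, norm_pow, Nat.add_sub_cancel]
  rw [show ((n : ℂ) + 1) = ((n + 1 : ℕ) : ℂ) by push_cast; ring, Complex.norm_natCast, mul_assoc]

variable {𝔸 : Type*} [NormedRing 𝔸] [NormedAlgebra ℂ 𝔸]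

/-- The factor `v` absorbs the exponent `0`: the norm of `1` is not assumed to be `1`. -/
lemma norm_pow_mul_le (a v : 𝔸) (n : ℕ) : ‖a ^ n * v‖ ≤ ‖a‖ ^ n * ‖v‖ := by
  induction n with
  | zero => simp
  | succ n ih =>
    rw [pow_succ', pow_succ', mul_assoc, mul_assoc]
    exact (norm_mul_le _ _).trans (mul_le_mul_of_nonneg_left ih (norm_nonneg a))

lemma norm_mul_pow_le (a v : 𝔸) (n : ℕ) : ‖v * a ^ n‖ ≤ ‖v‖ * ‖a‖ ^ n := by
  induction n with
  | zero => simp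
  | succ n ih =>
    rw [pow_succ, pow_succ, ← mul_assoc, ← mul_assoc]
    exact (norm_mul_le _ _).trans (mul_le_mul_of_nonneg_right ih (norm_nonneg a))

variable [CompleteSpace 𝔸]

lemma summable_smul_pow {c : ℕ → ℂ} (hc : ∀ z : ℂ, Summable fun n => c n * z ^ n) (a : 𝔸) :
    Summable fun n => c n • a ^ n := by
  refine Summable.of_norm_bounded ((summable_norm_mul_pow hc ‖a‖).mul_right ‖(1 : 𝔸)‖) fun n => ?_
  rw [norm_smul, abs_of_nonneg (norm_nonneg a), mul_assoc]
  gcongr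
  simpa using norm_pow_mul_le a 1 n

/-- An entire power series defines a smooth function on a Banach algebra. -/
lemma contDiff_entire {c : ℕ → ℂ} (hc : ∀ z : ℂ, Summable fun n => c n * z ^ n) :
    ContDiff ℝ ∞ fun a : 𝔸 => ∑' n, c n • a ^ n := by
  have hrad : (FormalMultilinearSeries.ofScalars 𝔸 c).radius = ⊤ := by
    refine FormalMultilinearSeries.radius_eq_top_of_summable_norm _ fun r => ?_
    have h0 := (summable_nat_add_iff 1).mpr (summable_norm_mul_pow hc r)
    simp only [NNReal.abs_eq] at h0
    rw [← summable_nat_add_iff 1]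
    refine Summable.of_nonneg_of_le (fun n => by positivity) (fun n => ?_) h0
    gcongr
    exact FormalMultilinearSeries.ofScalars_norm_le 𝔸 c (n + 1) n.succ_pos
  have h := (FormalMultilinearSeries.ofScalars 𝔸 c).hasFPowerSeriesOnBall (by rw [hrad]; simp)
  rw [hrad] at h
  have h2 : AnalyticOnNhd ℂ (FormalMultilinearSeries.ofScalars 𝔸 c).sum Set.univ := by
    have := h.analyticOnNhd
    simpa using this
  have h3 : (FormalMultilinearSeries.ofScalars 𝔸 c).sum = fun a : 𝔸 => ∑' n, c n • a ^ n :=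
    FormalMultilinearSeries.ofScalarsSum_eq_tsum c
  rw [h3] at h2
  exact (h2.contDiff (n := ∞)).restrict_scalars ℝ

/-- Termwise differentiation of an entire power series on a Banach algebra. -/
lemma hasSum_fderiv_entire {c : ℕ → ℂ} (hc : ∀ z : ℂ, Summable fun n => c n * z ^ n) (a v : 𝔸) :
    HasSum (fun n => c n • ∑ i ∈ Finset.range n, a ^ (n - 1 - i) * v * a ^ i)
      (fderiv ℝ (fun a : 𝔸 => ∑' n, c n • a ^ n) a v) := by
  let g' : ℕ → 𝔸 → 𝔸 →L[ℝ] 𝔸 := fun n x => c n • ∑ i ∈ Finset.range n,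
    (ContinuousLinearMap.mul ℝ 𝔸 (x ^ (n - 1 - i))) ∘L (ContinuousLinearMap.mul ℝ 𝔸).flip (x ^ i)
  have g'_apply : ∀ n x v, g' n x v =
      c n • ∑ i ∈ Finset.range n, x ^ (n - 1 - i) * v * x ^ i := by
    intro n x v
    simp only [g', smul_apply, sum_apply, ContinuousLinearMap.comp_apply,
      ContinuousLinearMap.mul_apply', ContinuousLinearMap.flip_apply, mul_assoc]
  have hg : ∀ n x, HasFDerivAt (𝕜 := ℝ) (fun x : 𝔸 => c n • x ^ n) (g' n x) x := by
    intro n x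
    refine ((hasFDerivAt_pow' (𝕜 := ℝ) n (x := x)).const_smul (c n)).congr_fderiv ?_
    ext v
    rw [g'_apply]
    simp [sum_apply, mul_assoc, Nat.pred_eq_sub_one]
  have hbound : ∀ n x, ‖x‖ ≤ ‖a‖ + 1 → ‖g' n x‖ ≤ ‖c n‖ * (n * (‖a‖ + 1) ^ (n - 1)) := by
    intro n x hx
    refine ContinuousLinearMap.opNorm_le_bound _ (by positivity) fun v => ?_
    rw [g'_apply, norm_smul, mul_assoc]
    gcongr
    refine (norm_sum_le _ _).trans ?_
    have hi : ∀ i ∈ Finset.range n, ‖x ^ (n - 1 - i) * v * x ^ i‖ ≤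
        (‖a‖ + 1) ^ (n - 1) * ‖v‖ := by
      intro i hi
      rw [Finset.mem_range] at hi
      refine (norm_mul_pow_le _ _ _).trans ((mul_le_mul_of_nonneg_right
        (norm_pow_mul_le _ _ _) (by positivity)).trans ?_)
      rw [mul_right_comm, ← pow_add, show n - 1 - i + i = n - 1 by omega]
      gcongr
    refine (Finset.sum_le_sum hi).trans (le_of_eq ?_)
    rw [Finset.sum_const, Finset.card_range, nsmul_eq_mul, mul_assoc]
  have hsum : Summable fun n => g' n a := Summable.of_norm_bounded
    (summable_deriv_bound hc (r := ‖a‖ + 1) (by positivity))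
    fun n => hbound n a (by linarith)
  have hmem : a ∈ Metric.ball (0 : 𝔸) (‖a‖ + 1) := by simp
  have hF := hasFDerivAt_tsum_of_isPreconnected (𝕜 := ℝ)
    (summable_deriv_bound hc (r := ‖a‖ + 1) (by positivity))
    Metric.isOpen_ball (convex_ball (0 : 𝔸) (‖a‖ + 1)).isPreconnected
    (fun n x _ => hg n x) (fun n x hx => hbound n x (by simpa using (mem_ball_zero_iff.mp hx).le))
    hmem (summable_smul_pow hc a) hmem
  rw [hF.fderiv]
  have := hsum.hasSum.mapL (ContinuousLinearMap.apply ℝ 𝔸 v)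
  simpa only [ContinuousLinearMap.apply_apply, g'_apply] using this

end Analysis

/-! ### Integrals depending on a parameter -/

section ParametricIntegral

open Filter Topology MeasureTheory

universe u

variable {Z : Type u} [NormedAddCommGroup Z] [NormedSpace ℝ Z] [FiniteDimensional ℝ Z]

/-- Differentiation under the integral sign. -/
lemma hasFDerivAt_integral_of_contDiff {E : Type u} [NormedAddCommGroup E] [NormedSpace ℝ E]
    {K : ℝ × Z → E} (hK : ContDiff ℝ ∞ K) (z₀ : Z) :
    HasFDerivAt (fun z => ∫ t in (0 : ℝ)..1, K (t, z))
      (∫ t in (0 : ℝ)..1, fderiv ℝ K (t, z₀) ∘L ContinuousLinearMap.inr ℝ ℝ Z) z₀ := by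
  have : ProperSpace Z := FiniteDimensional.proper ℝ Z
  have hK' : Continuous fun p : ℝ × Z => fderiv ℝ K p ∘L ContinuousLinearMap.inr ℝ ℝ Z :=
    (hK.continuous_fderiv (by simp)).clm_comp continuous_const
  obtain ⟨C, hC⟩ := ((isCompact_Icc (a := (0 : ℝ)) (b := 1)).prod
    (isCompact_closedBall z₀ 1)).exists_bound_of_continuousOn hK'.continuousOn
  refine intervalIntegral.hasFDerivAt_integral_of_dominated_of_fderiv_le
    (F' := fun z t => fderiv ℝ K (t, z) ∘L ContinuousLinearMap.inr ℝ ℝ Z) (bound := fun _ => C)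
    (Metric.ball_mem_nhds z₀ one_pos) ?_ ?_ ?_ ?_ ?_ ?_
  · exact Eventually.of_forall fun z => (hK.continuous.comp
      (Continuous.prodMk continuous_id continuous_const)).aestronglyMeasurable
  · exact (hK.continuous.comp
      (Continuous.prodMk continuous_id continuous_const)).intervalIntegrable _ _
  · exact (hK'.comp (Continuous.prodMk continuous_id continuous_const)).aestronglyMeasurable
  · refine ae_of_all _ fun t ht z hz => hC (t, z) ⟨?_, Metric.ball_subset_closedBall hz⟩
    rw [Set.uIoc_of_le zero_le_one] at ht
    exact Set.Ioc_subset_Icc_self ht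
  · exact intervalIntegrable_const
  · refine ae_of_all _ fun t _ z _ => ?_
    exact ((hK.differentiable (by simp) (t, z)).hasFDerivAt).comp z (hasFDerivAt_prodMk_right t z)

lemma integral_fderiv_comp {E F : Type u} [NormedAddCommGroup E] [NormedSpace ℝ E]
    [NormedAddCommGroup F] [NormedSpace ℝ F] [CompleteSpace E] [CompleteSpace F]
    {K : ℝ × Z → E} (hK : ContDiff ℝ ∞ K) (z₀ : Z) (Λ : (Z →L[ℝ] E) →L[ℝ] F) :
    ∫ t in (0 : ℝ)..1, Λ (fderiv ℝ K (t, z₀) ∘L ContinuousLinearMap.inr ℝ ℝ Z) =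
      Λ (∫ t in (0 : ℝ)..1, fderiv ℝ K (t, z₀) ∘L ContinuousLinearMap.inr ℝ ℝ Z) := by
  have hcont : Continuous fun t : ℝ => fderiv ℝ K (t, z₀) ∘L ContinuousLinearMap.inr ℝ ℝ Z :=
    ((hK.continuous_fderiv (by simp)).comp (Continuous.prodMk_left z₀)).clm_comp
      continuous_const
  exact ContinuousLinearMap.intervalIntegral_comp_comm Λ
    (hcont.intervalIntegrable (μ := MeasureTheory.volume) (0 : ℝ) 1)

/-- The integral over `[0, 1]` of a jointly smooth function is smooth in the parameter. -/
lemma contDiff_integral {E : Type u} [NormedAddCommGroup E] [NormedSpace ℝ E]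
    {K : ℝ × Z → E} (hK : ContDiff ℝ ∞ K) :
    ContDiff ℝ ∞ fun z => ∫ t in (0 : ℝ)..1, K (t, z) := by
  rw [contDiff_infty]
  intro n
  induction n generalizing E with
  | zero =>
    rw [Nat.cast_zero, contDiff_zero]
    exact continuous_iff_continuousAt.mpr fun z =>
      (hasFDerivAt_integral_of_contDiff hK z).continuousAt
  | succ n ih =>
    rw [Nat.cast_succ, contDiff_succ_iff_fderiv]
    refine ⟨fun z => (hasFDerivAt_integral_of_contDiff hK z).differentiableAt, by simp, ?_⟩
    have : fderiv ℝ (fun z => ∫ t in (0 : ℝ)..1, K (t, z)) = fun z => ∫ t in (0 : ℝ)..1,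
        (fun p : ℝ × Z => fderiv ℝ K p ∘L ContinuousLinearMap.inr ℝ ℝ Z) (t, z) := by
      funext z; exact (hasFDerivAt_integral_of_contDiff hK z).fderiv
    rw [this]
    refine ih (E := Z →L[ℝ] E)
      (K := fun p : ℝ × Z => fderiv ℝ K p ∘L ContinuousLinearMap.inr ℝ ℝ Z) ?_
    have h1 : ContDiff ℝ ∞ (fderiv ℝ K) := hK.fderiv_right (m := ∞) (by
      exact_mod_cast (le_top : (⊤ : ℕ∞) + 1 ≤ ⊤))
    exact (((ContinuousLinearMap.compL ℝ Z (ℝ × Z) E).flip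
      (ContinuousLinearMap.inr ℝ ℝ Z)).contDiff).comp h1

end ParametricIntegral

/-! ### Entire functions of matrices of forms -/

section MatrixFunctions

open Filter Topology

variable {V : Type*} [NormedAddCommGroup V] [NormedSpace ℂ V] [FiniteDimensional ℂ V]
variable {n : ℕ}

/-- The sum of a power series with coefficients `c` at a matrix of forms. -/
def matSeries (c : ℕ → ℂ) (M : Matrix (Fin n) (Fin n) (FormAlg V)) :
    Matrix (Fin n) (Fin n) (FormAlg V) := ∑' k, c k • M ^ k

variable (V n) in
/-- A copy of the algebra of matrices of forms that carries the operator norm, which makes it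
a Banach algebra. -/
def OpMat : Type _ := Matrix (Fin n) (Fin n) (FormAlg V)

instance : NormedRing (OpMat V n) :=
  Matrix.linftyOpNormedRing (n := Fin n) (α := FormAlg V)

instance : NormedAlgebra ℂ (OpMat V n) :=
  Matrix.linftyOpNormedAlgebra (n := Fin n) (α := FormAlg V)

instance : FiniteDimensional ℂ (OpMat V n) :=
  inferInstanceAs (Module.Finite ℂ (Matrix (Fin n) (Fin n) (FormAlg V)))

instance : CompleteSpace (OpMat V n) := FiniteDimensional.complete ℂ _

/-- The identification of matrices with their normed copy. -/
def toOpMat : Matrix (Fin n) (Fin n) (FormAlg V) →ₐ[ℂ] OpMat V n :=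
  AlgHom.id ℂ (Matrix (Fin n) (Fin n) (FormAlg V))

/-- The identification of arrays, with the sup norm, with the normed algebra of matrices. -/
def arrayToOpMat : (Fin n → Fin n → FormAlg V) →L[ℂ] OpMat V n :=
  LinearMap.toContinuousLinearMap
    { toFun := fun z => toOpMat (Matrix.of z), map_add' := fun _ _ => rfl,
      map_smul' := fun _ _ => rfl }

/-- The matrix entries, as continuous linear functions on the normed algebra of matrices. -/
def opEntry (a b : Fin n) : OpMat V n →L[ℂ] FormAlg V :=
  LinearMap.toContinuousLinearMap
    { toFun := fun M => (M : Matrix (Fin n) (Fin n) (FormAlg V)) a b, map_add' := fun _ _ => rfl,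
      map_smul' := fun _ _ => rfl }

lemma arrayToOpMat_apply (z : Fin n → Fin n → FormAlg V) :
    arrayToOpMat z = toOpMat (Matrix.of z) := rfl

lemma opEntry_toOpMat (a b : Fin n) (M : Matrix (Fin n) (Fin n) (FormAlg V)) :
    opEntry a b (toOpMat M) = M a b := rfl

lemma hasSum_opEntry {c : ℕ → ℂ} (hc : ∀ z : ℂ, Summable fun n => c n * z ^ n)
    (M : Matrix (Fin n) (Fin n) (FormAlg V)) (a b : Fin n) :
    HasSum (fun k => (c k • M ^ k) a b) (opEntry a b (∑' k, c k • toOpMat M ^ k)) := by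
  have h := (summable_smul_pow hc (toOpMat M)).hasSum.mapL (opEntry a b)
  have e : ∀ k, opEntry a b (c k • toOpMat M ^ k) = (c k • M ^ k) a b := fun k => by
    rw [← map_pow, ← map_smul, opEntry_toOpMat]
  simpa only [e] using h

lemma hasSum_matSeries_aux {c : ℕ → ℂ} (hc : ∀ z : ℂ, Summable fun n => c n * z ^ n)
    (M : Matrix (Fin n) (Fin n) (FormAlg V)) : HasSum (fun k => c k • M ^ k)
      (Matrix.of fun a b => opEntry a b (∑' k, c k • toOpMat M ^ k)) :=
  Pi.hasSum.mpr fun a => Pi.hasSum.mpr fun b => hasSum_opEntry hc M a b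

lemma summable_matSeries {c : ℕ → ℂ} (hc : ∀ z : ℂ, Summable fun n => c n * z ^ n)
    (M : Matrix (Fin n) (Fin n) (FormAlg V)) : Summable fun k => c k • M ^ k :=
  (hasSum_matSeries_aux hc M).summable

lemma matSeries_apply {c : ℕ → ℂ} (hc : ∀ z : ℂ, Summable fun n => c n * z ^ n)
    (M : Matrix (Fin n) (Fin n) (FormAlg V)) (a b : Fin n) :
    matSeries c M a b = opEntry a b (∑' k, c k • toOpMat M ^ k) := by
  rw [matSeries, (hasSum_matSeries_aux hc M).tsum_eq]
  rfl

lemma hasSum_matSeries {c : ℕ → ℂ} (hc : ∀ z : ℂ, Summable fun n => c n * z ^ n)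
    (M : Matrix (Fin n) (Fin n) (FormAlg V)) : HasSum (fun k => c k • M ^ k) (matSeries c M) :=
  (summable_matSeries hc M).hasSum

lemma hasSum_matSeries_apply {c : ℕ → ℂ} (hc : ∀ z : ℂ, Summable fun n => c n * z ^ n)
    (M : Matrix (Fin n) (Fin n) (FormAlg V)) (a b : Fin n) :
    HasSum (fun k => c k • (M ^ k) a b) (matSeries c M a b) :=
  Pi.hasSum.mp (Pi.hasSum.mp (hasSum_matSeries hc M) a) b

lemma matSeries_comp_eq {c : ℕ → ℂ} (hc : ∀ z : ℂ, Summable fun n => c n * z ^ n)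
    (a b : Fin n) : (fun z : Fin n → Fin n → FormAlg V => matSeries c (Matrix.of z) a b) =
      opEntry a b ∘ (fun A : OpMat V n => ∑' k, c k • A ^ k) ∘ arrayToOpMat := by
  funext z
  rw [matSeries_apply hc]
  rfl

lemma contDiff_matSeries {c : ℕ → ℂ} (hc : ∀ z : ℂ, Summable fun n => c n * z ^ n)
    (a b : Fin n) :
    ContDiff ℝ ∞ fun z : Fin n → Fin n → FormAlg V => matSeries c (Matrix.of z) a b := by
  rw [matSeries_comp_eq hc]
  exact ((opEntry (V := V) a b).restrictScalars ℝ).contDiff.comp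
    ((contDiff_entire hc).comp ((arrayToOpMat (V := V)).restrictScalars ℝ).contDiff)

lemma hasSum_fderiv_matSeries {c : ℕ → ℂ} (hc : ∀ z : ℂ, Summable fun n => c n * z ^ n)
    (a b : Fin n) (z v : Fin n → Fin n → FormAlg V) :
    HasSum (fun k => c k • (∑ i ∈ Finset.range k, Matrix.of z ^ (k - 1 - i) * Matrix.of v *
        Matrix.of z ^ i) a b)
      (fderiv ℝ (fun z : Fin n → Fin n → FormAlg V => matSeries c (Matrix.of z) a b) z v) := by
  have h5 := ((contDiff_entire hc (𝔸 := OpMat V n)).differentiable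
    (by simp) (arrayToOpMat z)).hasFDerivAt
  have h6 := (((opEntry (V := V) a b).restrictScalars ℝ).hasFDerivAt.comp z
    (h5.comp z ((arrayToOpMat (V := V)).restrictScalars ℝ).hasFDerivAt)).fderiv
  have h2 := (hasSum_fderiv_entire hc (arrayToOpMat z) (arrayToOpMat v)).mapL (opEntry a b)
  have e : ∀ k, opEntry a b (c k • ∑ i ∈ Finset.range k, arrayToOpMat z ^ (k - 1 - i) *
      arrayToOpMat v * arrayToOpMat z ^ i) = c k • (∑ i ∈ Finset.range k,
        Matrix.of z ^ (k - 1 - i) * Matrix.of v * Matrix.of z ^ i) a b := fun k => by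
    simp only [arrayToOpMat_apply, ← map_pow, ← map_mul, ← map_sum, map_smul, opEntry_toOpMat]
  simp only [e] at h2
  rw [matSeries_comp_eq hc]
  exact (DFunLike.congr_fun h6 v).symm ▸ h2

/-- Power series are compatible with entrywise application of an algebra homomorphism. -/
lemma matSeries_map {c : ℕ → ℂ} (hc : ∀ z : ℂ, Summable fun n => c n * z ^ n)
    (S : FormAlg V →ₐ[ℂ] FormAlg V) (M : Matrix (Fin n) (Fin n) (FormAlg V)) :
    matSeries c (M.map S) = (matSeries c M).map S := by
  ext a b
  have h1 := hasSum_matSeries_apply hc (M.map S) a b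
  have h2 := (hasSum_matSeries_apply hc M a b).mapL (LinearMap.toContinuousLinearMap S.toLinearMap)
  have hk : ∀ k : ℕ, M.map S ^ k = (M ^ k).map S := fun k =>
    (map_pow (S.mapMatrix (m := Fin n)) M k).symm
  simp only [hk, Matrix.map_apply] at h1
  simp only [map_smul, LinearMap.coe_toContinuousLinearMap', AlgHom.toLinearMap_apply] at h2
  exact h1.unique h2

/-- Power series are compatible with a change of frame. -/
lemma matSeries_conj {m : ℕ} {c : ℕ → ℂ} (hc : ∀ z : ℂ, Summable fun n => c n * z ^ n)
    {M : Matrix (Fin n) (Fin n) (FormAlg V)} {N : Matrix (Fin m) (Fin m) (FormAlg V)}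
    {g : Matrix (Fin n) (Fin m) (FormAlg V)} (h : M * g = g * N) :
    matSeries c M * g = g * matSeries c N := by
  have hk : ∀ k : ℕ, M ^ k * g = g * N ^ k := by
    intro k
    induction k with
    | zero => simp
    | succ k ih => rw [pow_succ, Matrix.mul_assoc, h, ← Matrix.mul_assoc, ih, Matrix.mul_assoc,
        ← pow_succ]
  ext a b
  have e1 : HasSum (fun k => ∑ j, (c k • (M ^ k) a j) * g j b) ((matSeries c M * g) a b) :=
    hasSum_sum fun j _ => (hasSum_matSeries_apply hc M a j).mul_right (g j b)
  have e2 : HasSum (fun k => ∑ j, g a j * (c k • (N ^ k) j b)) ((g * matSeries c N) a b) :=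
    hasSum_sum fun j _ => (hasSum_matSeries_apply hc N j b).mul_left (g a j)
  refine e1.unique ?_
  convert! e2 using 1
  funext k
  have h3 := congrFun (congrFun (hk k) a) b
  simp only [Matrix.mul_apply] at h3
  simp only [smul_mul_assoc, mul_smul_comm, ← Finset.smul_sum, h3]

end MatrixFunctions

/-! ### Natural operations on forms -/

section Natural

open Filter Topology

variable {V : Type*} [NormedAddCommGroup V] [NormedSpace ℂ V] [FiniteDimensional ℂ V]
variable {X : Type*} [TopologicalSpace X] [ChartedSpace V X] [IsManifold 𝓘(ℂ, V) ω X]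
variable {ι : Type} [Fintype ι]

/-- A pointwise operation on tuples of forms is natural if it commutes with pullbacks. -/
def IsNatural (K : (ι → FormAlg V) → FormAlg V) : Prop :=
  ∀ (A : V →L[ℝ] V) z, K (fun i => pull A (z i)) = pull A (K z)

/-- The expression of a tuple of forms in the chart at `x`. -/
def repTuple (p : X) (η : X → ι → FormAlg V) (y : V) (i : ι) : FormAlg V :=
  rep p (fun x => η x i) y

lemma IsNatural.rep {K : (ι → FormAlg V) → FormAlg V} (hK : IsNatural K) (p : X)
    (η : X → ι → FormAlg V) : rep p (fun x => K (η x)) = fun y => K (repTuple p η y) := by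
  funext y
  exact (hK _ _).symm

lemma contDiffAt_repTuple {η : X → ι → FormAlg V} {x : X} (hη : ∀ i, SmAt (fun x => η x i) x) :
    ContDiffAt ℝ ∞ (repTuple x η) (chartAt V x x) :=
  contDiffAt_pi.mpr hη

lemma repTuple_self (η : X → ι → FormAlg V) (x : X) : repTuple x η (chartAt V x x) = η x := by
  funext i
  exact rep_self x fun x => η x i

lemma IsNatural.smAt {K : (ι → FormAlg V) → FormAlg V} (hK : IsNatural K)
    (hK' : ContDiff ℝ ∞ K) {η : X → ι → FormAlg V} {x : X} (hη : ∀ i, SmAt (fun x => η x i) x) :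
    SmAt (fun x => K (η x)) x := by
  rw [SmAt, hK.rep]
  exact hK'.contDiffAt.comp _ (contDiffAt_repTuple hη)

lemma IsNatural.extD {K : (ι → FormAlg V) → FormAlg V} (hK : IsNatural K)
    (hK' : ContDiff ℝ ∞ K) {η : X → ι → FormAlg V} {x : X} (hη : ∀ i, SmAt (fun x => η x i) x) :
    extD (fun x => K (η x)) x =
      wedgeL (fderiv ℝ K (η x) ∘L fderiv ℝ (repTuple x η) (chartAt V x x)) := by
  have h1 := (contDiffAt_repTuple hη).differentiableAt (by simp)
  have h2 := hK'.differentiable (by simp) (repTuple x η (chartAt V x x))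
  have h3 := (h2.hasFDerivAt.comp (chartAt V x x) h1.hasFDerivAt).fderiv
  rw [repTuple_self] at h3
  rw [Cohesive.extD, hK.rep]
  exact congrArg wedgeL h3

/-- Integration of natural operations along a parameter yields smooth forms. -/
lemma smAt_integral {K : ℝ × (ι → FormAlg V) → FormAlg V} (hK : ∀ t, IsNatural fun z => K (t, z))
    (hK' : ContDiff ℝ ∞ K) {η : X → ι → FormAlg V} {x : X} (hη : ∀ i, SmAt (fun x => η x i) x) :
    SmAt (fun x => ∫ t in (0 : ℝ)..1, K (t, η x)) x := by
  refine IsNatural.smAt (K := fun z => ∫ t in (0 : ℝ)..1, K (t, z)) ?_ (contDiff_integral hK') hη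
  intro A z
  have h1 := ContinuousLinearMap.intervalIntegral_comp_comm (pullL A)
    ((hK'.continuous.comp (Continuous.prodMk_left z)).intervalIntegrable
      (μ := MeasureTheory.volume) (0 : ℝ) 1)
  simp only [pullL_apply, Function.comp_apply] at h1
  rw [← h1]
  exact intervalIntegral.integral_congr fun t _ => hK t A z

/-- The exterior derivative commutes with integration along a parameter. -/
lemma extD_integral {K : ℝ × (ι → FormAlg V) → FormAlg V} (hK : ∀ t, IsNatural fun z => K (t, z))
    (hK' : ContDiff ℝ ∞ K) {η : X → ι → FormAlg V} {x : X} (hη : ∀ i, SmAt (fun x => η x i) x) :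
    extD (fun x => ∫ t in (0 : ℝ)..1, K (t, η x)) x =
      ∫ t in (0 : ℝ)..1, extD (fun x => K (t, η x)) x := by
  have hnat : IsNatural fun z : ι → FormAlg V => ∫ t in (0 : ℝ)..1, K (t, z) := by
    intro A z
    have h1 := ContinuousLinearMap.intervalIntegral_comp_comm (pullL A)
      ((hK'.continuous.comp (Continuous.prodMk_left z)).intervalIntegrable
        (μ := MeasureTheory.volume) (0 : ℝ) 1)
    simp only [pullL_apply, Function.comp_apply] at h1
    rw [← h1]
    exact intervalIntegral.integral_congr fun t _ => hK t A z
  have hsmooth : ∀ t, ContDiff ℝ ∞ fun z => K (t, z) := fun t =>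
    hK'.comp (contDiff_prodMk_right t)
  have hder : ∀ t, fderiv ℝ (fun z => K (t, z)) (η x) =
      fderiv ℝ K (t, η x) ∘L ContinuousLinearMap.inr ℝ ℝ (ι → FormAlg V) := fun t =>
    (((hK'.differentiable (by simp) (t, η x)).hasFDerivAt).comp (η x)
      (hasFDerivAt_prodMk_right t (η x))).fderiv
  rw [hnat.extD (contDiff_integral hK') hη, (hasFDerivAt_integral_of_contDiff hK' (η x)).fderiv]
  simp only [fun t => (hK t).extD (hsmooth t) hη, hder]
  let Λ : ((ι → FormAlg V) →L[ℝ] FormAlg V) →L[ℝ] FormAlg V := wedgeCLM ∘L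
    (ContinuousLinearMap.compL ℝ V (ι → FormAlg V) (FormAlg V)).flip
      (fderiv ℝ (repTuple x η) (chartAt V x x))
  have h2 := integral_fderiv_comp hK' (η x) Λ
  have hΛ : ∀ L, Λ L = wedgeL (L ∘L fderiv ℝ (repTuple x η) (chartAt V x x)) := fun L => by
    simp [Λ]
  simp only [hΛ] at h2
  exact h2.symm

variable {n : ℕ}

lemma contDiff_pow_apply (k : ℕ) (a b : Fin n) :
    ContDiff ℝ ∞ fun z : Fin n → Fin n → FormAlg V => (Matrix.of z ^ k) a b := by
  induction k generalizing b with
  | zero => simpa using contDiff_const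
  | succ k ih =>
    simp only [pow_succ, Matrix.mul_apply, Matrix.of_apply]
    exact ContDiff.sum fun j _ => (ih j).mul (contDiff_apply_apply ℝ (FormAlg V) j b)

lemma hasSum_single_smul (k : ℕ) (g : ℕ → FormAlg V) :
    HasSum (fun j => (Pi.single k 1 : ℕ → ℂ) j • g j) (g k) := by
  have h := hasSum_single (f := fun j => (Pi.single k 1 : ℕ → ℂ) j • g j) k fun j hj => by
    rw [Pi.single_eq_of_ne hj, zero_smul]
  simpa using h

/-- The derivative of the power map on a noncommutative algebra of matrices. -/
lemma fderiv_pow_apply (k : ℕ) (a b : Fin n) (z v : Fin n → Fin n → FormAlg V) :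
    fderiv ℝ (fun z : Fin n → Fin n → FormAlg V => (Matrix.of z ^ k) a b) z v =
      (∑ i ∈ Finset.range k, Matrix.of z ^ (k - 1 - i) * Matrix.of v * Matrix.of z ^ i) a b := by
  -- The power is the entire series with a single nonzero coefficient.
  have hc : ∀ w : ℂ, Summable fun j => (Pi.single k 1 : ℕ → ℂ) j * w ^ j := fun w =>
    summable_of_ne_finset_zero (s := {k}) fun j hj => by
      rw [Finset.mem_singleton] at hj
      rw [Pi.single_eq_of_ne hj, zero_mul]
  have h1 : ∀ z : Fin n → Fin n → FormAlg V,
      matSeries (Pi.single k 1) (Matrix.of z) a b = (Matrix.of z ^ k) a b := by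
    intro z
    exact (hasSum_matSeries_apply hc (Matrix.of z) a b).unique
      (hasSum_single_smul k fun j => (Matrix.of z ^ j) a b)
  have h2 := hasSum_fderiv_matSeries hc a b z v
  simp only [h1] at h2
  exact h2.unique (hasSum_single_smul k fun k => (∑ i ∈ Finset.range k,
    Matrix.of z ^ (k - 1 - i) * Matrix.of v * Matrix.of z ^ i) a b)

/-- Smoothness of a matrix of forms at a point. -/
def SmMat {m n : ℕ} (M : X → Matrix (Fin m) (Fin n) (FormAlg V)) (x : X) : Prop :=
  ∀ a b, SmAt (fun x' => M x' a b) x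

/-- Regroup a tuple indexed by pairs into an array. -/
def toArray : (Fin n × Fin n → FormAlg V) →L[ℝ] (Fin n → Fin n → FormAlg V) :=
  ContinuousLinearMap.pi fun a => ContinuousLinearMap.pi fun b =>
    ContinuousLinearMap.proj (R := ℝ) (φ := fun _ : Fin n × Fin n => FormAlg V) (a, b)

lemma map_pow_pull (A : V →L[ℝ] V) (M : Matrix (Fin n) (Fin n) (FormAlg V)) (k : ℕ) :
    M.map (pull A) ^ k = (M ^ k).map (pull A) :=
  (map_pow ((pull A).mapMatrix (m := Fin n)) M k).symm

lemma isNatural_matSeries {c : ℕ → ℂ} (hc : ∀ z : ℂ, Summable fun n => c n * z ^ n)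
    (a b : Fin n) : IsNatural fun z : Fin n × Fin n → FormAlg V =>
      matSeries c (Matrix.of (toArray z)) a b := by
  intro A z
  exact congrFun (congrFun (matSeries_map hc (pull A) (Matrix.of (toArray z))) a) b

lemma isNatural_pow (k : ℕ) (a b : Fin n) : IsNatural fun z : Fin n × Fin n → FormAlg V =>
      (Matrix.of (toArray z) ^ k) a b := by
  intro A z
  exact congrFun (congrFun (map_pow_pull A (Matrix.of (toArray z)) k) a) b

lemma SmMat.matSeries {c : ℕ → ℂ} (hc : ∀ z : ℂ, Summable fun n => c n * z ^ n)
    {M : X → Matrix (Fin n) (Fin n) (FormAlg V)} {x : X} (hM : SmMat M x) :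
    SmMat (fun x' => matSeries c (M x')) x := fun a b =>
  (isNatural_matSeries hc a b).smAt ((contDiff_matSeries hc a b).comp (toArray (V := V)).contDiff)
    (η := fun x' i => M x' i.1 i.2) fun i => hM i.1 i.2

lemma SmMat.pow (k : ℕ) {M : X → Matrix (Fin n) (Fin n) (FormAlg V)} {x : X} (hM : SmMat M x) :
    SmMat (fun x' => M x' ^ k) x := fun a b =>
  (isNatural_pow k a b).smAt ((contDiff_pow_apply k a b).comp (toArray (V := V)).contDiff)
    (η := fun x' i => M x' i.1 i.2) fun i => hM i.1 i.2

/-- The partial derivatives at `x`, in the chart at `x`, of a matrix of forms. -/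
def partialMat (M : X → Matrix (Fin n) (Fin n) (FormAlg V)) (x : X)
    (i : Fin (Module.finrank ℝ V)) : Fin n → Fin n → FormAlg V :=
  toArray (fderiv ℝ (repTuple x fun x' (j : Fin n × Fin n) => M x' j.1 j.2) (chartAt V x x)
    (Module.finBasis ℝ V i))

/-- The exterior derivative of a natural smooth function of a matrix of forms, by the chain rule. -/
lemma extD_array {G : (Fin n → Fin n → FormAlg V) → FormAlg V} (hG : ContDiff ℝ ∞ G)
    (hnat : IsNatural fun z : Fin n × Fin n → FormAlg V => G (toArray z))
    {M : X → Matrix (Fin n) (Fin n) (FormAlg V)} {x : X} (hM : SmMat M x) :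
    extD (fun x' => G fun a b => M x' a b) x =
      ∑ i, realForm (coordForm i) * fderiv ℝ G (fun a b => M x a b) (partialMat M x i) := by
  have e1 := hnat.extD (hG.comp (toArray (V := V)).contDiff)
    (η := fun x' (j : Fin n × Fin n) => M x' j.1 j.2) (x := x) fun j => hM j.1 j.2
  have e2 : fderiv ℝ (fun z : Fin n × Fin n → FormAlg V => G (toArray z))
      (fun j : Fin n × Fin n => M x j.1 j.2) = fderiv ℝ G (fun a b => M x a b) ∘L toArray :=
    (((hG.differentiable (by simp) (toArray fun j : Fin n × Fin n => M x j.1 j.2)).hasFDerivAt).comp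
      (fun j : Fin n × Fin n => M x j.1 j.2) (toArray (V := V)).hasFDerivAt).fderiv
  refine e1.trans ?_
  rw [e2, wedgeL_eq]
  rfl

/-- The exterior derivative of an entire series of a matrix of forms is computed termwise. -/
lemma hasSum_extD_matSeries {c : ℕ → ℂ} (hc : ∀ z : ℂ, Summable fun n => c n * z ^ n)
    {M : X → Matrix (Fin n) (Fin n) (FormAlg V)} {x : X} (hM : SmMat M x) (a b : Fin n) :
    HasSum (fun k => c k • extD (fun x' => (M x' ^ k) a b) x)
      (extD (fun x' => matSeries c (M x') a b) x) := by
  have e1 := extD_array (contDiff_matSeries hc a b) (isNatural_matSeries hc a b) hM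
  have e2 := fun k => extD_array (contDiff_pow_apply k a b) (isNatural_pow k a b) hM
  simp only [fderiv_pow_apply] at e2
  have h := hasSum_sum (s := Finset.univ) fun i (_ : i ∈ Finset.univ) =>
    (hasSum_fderiv_matSeries hc a b (fun a b => M x a b) (partialMat M x i)).mul_left
      (realForm (coordForm i))
  rw [← e1] at h
  simp only [mul_smul_comm, ← Finset.smul_sum, ← e2] at h
  exact h

end Natural

/-! ### Supertraces of matrices of forms -/

section Super

variable {V : Type*} [NormedAddCommGroup V] [NormedSpace ℂ V] [FiniteDimensional ℂ V]

/-- The sign `(-1)^k`. -/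
def sgn (k : ℤ) : ℂ := (-1) ^ k

lemma sgn_even {k : ℤ} (h : Even k) : sgn k = 1 := h.neg_one_zpow

lemma sgn_odd {k : ℤ} (h : ¬ Even k) : sgn k = -1 := (Int.not_even_iff_odd.mp h).neg_one_zpow

lemma sgn_cases (k : ℤ) : sgn k = 1 ∨ sgn k = -1 := by
  by_cases h : Even k
  · exact Or.inl (sgn_even h)
  · exact Or.inr (sgn_odd h)

@[simp] lemma sgn_mul_self (k : ℤ) : sgn k * sgn k = 1 := by
  rcases sgn_cases k with h | h <;> simp [h]

variable {m n : ℕ}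

/-- The supertrace of a matrix of forms in a frame whose vectors have degrees `d`. -/
def superTr (d : Fin n → ℤ) (M : Matrix (Fin n) (Fin n) (FormAlg V)) : FormAlg V :=
  ∑ a, if Even (d a) then M a a else -parity (M a a)

/-- The supertrace as a linear map. -/
def superTrLin (d : Fin n → ℤ) : Matrix (Fin n) (Fin n) (FormAlg V) →ₗ[ℂ] FormAlg V where
  toFun := superTr d
  map_add' M N := by
    simp only [superTr, ← Finset.sum_add_distrib]
    refine Finset.sum_congr rfl fun a _ => ?_
    split_ifs
    · rfl
    · simp [add_comm]
  map_smul' c M := by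
    simp only [superTr, Finset.smul_sum]
    refine Finset.sum_congr rfl fun a _ => ?_
    split_ifs <;> simp

lemma superTrLin_apply (d : Fin n → ℤ) (M : Matrix (Fin n) (Fin n) (FormAlg V)) :
    superTrLin d M = superTr d M := rfl

/-- A matrix of forms is homogeneous, of parity given by the sign `s`, for the total grading in
which the `(a, b)` entry gets the additional parity `d a + d b`. -/
def HasPar (d : Fin n → ℤ) (s : ℂ) (M : Matrix (Fin n) (Fin n) (FormAlg V)) : Prop :=
  ∀ a b, parity (M a b) = (s * sgn (d a) * sgn (d b)) • M a b

variable {d : Fin n → ℤ} {s t : ℂ} {M N : Matrix (Fin n) (Fin n) (FormAlg V)}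

lemma HasPar.mul (hM : HasPar d s M) (hN : HasPar d t N) : HasPar d (s * t) (M * N) := by
  intro a b
  rw [Matrix.mul_apply, map_sum, Finset.smul_sum]
  refine Finset.sum_congr rfl fun j _ => ?_
  rw [parity_mul, hM a j, hN j b, smul_mul_smul_comm]
  congr 1
  linear_combination (s * t * sgn (d a) * sgn (d b)) * sgn_mul_self (d j)

lemma HasPar.add (hM : HasPar d s M) (hN : HasPar d s N) : HasPar d s (M + N) := by
  intro a b
  rw [Matrix.add_apply, map_add, hM, hN, smul_add]

lemma HasPar.sub (hM : HasPar d s M) (hN : HasPar d s N) : HasPar d s (M - N) := by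
  intro a b
  rw [Matrix.sub_apply, map_sub, hM, hN, smul_sub]

lemma HasPar.smul (c : ℂ) (hM : HasPar d s M) : HasPar d s (c • M) := by
  intro a b
  rw [Matrix.smul_apply, map_smul, hM, smul_comm]

lemma hasPar_one : HasPar d 1 (1 : Matrix (Fin n) (Fin n) (FormAlg V)) := by
  intro a b
  by_cases h : a = b
  · subst h
    simp
  · simp [Matrix.one_apply_ne h]

lemma HasPar.pow (hM : HasPar d 1 M) (k : ℕ) : HasPar d 1 (M ^ k) := by
  induction k with
  | zero => simpa using hasPar_one
  | succ k ih => rw [pow_succ]; simpa using ih.mul hM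

lemma HasPar.matSeries {c : ℕ → ℂ} (hc : ∀ z : ℂ, Summable fun n => c n * z ^ n)
    (hM : HasPar d 1 M) : HasPar d 1 (matSeries c M) := by
  intro a b
  have h1 := (hasSum_matSeries_apply hc M a b).mapL parityL
  have h2 := (hasSum_matSeries_apply hc M a b).const_smul ((1 : ℂ) * sgn (d a) * sgn (d b))
  refine h1.unique ?_
  convert! h2 using 1
  funext k
  rw [parityL_apply, map_smul, hM.pow k a b, smul_comm]

lemma superTr_eq_of_even (hM : HasPar d 1 M) : superTr d M = ∑ a, sgn (d a) • M a a := by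
  refine Finset.sum_congr rfl fun a _ => ?_
  have h := hM a a
  rw [one_mul, sgn_mul_self, one_smul] at h
  split_ifs with he
  · rw [sgn_even he, one_smul]
  · rw [sgn_odd he, h, neg_one_smul]

lemma superTr_eq_of_odd (hM : HasPar d (-1) M) : superTr d M = ∑ a, M a a := by
  refine Finset.sum_congr rfl fun a _ => ?_
  have h := hM a a
  rw [mul_assoc, sgn_mul_self, mul_one, neg_one_smul] at h
  split_ifs with he
  · rfl
  · rw [h, neg_neg]

/-- The supertrace is symmetric on even matrices. -/
lemma superTr_mul_comm_even_even (hM : HasPar d 1 M) (hN : HasPar d 1 N) :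
    superTr d (M * N) = superTr d (N * M) := by
  rw [superTr_eq_of_even (by simpa using hM.mul hN), superTr_eq_of_even (by simpa using hN.mul hM)]
  simp only [Matrix.mul_apply, Finset.smul_sum]
  rw [Finset.sum_comm]
  refine Finset.sum_congr rfl fun b _ => Finset.sum_congr rfl fun a _ => ?_
  have h1 := hM a b
  have h2 := hN b a
  rcases sgn_cases (d a) with ha | ha <;> rcases sgn_cases (d b) with hb | hb <;>
    simp only [ha, hb, mul_one, mul_neg, neg_neg, one_smul, neg_smul] at h1 h2 ⊢
  · exact mul_comm_of_even _ h2
  · rw [mul_comm_of_odd _ h2, h1, mul_neg]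
  · rw [mul_comm_of_odd _ h2, h1, mul_neg, neg_neg]
  · rw [mul_comm_of_even _ h2]

/-- The supertrace is symmetric on an even and an odd matrix. -/
lemma superTr_mul_comm_even_odd (hM : HasPar d 1 M) (hN : HasPar d (-1) N) :
    superTr d (M * N) = superTr d (N * M) := by
  rw [superTr_eq_of_odd (by simpa using hM.mul hN), superTr_eq_of_odd (by simpa using hN.mul hM)]
  simp only [Matrix.mul_apply]
  rw [Finset.sum_comm]
  refine Finset.sum_congr rfl fun b _ => Finset.sum_congr rfl fun a _ => ?_
  have h1 := hM a b
  have h2 := hN b a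
  rcases sgn_cases (d a) with ha | ha <;> rcases sgn_cases (d b) with hb | hb <;>
    simp only [ha, hb, mul_one, mul_neg, neg_neg, one_smul, neg_smul] at h1 h2 ⊢
  · rw [mul_comm_of_odd _ h2, h1]
  · exact mul_comm_of_even _ h2
  · exact mul_comm_of_even _ h2
  · rw [mul_comm_of_odd _ h2, h1]

/-- The supertrace is antisymmetric on odd matrices. -/
lemma superTr_mul_comm_odd_odd (hM : HasPar d (-1) M) (hN : HasPar d (-1) N) :
    superTr d (M * N) = -superTr d (N * M) := by
  rw [superTr_eq_of_even (by simpa using hM.mul hN), superTr_eq_of_even (by simpa using hN.mul hM)]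
  simp only [Matrix.mul_apply, Finset.smul_sum]
  rw [Finset.sum_comm, ← Finset.sum_neg_distrib]
  refine Finset.sum_congr rfl fun b _ => ?_
  rw [← Finset.sum_neg_distrib]
  refine Finset.sum_congr rfl fun a _ => ?_
  have h1 := hM a b
  have h2 := hN b a
  rcases sgn_cases (d a) with ha | ha <;> rcases sgn_cases (d b) with hb | hb <;>
    simp only [ha, hb, mul_one, mul_neg, neg_neg, one_smul, neg_smul] at h1 h2 ⊢
  · rw [mul_comm_of_odd _ h2, h1, mul_neg]
  · exact mul_comm_of_even _ h2
  · rw [mul_comm_of_even _ h2]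
  · rw [mul_comm_of_odd _ h2, h1, mul_neg, neg_neg]

/-- Scalar matrices, viewed as matrices of forms. -/
def scalarMat (g : Matrix (Fin m) (Fin n) ℂ) : Matrix (Fin m) (Fin n) (FormAlg V) :=
  g.map (algebraMap ℂ (FormAlg V))

lemma scalarMat_mul {l : ℕ} (g : Matrix (Fin m) (Fin n) ℂ) (h : Matrix (Fin n) (Fin l) ℂ) :
    scalarMat (V := V) (g * h) = scalarMat (V := V) g * scalarMat (V := V) h := Matrix.map_mul

lemma scalarMat_one : scalarMat (V := V) (1 : Matrix (Fin n) (Fin n) ℂ) = 1 :=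
  Matrix.map_one _ (map_zero _) (map_one _)

lemma scalarMat_mulVec (g : Matrix (Fin m) (Fin n) ℂ) (w : Fin n → FormAlg V) (a : Fin m) :
    (scalarMat g).mulVec w a = ∑ b, g a b • w b := by
  simp [Matrix.mulVec, dotProduct, scalarMat, Algebra.smul_def]

/-- The supertrace is invariant under an even change of frame. The matrix `N` need not be
homogeneous: scalars commute with all forms and with the parity automorphism. -/
lemma superTr_conj {e : Fin m → ℤ} {g : Matrix (Fin m) (Fin n) ℂ} {h : Matrix (Fin n) (Fin m) ℂ}
    (hgh : g * h = 1) (hg : ∀ a b, ¬ (Even (e a) ↔ Even (d b)) → g a b = 0)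
    (N : Matrix (Fin m) (Fin m) (FormAlg V)) :
    superTr d (scalarMat (V := V) h * N * scalarMat (V := V) g) = superTr e N := by
  let σ : Prop → FormAlg V →ₗ[ℂ] FormAlg V := fun p =>
    open Classical in if p then LinearMap.id else -parity
  have hσ : ∀ (k : ℤ) (w : FormAlg V), (if Even k then w else -parity w) = σ (Even k) w := by
    intro k w
    simp only [σ]
    split_ifs <;> rfl
  simp only [superTr, hσ]
  have h1 : ∀ a, σ (Even (d a)) ((scalarMat (V := V) h * N * scalarMat (V := V) g) a a) =
      ∑ c, ∑ b, (g c a * h a b) • σ (Even (e c)) (N b c) := by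
    intro a
    simp only [Matrix.mul_apply, Finset.sum_mul, map_sum]
    refine Finset.sum_congr rfl fun c _ => Finset.sum_congr rfl fun b _ => ?_
    have h2 : scalarMat (V := V) h a b * N b c * scalarMat (V := V) g c a = (g c a * h a b) • N b c := by
      simp only [scalarMat, Matrix.map_apply]
      rw [← Algebra.smul_def, ← Algebra.commutes, ← Algebra.smul_def, smul_smul]
    rw [h2, map_smul]
    by_cases hp : (Even (e c) ↔ Even (d a))
    · rw [propext hp]
    · rw [hg c a hp, zero_mul, zero_smul, zero_smul]
  rw [Finset.sum_congr rfl fun a _ => h1 a, Finset.sum_comm]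
  refine Finset.sum_congr rfl fun c _ => ?_
  rw [Finset.sum_comm]
  simp only [← Finset.sum_smul, ← Matrix.mul_apply, hgh]
  rw [Finset.sum_eq_single c]
  · rw [Matrix.one_apply_eq, one_smul]
  · intro b _ hb
    rw [Matrix.one_apply_ne hb.symm, zero_smul]
  · simp

end Super

/-! ### Chern–Weil theory of a superconnection matrix -/

section ChernWeil

open Filter Topology

variable {V : Type*} [NormedAddCommGroup V] [NormedSpace ℂ V] [FiniteDimensional ℂ V]
variable {X : Type*} [TopologicalSpace X] [ChartedSpace V X] [IsManifold 𝓘(ℂ, V) ω X]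
variable {n : ℕ} {d : Fin n → ℤ} {x : X}

lemma SmMat.add {M N : X → Matrix (Fin n) (Fin n) (FormAlg V)} (hM : SmMat M x)
    (hN : SmMat N x) : SmMat (fun x' => M x' + N x') x := fun a b => (hM a b).add (hN a b)

lemma SmMat.smul (c : ℂ) {M : X → Matrix (Fin n) (Fin n) (FormAlg V)} (hM : SmMat M x) :
    SmMat (fun x' => c • M x') x := fun a b => (hM a b).smul c

lemma SmMat.mul {l m n : ℕ} {M : X → Matrix (Fin l) (Fin m) (FormAlg V)}
    {N : X → Matrix (Fin m) (Fin n) (FormAlg V)} (hM : SmMat M x)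
    (hN : SmMat N x) : SmMat (fun x' => M x' * N x') x := fun a b => by
  simp only [Matrix.mul_apply]
  exact SmAt.sum _ fun j _ => (hM a j).mul (hN j b)

/-- The exterior derivative of a matrix of forms, with the signs of the superconnection `ε d`. -/
def extMat (d : Fin n → ℤ) (M : X → Matrix (Fin n) (Fin n) (FormAlg V)) (x : X) :
    Matrix (Fin n) (Fin n) (FormAlg V) :=
  Matrix.of fun a b => sgn (d a) • extD (fun x' => M x' a b) x

lemma SmMat.extMat {M : X → Matrix (Fin n) (Fin n) (FormAlg V)} (hM : SmMat M x) :
    SmMat (extMat d M) x := fun a b => (hM a b).extD.smul (sgn (d a))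

lemma extMat_add {M N : X → Matrix (Fin n) (Fin n) (FormAlg V)} (hM : SmMat M x)
    (hN : SmMat N x) : extMat d (fun x' => M x' + N x') x = extMat d M x + extMat d N x := by
  ext a b
  simp only [extMat, Matrix.of_apply, Matrix.add_apply, ← smul_add]
  congr 1
  exact extD_add (hM a b) (hN a b)

lemma extMat_smul (c : ℂ) {M : X → Matrix (Fin n) (Fin n) (FormAlg V)} (hM : SmMat M x) :
    extMat d (fun x' => c • M x') x = c • extMat d M x := by
  ext a b
  simp only [extMat, Matrix.of_apply, Matrix.smul_apply]
  rw [smul_comm]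
  congr 1
  exact extD_smul c (hM a b)

/-- The graded Leibniz rule for products of matrices. -/
lemma extMat_mul {s : ℂ} {M N : X → Matrix (Fin n) (Fin n) (FormAlg V)} (hM : SmMat M x)
    (hN : SmMat N x) (hs : HasPar d s (M x)) :
    extMat d (fun x' => M x' * N x') x = extMat d M x * N x + s • (M x * extMat d N x) := by
  ext a b
  simp only [extMat, Matrix.of_apply, Matrix.add_apply, Matrix.smul_apply, Matrix.mul_apply]
  have h := extD_sum Finset.univ (η := fun j x' => M x' a j * N x' j b) (x := x)
    fun j _ => (hM a j).mul (hN j b)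
  rw [h, Finset.smul_sum, Finset.smul_sum, ← Finset.sum_add_distrib]
  refine Finset.sum_congr rfl fun j _ => ?_
  have h2 := extD_mul (hM a j) (hN j b)
  change extD (fun x' => M x' a j * N x' j b) x = _ at h2
  rw [h2, hs a j, smul_add, smul_mul_assoc, smul_mul_assoc, mul_smul_comm, smul_smul, smul_smul]
  congr 2
  linear_combination (s * sgn (d j)) * sgn_mul_self (d a)

lemma extMat_extMat {M : X → Matrix (Fin n) (Fin n) (FormAlg V)} (hM : SmMat M x) :
    extMat d (extMat d M) x = 0 := by
  ext a b
  simp only [extMat, Matrix.of_apply, Matrix.zero_apply]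
  have h := extD_smul (sgn (d a)) (hM a b).extD
  change extD (fun x' => sgn (d a) • extD (fun x' => M x' a b) x') x = _ at h
  rw [h, extD_extD (hM a b), smul_zero, smul_zero]

lemma HasPar.extMat {s : ℂ} {M : X → Matrix (Fin n) (Fin n) (FormAlg V)} (hM : SmMat M x)
    (hs : ∀ x', HasPar d s (M x')) : HasPar d (-s) (extMat d M x) := by
  intro a b
  simp only [Cohesive.extMat, Matrix.of_apply]
  have h1 := extD_parity (hM a b)
  have h2 : (fun x' => parity (M x' a b)) = (s * sgn (d a) * sgn (d b)) • fun x' => M x' a b := by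
    funext x'
    exact hs x' a b
  rw [h2, extD_smul _ (hM a b)] at h1
  rw [map_smul, ← neg_eq_iff_eq_neg.mpr h1, smul_neg, smul_smul, smul_smul, ← neg_smul]
  congr 1
  ring

/-- The exterior derivative of a supertrace. -/
lemma extD_superTr {M : X → Matrix (Fin n) (Fin n) (FormAlg V)} (hM : SmMat M x) :
    extD (fun x' => superTr d (M x')) x = superTr d (extMat d M x) := by
  simp only [superTr]
  have h1 : ∀ a, SmAt (fun x' => if Even (d a) then M x' a a else -parity (M x' a a)) x := by
    intro a
    split_ifs
    · exact hM a a
    · have := (hM a a).parity.smul (-1)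
      simpa only [neg_one_smul] using! this
  rw [extD_sum Finset.univ fun a _ => h1 a]
  refine Finset.sum_congr rfl fun a _ => ?_
  simp only [extMat, Matrix.of_apply]
  split_ifs with he
  · rw [sgn_even he, one_smul]
  · have h2 := extD_smul (-1) (hM a a).parity
    rw [extD_parity (hM a a)] at h2
    rw [sgn_odd he, neg_one_smul, map_neg, neg_neg]
    simpa using! h2

lemma SmMat.superTr {M : X → Matrix (Fin n) (Fin n) (FormAlg V)} (hM : SmMat M x) :
    SmAt (fun x' => superTr d (M x')) x := by
  refine SmAt.sum _ fun a _ => ?_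
  split_ifs
  · exact hM a a
  · have := (hM a a).parity.smul (-1)
    simpa only [neg_one_smul] using! this

/-- The curvature `ε dΓ + Γ²` of the superconnection `ε d + Γ`. -/
def curvMat (d : Fin n → ℤ) (Γ : X → Matrix (Fin n) (Fin n) (FormAlg V)) (x : X) :
    Matrix (Fin n) (Fin n) (FormAlg V) := extMat d Γ x + Γ x * Γ x

lemma SmMat.curvMat {Γ : X → Matrix (Fin n) (Fin n) (FormAlg V)} (hΓ : SmMat Γ x) :
    SmMat (curvMat d Γ) x := hΓ.extMat.add (hΓ.mul hΓ)

lemma HasPar.curvMat {Γ : X → Matrix (Fin n) (Fin n) (FormAlg V)} (hΓ : SmMat Γ x)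
    (hs : ∀ x', HasPar d (-1) (Γ x')) : HasPar d 1 (curvMat d Γ x) := by
  have h1 := HasPar.extMat hΓ hs
  have h2 := (hs x).mul (hs x)
  rw [neg_neg] at h1
  rw [neg_mul_neg, one_mul] at h2
  exact h1.add h2

/-- The Bianchi identity. -/
lemma extMat_curvMat {Γ : X → Matrix (Fin n) (Fin n) (FormAlg V)} (hΓ : SmMat Γ x)
    (hs : ∀ x', HasPar d (-1) (Γ x')) :
    extMat d (curvMat d Γ) x = curvMat d Γ x * Γ x - Γ x * curvMat d Γ x := by
  have h := extMat_add (d := d) (hΓ.extMat (d := d)) (hΓ.mul hΓ)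
  change extMat d (curvMat d Γ) x = _ at h
  rw [h, extMat_extMat hΓ, extMat_mul hΓ hΓ (hs x), curvMat, neg_one_smul]
  noncomm_ring

/-- The identity `d_Γ R = 0`, where `d_Γ = ε d + [Γ, ·]`, is inherited by the powers of `R`. -/
lemma extMat_pow {Γ R : X → Matrix (Fin n) (Fin n) (FormAlg V)} (hR : SmMat R x)
    (heven : HasPar d 1 (R x)) (hRΓ : extMat d R x = R x * Γ x - Γ x * R x) (k : ℕ) :
    extMat d (fun x' => R x' ^ k) x = R x ^ k * Γ x - Γ x * R x ^ k := by
  induction k with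
  | zero =>
    simp only [pow_zero, one_mul, mul_one, sub_self]
    ext a b
    simp only [extMat, Matrix.of_apply, Matrix.zero_apply]
    have h := extD_const_algebraMap (V := V) ((1 : Matrix (Fin n) (Fin n) ℂ) a b) x
    have h2 : (fun _ : X => (1 : Matrix (Fin n) (Fin n) (FormAlg V)) a b) =
        fun _ => algebraMap ℂ (FormAlg V) ((1 : Matrix (Fin n) (Fin n) ℂ) a b) := by
      funext _
      by_cases hab : a = b
      · subst hab; simp
      · simp [Matrix.one_apply_ne hab]
    rw [h2, h, smul_zero]
  | succ k ih =>
    simp only [pow_succ]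
    rw [extMat_mul (hR.pow k) hR (heven.pow k), ih, hRΓ, one_smul]
    noncomm_ring

/-- An entire function of the curvature is covariantly constant. -/
lemma extMat_matSeries {c : ℕ → ℂ} (hc : ∀ z : ℂ, Summable fun n => c n * z ^ n)
    {Γ R : X → Matrix (Fin n) (Fin n) (FormAlg V)} (hR : SmMat R x)
    (heven : HasPar d 1 (R x)) (hRΓ : extMat d R x = R x * Γ x - Γ x * R x) :
    extMat d (fun x' => matSeries c (R x')) x =
      matSeries c (R x) * Γ x - Γ x * matSeries c (R x) := by
  ext a b
  have h1 := (hasSum_extD_matSeries hc hR a b).const_smul (sgn (d a))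
  have e1 : HasSum (fun k => ∑ j, (c k • (R x ^ k) a j) * Γ x j b)
      ((matSeries c (R x) * Γ x) a b) :=
    hasSum_sum fun j _ => (hasSum_matSeries_apply hc (R x) a j).mul_right (Γ x j b)
  have e2 : HasSum (fun k => ∑ j, Γ x a j * (c k • (R x ^ k) j b))
      ((Γ x * matSeries c (R x)) a b) :=
    hasSum_sum fun j _ => (hasSum_matSeries_apply hc (R x) j b).mul_left (Γ x a j)
  refine h1.unique ?_
  convert! e1.sub e2 using 1
  funext k
  have h3 := congrFun (congrFun (extMat_pow hR heven hRΓ k) a) b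
  simp only [extMat, Matrix.of_apply, Matrix.sub_apply, Matrix.mul_apply] at h3
  rw [smul_comm, h3]
  simp only [smul_mul_assoc, mul_smul_comm, ← Finset.smul_sum, smul_sub]

/-- The form `str f(R)` of a superconnection matrix is closed. -/
lemma extD_superTr_matSeries {c : ℕ → ℂ} (hc : ∀ z : ℂ, Summable fun n => c n * z ^ n)
    {Γ : X → Matrix (Fin n) (Fin n) (FormAlg V)} (hΓ : SmMat Γ x)
    (hs : ∀ x', HasPar d (-1) (Γ x')) :
    extD (fun x' => superTr d (matSeries c (curvMat d Γ x'))) x = 0 := by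
  have heven := HasPar.curvMat hΓ hs
  rw [extD_superTr (hΓ.curvMat.matSeries hc),
    extMat_matSeries hc hΓ.curvMat heven (extMat_curvMat hΓ hs), ← superTrLin_apply, map_sub,
    superTrLin_apply, superTrLin_apply, superTr_mul_comm_even_odd (heven.matSeries hc) (hs x),
    sub_self]

/-- The exterior derivative of `str (A g(R))`: since `g(R)` is covariantly constant and supertraces
of supercommutators vanish, only the covariant derivative `ε dA + Γ A + A Γ` of `A` contributes. -/
lemma extD_superTr_mul_matSeries {c : ℕ → ℂ} (hc : ∀ z : ℂ, Summable fun n => c n * z ^ n)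
    {Γ A : X → Matrix (Fin n) (Fin n) (FormAlg V)} (hΓ : SmMat Γ x) (hA : SmMat A x)
    (hs : ∀ x', HasPar d (-1) (Γ x')) (hsA : HasPar d (-1) (A x)) :
    extD (fun x' => superTr d (A x' * matSeries c (curvMat d Γ x'))) x =
      superTr d ((extMat d A x + Γ x * A x + A x * Γ x) * matSeries c (curvMat d Γ x)) := by
  have heven := HasPar.curvMat hΓ hs
  have hodd : HasPar d (-1) (A x * matSeries c (curvMat d Γ x)) := by
    simpa using hsA.mul (heven.matSeries hc)
  have h1 := superTr_mul_comm_odd_odd hodd (hs x)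
  rw [extD_superTr (hA.mul (hΓ.curvMat.matSeries hc)),
    extMat_mul hA (hΓ.curvMat.matSeries hc) hsA,
    extMat_matSeries hc hΓ.curvMat heven (extMat_curvMat hΓ hs)]
  have h2 : extMat d A x * matSeries c (curvMat d Γ x) + (-1 : ℂ) • (A x *
      (matSeries c (curvMat d Γ x) * Γ x - Γ x * matSeries c (curvMat d Γ x))) =
      (extMat d A x + Γ x * A x + A x * Γ x) * matSeries c (curvMat d Γ x) -
      (A x * matSeries c (curvMat d Γ x) * Γ x + Γ x * (A x * matSeries c (curvMat d Γ x))) := by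
    rw [neg_one_smul]
    noncomm_ring
  rw [h2, ← superTrLin_apply, map_sub, map_add, superTrLin_apply, superTrLin_apply,
    superTrLin_apply, h1, neg_add_cancel, sub_zero]

end ChernWeil

/-! ### The transgression formula for superconnection matrices -/

section Transgression

open Filter Topology

variable {V : Type*} [NormedAddCommGroup V] [NormedSpace ℂ V] [FiniteDimensional ℂ V]
variable {X : Type*} [TopologicalSpace X] [ChartedSpace V X] [IsManifold 𝓘(ℂ, V) ω X]
variable {n : ℕ} {d : Fin n → ℤ} {x : X}

lemma contDiff_superTr {Y : Type*} [NormedAddCommGroup Y] [NormedSpace ℝ Y]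
    {M : Y → Matrix (Fin n) (Fin n) (FormAlg V)} (hM : ∀ a b, ContDiff ℝ ∞ fun y => M y a b) :
    ContDiff ℝ ∞ fun y => superTr d (M y) := by
  refine ContDiff.sum fun a _ => ?_
  split_ifs
  · exact hM a a
  · exact (((parityL (V := V)).restrictScalars ℝ).contDiff.comp (hM a a)).neg

lemma contDiff_superTr_mul_matSeries {c : ℕ → ℂ}
    (hc : ∀ z : ℂ, Summable fun n => c n * z ^ n) {Y : Type*}
    [NormedAddCommGroup Y] [NormedSpace ℝ Y] {M R : Y → Matrix (Fin n) (Fin n) (FormAlg V)}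
    (hM : ∀ a b, ContDiff ℝ ∞ fun y => M y a b) (hR : ∀ a b, ContDiff ℝ ∞ fun y => R y a b) :
    ContDiff ℝ ∞ fun y => superTr d (M y * matSeries c (R y)) := by
  refine contDiff_superTr fun a b => ?_
  simp only [Matrix.mul_apply]
  refine ContDiff.sum fun j _ => (hM a j).mul ?_
  have hR' : ContDiff ℝ ∞ fun y => (fun a b => R y a b : Fin n → Fin n → FormAlg V) :=
    contDiff_pi.mpr fun a => contDiff_pi.mpr fun b => hR a b
  exact (contDiff_matSeries hc j b).comp hR'

lemma superTr_map_pull (A : V →L[ℝ] V) (M : Matrix (Fin n) (Fin n) (FormAlg V)) :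
    superTr d (M.map (pull A)) = pull A (superTr d M) := by
  simp only [superTr, map_sum]
  refine Finset.sum_congr rfl fun a _ => ?_
  split_ifs
  · rfl
  · rw [map_neg, Matrix.map_apply, parity_pull]

lemma hasSum_superTr {f : ℕ → Matrix (Fin n) (Fin n) (FormAlg V)}
    {M : Matrix (Fin n) (Fin n) (FormAlg V)} (h : ∀ a b, HasSum (fun k => f k a b) (M a b)) :
    HasSum (fun k => superTr d (f k)) (superTr d M) := by
  refine hasSum_sum fun a _ => ?_
  split_ifs
  · exact h a a
  · exact ((h a a).mapL parityL).neg

/-- The derivative of `str f(R)` along a path of even matrices. The matrices `R` and `R'` need not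
commute, but under the supertrace the factors of each monomial can be permuted cyclically. -/
lemma hasDerivAt_superTr_matSeries {f : PowerSeries ℂ}
    (hf : ∀ z : ℂ, Summable fun n => PowerSeries.coeff n f * z ^ n)
    {R : ℝ → Fin n → Fin n → FormAlg V} {Q : Fin n → Fin n → FormAlg V} {t : ℝ}
    (hR : HasDerivAt R Q t) (hRe : HasPar d 1 (Matrix.of (R t))) (hQe : HasPar d 1 (Matrix.of Q)) :
    HasDerivAt (fun t => superTr d (matSeries (fun k => PowerSeries.coeff k f) (Matrix.of (R t))))
      (superTr d (Matrix.of Q * matSeries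
        (fun k => PowerSeries.coeff k (PowerSeries.derivative ℂ f)) (Matrix.of (R t)))) t := by
  let c : ℕ → ℂ := fun k => PowerSeries.coeff k f
  let D : Matrix (Fin n) (Fin n) (FormAlg V) := Matrix.of fun a b =>
    fderiv ℝ (fun z : Fin n → Fin n → FormAlg V => matSeries c (Matrix.of z) a b) (R t) Q
  have h1 : ∀ a b, HasDerivAt (fun t => matSeries c (Matrix.of (R t)) a b) (D a b) t := fun a b =>
    (((contDiff_matSeries hf a b).differentiable (by simp) (R t)).hasFDerivAt).comp_hasDerivAt t hR
  have h2 : HasDerivAt (fun t => superTr d (matSeries c (Matrix.of (R t)))) (superTr d D) t := by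
    refine HasDerivAt.fun_sum fun a _ => ?_
    split_ifs
    · exact h1 a a
    · exact ((((parityL (V := V)).restrictScalars ℝ).hasFDerivAt).comp_hasDerivAt t (h1 a a)).neg
  refine h2.congr_deriv ?_
  have h3 : HasSum (fun k => superTr d (c k • (∑ i ∈ Finset.range k, Matrix.of (R t) ^ (k - 1 - i) *
      Matrix.of Q * Matrix.of (R t) ^ i))) (superTr d D) :=
    hasSum_superTr fun a b => hasSum_fderiv_matSeries hf a b (R t) Q
  have h4 : ∀ k, superTr d (c k • (∑ i ∈ Finset.range k, Matrix.of (R t) ^ (k - 1 - i) *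
      Matrix.of Q * Matrix.of (R t) ^ i)) =
      (c k * k) • superTr d (Matrix.of Q * Matrix.of (R t) ^ (k - 1)) := by
    intro k
    rw [← superTrLin_apply, map_smul, map_sum, mul_smul]
    congr 1
    rw [Finset.sum_congr rfl (g := fun _ => superTr d (Matrix.of Q * Matrix.of (R t) ^ (k - 1)))]
    · rw [Finset.sum_const, Finset.card_range, ← Nat.cast_smul_eq_nsmul ℂ]
    · intro i hi
      rw [Finset.mem_range] at hi
      have e1 : HasPar d 1 (Matrix.of Q * Matrix.of (R t) ^ i) := by
        simpa using hQe.mul (hRe.pow i)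
      rw [superTrLin_apply, mul_assoc, superTr_mul_comm_even_even (hRe.pow _) e1, mul_assoc,
        ← pow_add, show i + (k - 1 - i) = k - 1 by omega]
  simp only [h4] at h3
  have h5 : HasSum (fun k => superTr d (Matrix.of Q *
      (PowerSeries.coeff k (PowerSeries.derivative ℂ f) • Matrix.of (R t) ^ k)))
      (superTr d (Matrix.of Q * matSeries
        (fun k => PowerSeries.coeff k (PowerSeries.derivative ℂ f)) (Matrix.of (R t)))) := by
    refine hasSum_superTr fun a b => ?_
    simp only [Matrix.mul_apply]
    exact hasSum_sum fun j _ =>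
      (hasSum_matSeries_apply (summable_derivative hf) (Matrix.of (R t)) j b).mul_left _
  have h6 := (hasSum_nat_add_iff' 1).mpr h3
  simp only [Finset.sum_range_one, Nat.cast_zero, mul_zero, zero_smul, sub_zero] at h6
  refine h6.unique ?_
  convert! h5 using 1
  funext k
  rw [Matrix.mul_smul, ← superTrLin_apply, ← superTrLin_apply, map_smul,
    PowerSeries.coeff_derivative, Nat.add_sub_cancel]
  push_cast
  rfl

variable {Γ A : X → Matrix (Fin n) (Fin n) (FormAlg V)}

/-- The curvature of a segment of superconnections is quadratic in the parameter. -/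
lemma curvMat_segment (hΓ : SmMat Γ x) (hA : SmMat A x) (t : ℂ) :
    curvMat d (fun x' => Γ x' + t • A x') x = curvMat d Γ x +
      t • (extMat d A x + Γ x * A x + A x * Γ x) + t ^ 2 • (A x * A x) := by
  rw [curvMat, extMat_add hΓ (hA.smul t), extMat_smul t hA, curvMat]
  simp only [add_mul, mul_add, smul_mul_assoc, mul_smul_comm, smul_add, smul_smul, pow_two]
  abel

/-- The operation that produces the transgression integrand from the coefficients of the quadratic
path of curvatures. -/
def transOp (d : Fin n → ℤ) (c : ℕ → ℂ) (p : ℝ × (Fin 4 × Fin n × Fin n → FormAlg V)) :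
    FormAlg V :=
  superTr d (Matrix.of (fun a b => p.2 (0, a, b)) * matSeries c
    (Matrix.of (fun a b => p.2 (1, a, b)) + (p.1 : ℂ) • Matrix.of (fun a b => p.2 (2, a, b)) +
      (p.1 : ℂ) ^ 2 • Matrix.of (fun a b => p.2 (3, a, b))))

lemma isNatural_transOp {c : ℕ → ℂ} (hc : ∀ z : ℂ, Summable fun n => c n * z ^ n) (t : ℝ) :
    IsNatural fun z : Fin 4 × Fin n × Fin n → FormAlg V => transOp d c (t, z) := by
  intro B z
  simp only [transOp]
  rw [← superTr_map_pull]
  congr 1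
  rw [Matrix.map_mul, ← matSeries_map hc]
  congr 2
  ext a b
  simp only [Matrix.add_apply, Matrix.smul_apply, Matrix.of_apply, Matrix.map_apply, map_add, map_smul]

lemma contDiff_transOp {c : ℕ → ℂ} (hc : ∀ z : ℂ, Summable fun n => c n * z ^ n) :
    ContDiff ℝ ∞ (transOp (V := V) d c) := by
  have h1 : ∀ i : Fin 4 × Fin n × Fin n,
      ContDiff ℝ ∞ fun p : ℝ × (Fin 4 × Fin n × Fin n → FormAlg V) => p.2 i := fun i =>
    (contDiff_apply ℝ (FormAlg V) i).comp contDiff_snd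
  have h2 : ContDiff ℝ ∞ fun p : ℝ × (Fin 4 × Fin n × Fin n → FormAlg V) => (p.1 : ℂ) :=
    Complex.ofRealCLM.contDiff.comp contDiff_fst
  refine contDiff_superTr_mul_matSeries hc (fun a b => h1 _) fun a b => ?_
  simp only [Matrix.add_apply, Matrix.smul_apply, Matrix.of_apply]
  exact ((h1 _).add (ContDiff.fun_smul (𝕜' := ℂ) h2 (h1 _))).add
    (ContDiff.fun_smul (𝕜' := ℂ) (h2.pow 2) (h1 _))

/-- The tuple of coefficients of the transgression integrand. -/
def transTuple (d : Fin n → ℤ) (Γ A : X → Matrix (Fin n) (Fin n) (FormAlg V)) (x : X) :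
    Fin 4 × Fin n × Fin n → FormAlg V := fun i =>
  (![A x, curvMat d Γ x, extMat d A x + Γ x * A x + A x * Γ x, A x * A x] i.1) i.2.1 i.2.2

lemma transOp_transTuple (c : ℕ → ℂ) (hΓ : SmMat Γ x) (hA : SmMat A x) (t : ℝ) :
    transOp d c (t, transTuple d Γ A x) =
      superTr d (A x * matSeries c (curvMat d (fun x' => Γ x' + (t : ℂ) • A x') x)) := by
  rw [curvMat_segment hΓ hA]
  rfl

lemma smAt_transTuple (hΓ : SmMat Γ x) (hA : SmMat A x) (i : Fin 4 × Fin n × Fin n) :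
    SmAt (fun x' => transTuple d Γ A x' i) x := by
  obtain ⟨k, a, b⟩ := i
  fin_cases k
  · exact hA a b
  · exact hΓ.curvMat a b
  · exact ((hA.extMat.add (hΓ.mul hA)).add (hA.mul hΓ)) a b
  · exact (hA.mul hA) a b

lemma continuous_transgression {c : ℕ → ℂ} (hc : ∀ z : ℂ, Summable fun n => c n * z ^ n)
    (hΓ : SmMat Γ x) (hA : SmMat A x) : Continuous fun t : ℝ =>
      superTr d (A x * matSeries c (curvMat d (fun x' => Γ x' + (t : ℂ) • A x') x)) := by
  simp only [← transOp_transTuple c hΓ hA]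
  exact (contDiff_transOp (V := V) hc).continuous.comp (Continuous.prodMk_left _)

lemma integral_transgression_eventuallyEq (c : ℕ → ℂ)
    (hΓ : ∀ᶠ x' in 𝓝 x, SmMat Γ x') (hA : ∀ᶠ x' in 𝓝 x, SmMat A x') :
    (fun x' => ∫ t in (0 : ℝ)..1, transOp d c (t, transTuple d Γ A x')) =ᶠ[𝓝 x]
      fun x' => ∫ t in (0 : ℝ)..1, superTr d (A x' * matSeries c
        (curvMat d (fun y => Γ y + (t : ℂ) • A y) x')) := by
  filter_upwards [hΓ, hA] with x' h1 h2
  exact intervalIntegral.integral_congr fun t _ => transOp_transTuple c h1 h2 t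

lemma smAt_transgression {c : ℕ → ℂ} (hc : ∀ z : ℂ, Summable fun n => c n * z ^ n)
    (hΓ : ∀ᶠ x' in 𝓝 x, SmMat Γ x') (hA : ∀ᶠ x' in 𝓝 x, SmMat A x') :
    SmAt (fun x' => ∫ t in (0 : ℝ)..1, superTr d (A x' * matSeries c
        (curvMat d (fun y => Γ y + (t : ℂ) • A y) x'))) x :=
  (smAt_integral (isNatural_transOp hc) (contDiff_transOp hc)
    (smAt_transTuple hΓ.self_of_nhds hA.self_of_nhds)).congr
      (integral_transgression_eventuallyEq c hΓ hA)

/-- The transgression formula for the superconnection matrices `Γ` and `Γ + A`: the path of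
supertraces is differentiated in the parameter, and its derivative is recognised as exact. -/
lemma extD_transgression {f : PowerSeries ℂ}
    (hf : ∀ z : ℂ, Summable fun n => PowerSeries.coeff n f * z ^ n)
    (hΓ : ∀ᶠ x' in 𝓝 x, SmMat Γ x') (hA : ∀ᶠ x' in 𝓝 x, SmMat A x')
    (hsΓ : ∀ x', HasPar d (-1) (Γ x')) (hsA : ∀ x', HasPar d (-1) (A x')) :
    extD (fun x' => ∫ t in (0 : ℝ)..1, superTr d (A x' * matSeries
        (fun k => PowerSeries.coeff k (PowerSeries.derivative ℂ f))
        (curvMat d (fun y => Γ y + (t : ℂ) • A y) x'))) x =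
      superTr d (matSeries (fun k => PowerSeries.coeff k f)
        (curvMat d (fun y => Γ y + A y) x)) -
      superTr d (matSeries (fun k => PowerSeries.coeff k f) (curvMat d Γ x)) := by
  have hΓx := hΓ.self_of_nhds
  have hAx := hA.self_of_nhds
  let c' : ℕ → ℂ := fun k => PowerSeries.coeff k (PowerSeries.derivative ℂ f)
  have hc' : ∀ z : ℂ, Summable fun n => c' n * z ^ n := summable_derivative hf
  rw [← extD_congr (integral_transgression_eventuallyEq _ hΓ hA),
    extD_integral (isNatural_transOp hc') (contDiff_transOp hc') (smAt_transTuple hΓx hAx)]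
  let R : ℝ → Matrix (Fin n) (Fin n) (FormAlg V) := fun t =>
    curvMat d (fun y => Γ y + (t : ℂ) • A y) x
  let B : Matrix (Fin n) (Fin n) (FormAlg V) := extMat d A x + Γ x * A x + A x * Γ x
  let Q : ℝ → Matrix (Fin n) (Fin n) (FormAlg V) := fun t => B + (2 * t : ℂ) • (A x * A x)
  have hpar : ∀ (t : ℝ) x', HasPar d (-1) (Γ x' + (t : ℂ) • A x') := fun t x' =>
    (hsΓ x').add ((hsA x').smul _)
  have hsm : ∀ t : ℝ, SmMat (fun y => Γ y + (t : ℂ) • A y) x := fun t => hΓx.add (hAx.smul _)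
  have hQ : ∀ t : ℝ, Q t = extMat d A x + (Γ x + (t : ℂ) • A x) * A x +
      A x * (Γ x + (t : ℂ) • A x) := by
    intro t
    simp only [Q, B, add_mul, mul_add, smul_mul_assoc, mul_smul_comm, two_mul, add_smul]
    abel
  have hQe : ∀ t, HasPar d 1 (Q t) := by
    intro t
    rw [hQ t]
    have e1 := HasPar.extMat hAx hsA
    have e2 := (hpar t x).mul (hsA x)
    have e3 := (hsA x).mul (hpar t x)
    rw [neg_neg] at e1
    rw [neg_mul_neg, one_mul] at e2 e3
    exact (e1.add e2).add e3
  -- The exterior derivative of the integrand at time `t` is `str (R_t' f'(R_t))`.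
  have h1 : ∀ t : ℝ, extD (fun x' => transOp d c' (t, transTuple d Γ A x')) x =
      superTr d (Q t * matSeries c' (R t)) := by
    intro t
    have e1 : (fun x' => transOp d c' (t, transTuple d Γ A x')) =ᶠ[𝓝 x] fun x' =>
        superTr d (A x' * matSeries c' (curvMat d (fun y => Γ y + (t : ℂ) • A y) x')) := by
      filter_upwards [hΓ, hA] with x' h1 h2
      exact transOp_transTuple c' h1 h2 t
    rw [extD_congr e1, extD_superTr_mul_matSeries hc' (hsm t) hAx (hpar t) (hsA x), hQ t]
  have hRt : ∀ t : ℝ, R t = curvMat d Γ x + (t : ℂ) • B + (t : ℂ) ^ 2 • (A x * A x) := fun t =>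
    curvMat_segment hΓx hAx t
  have h2 : ∀ t : ℝ, HasDerivAt (fun t => superTr d (matSeries
      (fun k => PowerSeries.coeff k f) (R t))) (superTr d (Q t * matSeries c' (R t))) t := by
    intro t
    refine hasDerivAt_superTr_matSeries hf (R := fun t a b => R t a b) (Q := fun a b => Q t a b)
      ?_ (HasPar.curvMat (hsm t) (hpar t)) (hQe t)
    refine hasDerivAt_pi.mpr fun a => hasDerivAt_pi.mpr fun b => ?_
    simp only [hRt, Q, Matrix.add_apply, Matrix.smul_apply]
    have o1 : HasDerivAt (fun t : ℝ => (t : ℂ)) 1 t := Complex.ofRealCLM.hasDerivAt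
    have o2 : HasDerivAt (fun t : ℝ => (t : ℂ) ^ 2) (2 * t) t := by
      simpa using o1.fun_pow 2
    have o3 := ((o1.smul_const (B a b)).const_add (curvMat d Γ x a b)).add
      (o2.smul_const ((A x * A x) a b))
    simpa using! o3
  have h3 : Continuous fun t : ℝ => superTr d (Q t * matSeries c' (R t)) := by
    have p1 : ∀ w : FormAlg V, ContDiff ℝ ∞ fun t : ℝ => (t : ℂ) • w := fun w =>
      ContDiff.fun_smul (𝕜' := ℂ) Complex.ofRealCLM.contDiff contDiff_const
    have p2 : ∀ w : FormAlg V, ContDiff ℝ ∞ fun t : ℝ => (t : ℂ) ^ 2 • w := fun w =>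
      ContDiff.fun_smul (𝕜' := ℂ) (Complex.ofRealCLM.contDiff.pow 2) contDiff_const
    refine (contDiff_superTr_mul_matSeries hc' (fun a b => ?_) fun a b => ?_).continuous
    · simp only [Q, Matrix.add_apply, Matrix.smul_apply, mul_comm (2 : ℂ), mul_smul]
      exact contDiff_const.add (p1 _)
    · simp only [hRt, Matrix.add_apply, Matrix.smul_apply]
      exact (contDiff_const.add (p1 _)).add (p2 _)
  simp only [h1]
  rw [intervalIntegral.integral_eq_sub_of_hasDerivAt (fun t _ => h2 t)
    (h3.intervalIntegrable _ _)]
  simp [R]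

end Transgression

/-! ### Cutoff functions, frames and partitions of unity -/

section Frames

open Filter Topology

variable {V : Type*} [NormedAddCommGroup V] [NormedSpace ℂ V] [FiniteDimensional ℂ V]
variable {X : Type*} [TopologicalSpace X] [ChartedSpace V X] [IsManifold 𝓘(ℂ, V) ω X]

lemma SmAt.fun_smul {g : X → ℂ} {η : X → FormAlg V} {x : X}
    (hg : ContMDiffAt 𝓘(ℝ, V) 𝓘(ℝ, ℂ) ∞ g x) (hη : SmAt η x) :
    SmAt (fun y => g y • η y) x := by
  simp only [Algebra.smul_def]
  exact (smAt_funForm hg).mul hη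

/-- A form that is smooth on a neighbourhood of the support of a cutoff function becomes globally
smooth when it is multiplied with that function. -/
lemma smAt_cutoff_smul {g : X → ℂ} (hg : ∀ y, ContMDiffAt 𝓘(ℝ, V) 𝓘(ℝ, ℂ) ∞ g y) {U : Set X}
    (hU : tsupport g ⊆ U) {η : X → FormAlg V} (hη : ∀ y ∈ U, SmAt η y) (x : X) :
    SmAt (fun y => g y • η y) x := by
  by_cases hx : x ∈ tsupport g
  · exact SmAt.fun_smul (hg x) (hη x (hU hx))
  · refine SmAt.zero.congr ?_
    filter_upwards [notMem_tsupport_iff_eventuallyEq.mp hx] with y hy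
    simp [hy]

lemma contMDiffAt_cutoff_mul {g h : X → ℂ} (hg : ∀ y, ContMDiffAt 𝓘(ℝ, V) 𝓘(ℝ, ℂ) ∞ g y)
    {U : Set X} (hU : tsupport g ⊆ U) {x : X}
    (hh : x ∈ U → ContMDiffAt 𝓘(ℝ, V) 𝓘(ℝ, ℂ) ∞ h x) :
    ContMDiffAt 𝓘(ℝ, V) 𝓘(ℝ, ℂ) ∞ (fun y => g y * h y) x := by
  by_cases hx : x ∈ tsupport g
  · exact (contDiff_mul (𝕜 := ℝ) (𝔸 := ℂ)).comp_contMDiffAt ((hg x).prodMk_space (hh (hU hx)))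
  · refine (contMDiffAt_const (c := (0 : ℂ))).congr_of_eventuallyEq ?_
    filter_upwards [notMem_tsupport_iff_eventuallyEq.mp hx] with y hy
    simp [hy]

variable (V) in
/-- A smooth function that is supported in `U` and constantly `1` near `x`. -/
lemma exists_cutoff [T2Space X] (x : X) {U : Set X} (hU : U ∈ 𝓝 x) :
    ∃ g : X → ℂ, (∀ y, ContMDiffAt 𝓘(ℝ, V) 𝓘(ℝ, ℂ) ∞ g y) ∧ tsupport g ⊆ U ∧ g =ᶠ[𝓝 x] 1 := by
  obtain ⟨b, -, hb⟩ := (SmoothBumpFunction.nhds_basis_tsupport (I := 𝓘(ℝ, V)) x).mem_iff.mp hU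
  refine ⟨fun y => (b y : ℂ), fun y => ?_, ?_, ?_⟩
  · exact Complex.ofRealCLM.contDiff.comp_contMDiffAt b.contMDiffAt
  · exact (tsupport_comp_subset Complex.ofReal_zero b).trans hb
  · filter_upwards [b.eventuallyEq_one] with y hy
    simp [hy]

variable (V) in
/-- A finite smooth partition of unity subordinate to a neighbourhood of each point. -/
lemma exists_finite_partition [T2Space X] [CompactSpace X] {W : X → Set X}
    (hW : ∀ p, IsOpen (W p)) (hp : ∀ p, p ∈ W p) :
    ∃ (t : Finset X) (ρ : X → X → ℝ),
      (∀ p x, ContMDiffAt 𝓘(ℝ, V) 𝓘(ℝ, ℂ) ∞ (fun y => (ρ p y : ℂ)) x) ∧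
      (∀ p, tsupport (fun y => (ρ p y : ℂ)) ⊆ W p) ∧ (∀ p x, 0 ≤ ρ p x) ∧
      ∀ x, ∑ p ∈ t, ρ p x = 1 := by
  obtain ⟨ρ, hρ⟩ := SmoothPartitionOfUnity.exists_isSubordinate (ι := X) 𝓘(ℝ, V)
    (isClosed_univ (X := X)) W hW fun x _ => Set.mem_iUnion_of_mem x (hp x)
  have hfin : {p | (Function.support (ρ p)).Nonempty}.Finite :=
    ρ.locallyFinite.finite_nonempty_of_compact
  refine ⟨hfin.toFinset, fun p x => ρ p x, fun p x => ?_, fun p => ?_, fun p x => ρ.nonneg p x,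
    fun x => ?_⟩
  · exact Complex.ofRealCLM.contDiff.comp_contMDiffAt (ρ p).contMDiff.contMDiffAt
  · exact (tsupport_comp_subset Complex.ofReal_zero (ρ p)).trans (hρ p)
  · rw [← ρ.sum_eq_one (Set.mem_univ x)]
    refine (finsum_eq_sum_of_support_subset _ fun p hpx => ?_).symm
    simp only [Set.Finite.coe_toFinset, Set.mem_ofPred_eq]
    exact ⟨x, hpx⟩

namespace GradedBundle

variable {E : GradedBundle V X}

lemma coord_mulVec (p : X) (s : ∀ x, Fin (E.rank x) → FormAlg V) (x : X) :
    (fun a => E.coord p s a x) = (scalarMat (E.trans p x x)).mulVec (s x) := by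
  funext a
  rw [scalarMat_mulVec, coord]

lemma coord_self (s : ∀ x, Fin (E.rank x) → FormAlg V) (x : X) (a : Fin (E.rank x)) :
    E.coord x s a x = s x a := by
  simp [coord, E.trans_self x x (E.mem_dom x), Matrix.one_apply, ite_smul]

lemma coord_trans {p q x : X} (hp : x ∈ E.dom p) (hq : x ∈ E.dom q)
    (s : ∀ x, Fin (E.rank x) → FormAlg V) (c : Fin (E.rank q)) :
    E.coord q s c x = ∑ b, E.trans q p x c b • E.coord p s b x := by
  simp only [coord, Finset.smul_sum, smul_smul]
  rw [Finset.sum_comm]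
  refine Finset.sum_congr rfl fun d _ => ?_
  rw [← Finset.sum_smul, ← Matrix.mul_apply, E.trans_mul q p x x ⟨⟨hq, hp⟩, E.mem_dom x⟩]

lemma eq_sum_coord {p x : X} (hp : x ∈ E.dom p) (s : ∀ x, Fin (E.rank x) → FormAlg V)
    (c : Fin (E.rank x)) : s x c = ∑ b, E.trans x p x c b • E.coord p s b x := by
  rw [← coord_self s x c, coord_trans hp (E.mem_dom x)]

lemma contMDiffAt_trans {p q x : X} (hp : x ∈ E.dom p) (hq : x ∈ E.dom q) (a : Fin (E.rank p))
    (b : Fin (E.rank q)) : ContMDiffAt 𝓘(ℝ, V) 𝓘(ℝ, ℂ) ∞ (fun x => E.trans p q x a b) x :=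
  (E.trans_smooth p q a b).contMDiffAt
    (((E.isOpen_dom p).inter (E.isOpen_dom q)).mem_nhds ⟨hp, hq⟩)

lemma smAt_coord (s : E.Forms) {p x : X} (hx : x ∈ E.dom p) (a : Fin (E.rank p)) :
    SmAt (E.coord p s.1 a) x := SmAt.of_isSmoothOn (s.2 p a) (E.isOpen_dom p) hx

/-- Smoothness of a bundle valued form can be tested near each point in one frame. -/
lemma mem_forms_of_smAt {s : ∀ x, Fin (E.rank x) → FormAlg V}
    (h : ∀ x, ∃ p, x ∈ E.dom p ∧ ∀ b, SmAt (E.coord p s b) x) : s ∈ E.Forms := by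
  intro q c
  refine isSmoothOn_of_smAt fun x hq => ?_
  obtain ⟨p, hp, hs⟩ := h x
  have h1 : SmAt (fun y => ∑ b, E.trans q p y c b • E.coord p s b y) x :=
    SmAt.sum _ fun b _ => SmAt.fun_smul (contMDiffAt_trans hq hp c b) (hs b)
  refine h1.congr ?_
  filter_upwards [(E.isOpen_dom p).mem_nhds hp, (E.isOpen_dom q).mem_nhds hq] with y hy1 hy2
  exact (coord_trans hy1 hy2 s c).symm

/-- A function supported in the domain of the frame `p`, times a vector of that frame. -/
def frameVec (E : GradedBundle V X) {p : X} {g : X → ℂ}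
    (hg : ∀ y, ContMDiffAt 𝓘(ℝ, V) 𝓘(ℝ, ℂ) ∞ g y) (hU : tsupport g ⊆ E.dom p)
    (b : Fin (E.rank p)) : E.Forms :=
  ⟨fun x a => g x • algebraMap ℂ (FormAlg V) (E.trans x p x a b), by
    refine mem_forms_of_smAt fun x => ?_
    refine ⟨x, E.mem_dom x, fun c => ?_⟩
    have h1 : SmAt (fun y => g y • funForm (V := V) (fun y => E.trans x p y c b) y) x := by
      have h2 := contMDiffAt_cutoff_mul hg hU (h := fun y => E.trans x p y c b) (x := x)
        fun hx => contMDiffAt_trans (E.mem_dom x) hx c b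
      have h3 := smAt_funForm h2
      refine h3.congr (Eventually.of_forall fun y => ?_)
      simp [funForm, Algebra.smul_def]
    refine h1.congr ?_
    filter_upwards [(E.isOpen_dom x).mem_nhds (E.mem_dom x)] with y hy
    by_cases hy2 : y ∈ tsupport g
    · rw [funForm, ← E.trans_mul x y p y ⟨⟨hy, E.mem_dom y⟩, hU hy2⟩, Matrix.mul_apply, map_sum,
        Finset.smul_sum, coord]
      refine Finset.sum_congr rfl fun d _ => ?_
      rw [map_mul, ← Algebra.smul_def, smul_comm]
    · simp [image_eq_zero_of_notMem_tsupport hy2, coord]⟩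

variable {p : X} {g : X → ℂ} {hg : ∀ y, ContMDiffAt 𝓘(ℝ, V) 𝓘(ℝ, ℂ) ∞ g y}
  {hU : tsupport g ⊆ E.dom p}

lemma frameVec_apply (b : Fin (E.rank p)) (x : X) (a : Fin (E.rank x)) :
    (E.frameVec hg hU b).1 x a = algebraMap ℂ (FormAlg V) (g x * E.trans x p x a b) := by
  rw [map_mul, ← Algebra.smul_def]
  rfl

lemma coord_frameVec {x : X} (hx : x ∈ E.dom p) (b c : Fin (E.rank p)) :
    E.coord p (E.frameVec hg hU b).1 c x =
      algebraMap ℂ (FormAlg V) (g x * (1 : Matrix _ _ ℂ) c b) := by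
  rw [← E.trans_self p x hx, ← E.trans_mul p x p x ⟨⟨hx, E.mem_dom x⟩, hx⟩, Matrix.mul_apply,
    Finset.mul_sum, map_sum, coord]
  refine Finset.sum_congr rfl fun d _ => ?_
  rw [frameVec_apply, Algebra.smul_def, ← map_mul]
  congr 1
  ring

lemma isSection_frameVec (b : Fin (E.rank p)) : E.IsSection (E.frameVec hg hU b) := by
  intro x a k hk
  rw [frameVec_apply, degProj_algebraMap, if_neg hk]

lemma frameVec_eq_zero (b : Fin (E.rank p)) (x : X) (a : Fin (E.rank x))
    (h : E.deg x a ≠ E.deg p b) : (E.frameVec hg hU b).1 x a = 0 := by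
  rw [frameVec_apply]
  by_cases hx : x ∈ tsupport g
  · rw [E.trans_deg x p x ⟨E.mem_dom x, hU hx⟩ a b h, mul_zero, map_zero]
  · rw [image_eq_zero_of_notMem_tsupport hx, zero_mul, map_zero]

/-- Frame vectors are homogeneous because the transition matrices preserve degrees. -/
lemma hasTotalDegree_frameVec (b : Fin (E.rank p)) :
    E.HasTotalDegree (E.deg p b) (E.frameVec hg hU b) := by
  intro x a k hk
  by_cases h : E.deg x a = E.deg p b
  · exact isSection_frameVec b x a k (by rintro rfl; simp [h] at hk)
  · rw [frameVec_eq_zero b x a h, map_zero]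

/-- The coordinates of `s` in the frame `p`, cut off to a global form. -/
def cutCoord (hg : ∀ y, ContMDiffAt 𝓘(ℝ, V) 𝓘(ℝ, ℂ) ∞ g y) (hU : tsupport g ⊆ E.dom p)
    (s : E.Forms) (b : Fin (E.rank p)) : smoothForms V X :=
  ⟨fun x => g x • E.coord p s.1 b x, mem_smoothForms_iff.mpr
    fun x => smAt_cutoff_smul hg hU (fun _ hy => smAt_coord s hy b) x⟩

/-- The expansion of a form, cut off by a product of two functions, in a local frame. -/
lemma sum_frameVec_cutCoord {g' : X → ℂ} {hg' : ∀ y, ContMDiffAt 𝓘(ℝ, V) 𝓘(ℝ, ℂ) ∞ g' y}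
    {hU' : tsupport g' ⊆ E.dom p} (s : E.Forms) (x : X) (a : Fin (E.rank x)) :
    (∑ b, E.rmul (E.frameVec hg hU b) (cutCoord hg' hU' s b)).1 x a = (g x * g' x) • s.1 x a := by
  rw [AddSubmonoidClass.coe_finsetSum, Finset.sum_apply, Finset.sum_apply]
  by_cases hx : x ∈ tsupport g
  · rw [eq_sum_coord (hU hx) s.1 a, Finset.smul_sum]
    refine Finset.sum_congr rfl fun b _ => ?_
    change (E.frameVec hg hU b).1 x a * (g' x • E.coord p s.1 b x) = _
    rw [frameVec_apply, ← Algebra.smul_def, smul_smul, smul_smul]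
    congr 1
    ring
  · rw [image_eq_zero_of_notMem_tsupport hx, zero_mul, zero_smul]
    refine Finset.sum_eq_zero fun b _ => ?_
    change (E.frameVec hg hU b).1 x a * _ = _
    rw [frameVec_apply, image_eq_zero_of_notMem_tsupport hx, zero_mul, map_zero, zero_mul]

/-- Every bundle valued form is a finite sum of products of homogeneous sections and forms. -/
lemma forms_induction [T2Space X] [CompactSpace X] {P : E.Forms → Prop}
    (zero : P 0) (add : ∀ s t, P s → P t → P (s + t))
    (rmul : ∀ k e η, E.IsSection e → E.HasTotalDegree k e → P (E.rmul e η)) (s : E.Forms) :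
    P s := by
  -- Local frames become global sections when cut off by `g p`, and local coordinates become global
  -- forms when cut off by `ρ p`; the products `g p * ρ p = ρ p` still form a partition of unity.
  choose g hg hU hg1 using fun p => exists_cutoff V p ((E.isOpen_dom p).mem_nhds (E.mem_dom p))
  have hW : ∀ p, ∃ W, W ⊆ {x | g p x = 1} ∧ IsOpen W ∧ p ∈ W := fun p => mem_nhds_iff.mp (hg1 p)
  choose W hWg hWo hWp using hW
  obtain ⟨t, ρ, hρ, hρW, -, hsum⟩ := exists_finite_partition V hWo hWp
  have hρU : ∀ p, tsupport (fun y => (ρ p y : ℂ)) ⊆ E.dom p := fun p =>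
    (hρW p).trans fun x hx => by
      have h1 : g p x = 1 := hWg p hx
      exact hU p (subset_tsupport _ (by simp [h1]))
  have h : s = ∑ p ∈ t, ∑ b, E.rmul (E.frameVec (hg p) (hU p) b) (cutCoord (hρ p) (hρU p) s b) := by
    ext x a
    rw [AddSubmonoidClass.coe_finsetSum, Finset.sum_apply, Finset.sum_apply]
    simp only [sum_frameVec_cutCoord, ← Finset.sum_smul]
    have h2 : ∀ p, g p x * (ρ p x : ℂ) = (ρ p x : ℂ) := by
      intro p
      by_cases hx : x ∈ tsupport (fun y => (ρ p y : ℂ))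
      · have h1 : g p x = 1 := hWg p (hρW p hx)
        rw [h1, one_mul]
      · have h3 := image_eq_zero_of_notMem_tsupport hx
        change (ρ p x : ℂ) = 0 at h3
        rw [h3, mul_zero]
    rw [Finset.sum_congr rfl fun p _ => h2 p, ← Complex.ofReal_sum, hsum, Complex.ofReal_one,
      one_smul]
  have hS : ∀ {ι : Type _} (u : Finset ι) (f : ι → E.Forms), (∀ i ∈ u, P (f i)) →
      P (∑ i ∈ u, f i) := fun u f hf => Finset.sum_induction f P add zero hf
  rw [h]
  exact hS _ _ fun p _ => Finset.sum_induction _ P add zero fun b _ =>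
    rmul _ _ _ (isSection_frameVec b) (hasTotalDegree_frameVec b)

end GradedBundle

end Frames

/-! ### Superconnections -/

section Superconnections

open Filter Topology

variable {V : Type*} [NormedAddCommGroup V] [NormedSpace ℂ V] [FiniteDimensional ℂ V]
variable {X : Type*} [TopologicalSpace X] [ChartedSpace V X] [IsManifold 𝓘(ℂ, V) ω X]

lemma sgn_add (j k : ℤ) : sgn (j + k) = sgn j * sgn k := zpow_add₀ (by norm_num) j k

lemma sgn_sub (j k : ℤ) : sgn (j - k) = sgn j * sgn k := by
  have h := sgn_add (j - k) k
  rw [sub_add_cancel] at h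
  rw [h, mul_assoc, sgn_mul_self, mul_one]

lemma sgn_succ (k : ℤ) : sgn (k + 1) = -sgn k := by
  rw [sgn_add]
  simp [sgn]

lemma sgn_natCast (k : ℕ) : sgn (k : ℤ) = (-1) ^ k := zpow_natCast _ _

lemma degProj_parity (k : ℕ) (w : FormAlg V) :
    degProj k (parity w) = (-1 : ℂ) ^ k • degProj k w := by
  have h : parity w = ∑ j ∈ Finset.range (Module.finrank ℝ V + 1), (-1 : ℂ) ^ j • degProj j w := by
    conv_lhs => rw [← sum_degProj w, map_sum]
    exact Finset.sum_congr rfl fun j _ => parity_degProj j w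
  by_cases hk : k < Module.finrank ℝ V + 1
  · rw [h, map_sum, Finset.sum_eq_single k]
    · rw [map_smul, degProj_degProj, if_pos rfl]
    · intro j _ hj
      rw [map_smul, degProj_degProj, if_neg hj.symm, smul_zero]
    · intro h2
      exact absurd (Finset.mem_range.mpr hk) h2
  · rw [degProj_eq_zero_of_lt (by omega), degProj_eq_zero_of_lt (by omega), smul_zero]

/-- A form is homogeneous for the parity if its components of the opposite parity vanish. -/
lemma parity_of_degProj {w : FormAlg V} {c : ℂ}
    (h : ∀ j : ℕ, (-1 : ℂ) ^ j ≠ c → degProj j w = 0) : parity w = c • w := by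
  conv_lhs => rw [← sum_degProj w, map_sum]
  conv_rhs => rw [← sum_degProj w, Finset.smul_sum]
  refine Finset.sum_congr rfl fun j _ => ?_
  rw [parity_degProj]
  by_cases hj : (-1 : ℂ) ^ j = c
  · rw [hj]
  · rw [h j hj, smul_zero, smul_zero]

namespace GradedBundle

variable {E : GradedBundle V X}

lemma sgn_smul_trans {p q x : X} (hp : x ∈ E.dom p) (hq : x ∈ E.dom q) (a : Fin (E.rank p))
    (b : Fin (E.rank q)) : sgn (E.deg q b) * E.trans p q x a b =
      sgn (E.deg p a) * E.trans p q x a b := by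
  by_cases h : E.deg p a = E.deg q b
  · rw [h]
  · rw [E.trans_deg p q x ⟨hp, hq⟩ a b h, mul_zero, mul_zero]

variable (E) in
/-- The sign of the total degree, as an operator on bundle valued forms. -/
def parityOp : E.Forms →ₗ[ℂ] E.Forms where
  toFun s := ⟨fun x a => sgn (E.deg x a) • parity (s.1 x a), by
    refine mem_forms_of_smAt fun x => ⟨x, E.mem_dom x, fun a => ?_⟩
    refine ((smAt_coord s (E.mem_dom x) a).parity.smul (sgn (E.deg x a))).congr ?_
    filter_upwards [(E.isOpen_dom x).mem_nhds (E.mem_dom x)] with y hy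
    simp only [Pi.smul_apply, coord, map_sum, Finset.smul_sum, map_smul, smul_smul]
    refine Finset.sum_congr rfl fun b _ => ?_
    rw [← sgn_smul_trans hy (E.mem_dom y), mul_comm]⟩
  map_add' s t := by ext x a; simp
  map_smul' c s := by ext x a; simp [smul_comm c]

lemma parityOp_apply (s : E.Forms) (x : X) (a : Fin (E.rank x)) :
    (E.parityOp s).1 x a = sgn (E.deg x a) • parity (s.1 x a) := rfl

lemma rmul_apply (s : E.Forms) (η : smoothForms V X) (x : X) (a : Fin (E.rank x)) :
    (E.rmul s η).1 x a = s.1 x a * η.1 x := rfl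

lemma rmul_add (s t : E.Forms) (η : smoothForms V X) :
    E.rmul (s + t) η = E.rmul s η + E.rmul t η := by
  ext x a
  exact add_mul _ _ _

lemma rmul_zero (η : smoothForms V X) : E.rmul 0 η = 0 := by
  ext x a
  exact zero_mul _

/-- The product of two smooth forms. -/
def mulForms (η τ : smoothForms V X) : smoothForms V X :=
  ⟨η.1 * τ.1, IsSmoothOn.mul η.2 τ.2⟩

lemma rmul_rmul (s : E.Forms) (η τ : smoothForms V X) :
    E.rmul (E.rmul s η) τ = E.rmul s (mulForms η τ) := by
  ext x a
  exact mul_assoc _ _ _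

lemma smAt_form (η : smoothForms V X) (x : X) : SmAt η.1 x := mem_smoothForms_iff.mp η.2 x

/-- The parity automorphism on smooth forms. -/
def parityForm (η : smoothForms V X) : smoothForms V X :=
  ⟨fun x => parity (η.1 x), mem_smoothForms_iff.mpr fun x => (smAt_form η x).parity⟩

/-- The component of degree `k` of a smooth form. -/
def degForm (k : ℕ) (η : smoothForms V X) : smoothForms V X :=
  ⟨fun x => degProj k (η.1 x), IsSmoothOn.degProj k η.2⟩

variable (E) in
/-- Superconnections, characterized by the graded Leibniz rule for all bundle valued forms and by
oddness. Unlike the rule for homogeneous sections, this form of the definition is visibly stable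
under affine combinations and under bundle isomorphisms that only preserve the degrees modulo `2`. -/
structure IsSuperconn (T : E.Forms →ₗ[ℂ] E.Forms) : Prop where
  leibniz : ∀ (s : E.Forms) (η : smoothForms V X) (x : X) (a : Fin (E.rank x)),
    (T (E.rmul s η)).1 x a =
      (T s).1 x a * η.1 x + sgn (E.deg x a) • (parity (s.1 x a) * extD η.1 x)
  odd : ∀ s, T (E.parityOp s) = -E.parityOp (T s)

/-- The values of a homogeneous section are scalars, in the frame vectors of its degree. -/
lemma IsSection.exists_scalar {e : E.Forms} {k : ℤ} (he : E.IsSection e)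
    (hk : E.HasTotalDegree k e) (x : X) (a : Fin (E.rank x)) :
    ∃ z : ℂ, e.1 x a = algebraMap ℂ (FormAlg V) z ∧ sgn (E.deg x a) * z = sgn k * z := by
  obtain ⟨z, hz⟩ := exists_scalar_of_degProj (he x a)
  by_cases h : E.deg x a = k
  · exact ⟨z, hz, by rw [h]⟩
  · have h1 := hk x a 0 (by simpa using h)
    rw [hz, degProj_algebraMap, if_pos rfl] at h1
    exact ⟨0, by rw [hz, h1, map_zero], by rw [mul_zero, mul_zero]⟩

variable {T : E.Forms →ₗ[ℂ] E.Forms}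

/-- An operator is a superconnection if it has the defining properties on homogeneous sections. -/
lemma IsSuperconn.of_sections [T2Space X] [CompactSpace X] (hL : E.Leibniz extD T)
    (hodd : ∀ k e, E.IsSection e → E.HasTotalDegree k e → ∀ x a,
      parity ((T e).1 x a) = (-(sgn k * sgn (E.deg x a))) • (T e).1 x a) :
    E.IsSuperconn T where
  leibniz s := by
    have hL' : ∀ (k : ℤ) (e : E.Forms) (η : smoothForms V X), E.IsSection e →
        E.HasTotalDegree k e → ∀ x a, (T (E.rmul e η)).1 x a =
          (T e).1 x a * η.1 x + sgn k • (e.1 x a * extD η.1 x) := hL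
    induction s using forms_induction with
    | zero => intro η x a; simp [rmul_zero]
    | add s t hs ht =>
      intro η x a
      rw [rmul_add, map_add, map_add]
      change (T (E.rmul s η)).1 x a + (T (E.rmul t η)).1 x a = ((T s).1 x a + (T t).1 x a) * _ +
        sgn (E.deg x a) • (parity (s.1 x a + t.1 x a) * _)
      rw [hs η x a, ht η x a, map_add, add_mul, add_mul, smul_add]
      abel
    | rmul k e τ he hk =>
      intro η x a
      obtain ⟨z, hz, hz2⟩ := he.exists_scalar hk x a
      rw [rmul_rmul, hL' k e _ he hk x a, hL' k e τ he hk x a, rmul_apply, hz]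
      have h1 : extD (mulForms τ η).1 x = extD τ.1 x * η.1 x + parity (τ.1 x) * extD η.1 x :=
        extD_mul (smAt_form τ x) (smAt_form η x)
      rw [h1, parity_mul, parity_algebraMap]
      simp only [← Algebra.smul_def, smul_add, smul_mul_assoc, smul_smul, add_mul, hz2]
      have h2 : (mulForms τ η).1 x = τ.1 x * η.1 x := rfl
      rw [h2, mul_assoc]
      abel
  odd s := by
    have hL' : ∀ (k : ℤ) (e : E.Forms) (η : smoothForms V X), E.IsSection e →
        E.HasTotalDegree k e → ∀ x a, (T (E.rmul e η)).1 x a =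
          (T e).1 x a * η.1 x + sgn k • (e.1 x a * extD η.1 x) := hL
    induction s using forms_induction with
    | zero => simp
    | add s t hs ht => rw [map_add, map_add, hs, ht, map_add, map_add]; abel
    | rmul k e τ he hk =>
      have h1 : E.parityOp (E.rmul e τ) = sgn k • E.rmul e (parityForm τ) := by
        ext x a
        obtain ⟨z, hz, hz2⟩ := he.exists_scalar hk x a
        change sgn (E.deg x a) • parity (e.1 x a * τ.1 x) = sgn k • (e.1 x a * parity (τ.1 x))
        rw [hz, parity_mul, parity_algebraMap, ← Algebra.smul_def, smul_smul, hz2, ← smul_smul]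
      rw [h1, map_smul]
      ext x a
      obtain ⟨z, hz, hz2⟩ := he.exists_scalar hk x a
      change sgn k • (T (E.rmul e (parityForm τ))).1 x a =
        -(sgn (E.deg x a) • parity ((T (E.rmul e τ)).1 x a))
      have h2 : extD (parityForm τ).1 x = -parity (extD τ.1 x) := extD_parity (smAt_form τ x)
      have h3 : (parityForm τ).1 x = parity (τ.1 x) := rfl
      have e1 : sgn k * sgn k = 1 := sgn_mul_self k
      have e2 : sgn (E.deg x a) * sgn (E.deg x a) = 1 := sgn_mul_self _
      rw [hL' k e _ he hk x a, hL' k e _ he hk x a, map_add, parity_mul, hodd k e he hk x a, hz, h2,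
        h3, map_smul, parity_mul, parity_algebraMap]
      -- If the two signs differ, the section has no component along the frame vector `a`.
      rcases sgn_cases k with h | h <;> rcases sgn_cases (E.deg x a) with h' | h' <;>
        simp only [h, h'] at hz2 ⊢
      · simp [add_comm]
      · have hz0 : z = 0 := by linear_combination (-1 / 2 : ℂ) * hz2
        simp [hz0]
      · have hz0 : z = 0 := by linear_combination (1 / 2 : ℂ) * hz2
        simp [hz0]
      · simp [add_comm]

/-- Affine combinations of superconnections are superconnections. -/
lemma IsSuperconn.affine {T' : E.Forms →ₗ[ℂ] E.Forms} (hT : E.IsSuperconn T)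
    (hT' : E.IsSuperconn T') (t : ℂ) : E.IsSuperconn ((1 - t) • T + t • T') where
  leibniz s η x a := by
    have h1 := hT.leibniz s η x a
    have h2 := hT'.leibniz s η x a
    simp only [LinearMap.add_apply, LinearMap.smul_apply, Submodule.coe_add, Submodule.coe_smul,
      Pi.add_apply, Pi.smul_apply] at h1 h2 ⊢
    rw [h1, h2, add_mul, smul_mul_assoc, smul_mul_assoc]
    module
  odd s := by
    simp only [LinearMap.add_apply, LinearMap.smul_apply, hT.odd, hT'.odd, map_add, map_smul]
    module

/-- The Leibniz rule in coordinates. -/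
lemma IsSuperconn.coord_leibniz (hT : E.IsSuperconn T) (s : E.Forms) (η : smoothForms V X)
    {p x : X} (hx : x ∈ E.dom p) (a : Fin (E.rank p)) :
    E.coord p (T (E.rmul s η)).1 a x = E.coord p (T s).1 a x * η.1 x +
      sgn (E.deg p a) • (parity (E.coord p s.1 a x) * extD η.1 x) := by
  simp only [coord, hT.leibniz, smul_add, Finset.sum_add_distrib, Finset.sum_mul, smul_mul_assoc,
    map_sum, map_smul, Finset.smul_sum, smul_smul]
  congr 1
  refine Finset.sum_congr rfl fun b _ => ?_
  rw [← sgn_smul_trans hx (E.mem_dom x), mul_comm]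

/-- Superconnections are local operators: if `u` vanishes near `x` and `g` is a cutoff function
supported there, then `0 = T (u g)` equals `T u` at `x` by the Leibniz rule. -/
lemma IsSuperconn.congr [T2Space X] (hT : E.IsSuperconn T) {s t : E.Forms} {x : X}
    (h : ∀ᶠ y in 𝓝 x, s.1 y = t.1 y) : (T s).1 x = (T t).1 x := by
  have key : ∀ u : E.Forms, (∀ᶠ y in 𝓝 x, u.1 y = 0) → (T u).1 x = 0 := by
    intro u hu
    obtain ⟨g, hg, hgU, hg1⟩ := exists_cutoff V x hu
    let η : smoothForms V X := ⟨funForm g, mem_smoothForms_iff.mpr fun y => smAt_funForm (hg y)⟩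
    have h0 : E.rmul u η = 0 := by
      ext y a
      change u.1 y a * algebraMap ℂ (FormAlg V) (g y) = 0
      by_cases hy : y ∈ tsupport g
      · have h1 : u.1 y = 0 := hgU hy
        rw [h1, Pi.zero_apply, zero_mul]
      · rw [image_eq_zero_of_notMem_tsupport hy, map_zero, mul_zero]
    funext a
    have h1 := hT.leibniz u η x a
    have h2 : η.1 x = 1 := by
      change algebraMap ℂ (FormAlg V) (g x) = 1
      rw [hg1.self_of_nhds, Pi.one_apply, map_one]
    rw [h0, map_zero, hu.self_of_nhds, h2, mul_one, Pi.zero_apply, map_zero, zero_mul, smul_zero,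
      add_zero] at h1
    exact h1.symm
  have h1 := key (s - t) (h.mono fun y hy => by
    simp only [Submodule.coe_sub, Pi.sub_apply, hy, sub_self])
  rw [map_sub] at h1
  simpa [sub_eq_zero] using h1

end GradedBundle

end Superconnections

/-! ### Connection components, Chern superconnections and local forms -/

section LocalForms

open Filter Topology

variable {V : Type*} [NormedAddCommGroup V] [NormedSpace ℂ V] [FiniteDimensional ℂ V]
variable {X : Type*} [TopologicalSpace X] [ChartedSpace V X] [IsManifold 𝓘(ℂ, V) ω X]

namespace GradedBundle

variable {E : GradedBundle V X} {T : E.Forms →ₗ[ℂ] E.Forms}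

lemma parityOp_section {e : E.Forms} {k : ℤ} (he : E.IsSection e) (hk : E.HasTotalDegree k e) :
    E.parityOp e = sgn k • e := by
  ext x a
  obtain ⟨z, hz, hz2⟩ := he.exists_scalar hk x a
  change sgn (E.deg x a) • parity (e.1 x a) = sgn k • e.1 x a
  rw [hz, parity_algebraMap, Algebra.smul_def, Algebra.smul_def, ← map_mul, ← map_mul, hz2]

/-- A superconnection maps a homogeneous section to a form of the opposite parity. -/
lemma IsSuperconn.parity_section (hT : E.IsSuperconn T) {e : E.Forms} {k : ℤ}
    (he : E.IsSection e) (hk : E.HasTotalDegree k e) (x : X) (a : Fin (E.rank x)) :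
    parity ((T e).1 x a) = (-(sgn k * sgn (E.deg x a))) • (T e).1 x a := by
  have h := hT.odd e
  rw [parityOp_section he hk, map_smul] at h
  have h2 : sgn k • (T e).1 x a = -(sgn (E.deg x a) • parity ((T e).1 x a)) :=
    congrFun (congrFun (congrArg Subtype.val h) x) a
  rw [neg_smul, mul_comm, mul_smul, h2, smul_neg, smul_smul, sgn_mul_self, one_smul, neg_neg]

lemma IsSuperconn.leibniz_section (hT : E.IsSuperconn T) {e : E.Forms} {k : ℤ}
    (he : E.IsSection e) (hk : E.HasTotalDegree k e) (η : smoothForms V X) (x : X)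
    (a : Fin (E.rank x)) : (T (E.rmul e η)).1 x a =
      (T e).1 x a * η.1 x + sgn k • (e.1 x a * extD η.1 x) := by
  obtain ⟨z, hz, hz2⟩ := he.exists_scalar hk x a
  rw [hT.leibniz, hz, parity_algebraMap, ← Algebra.smul_def, smul_smul, smul_smul, hz2]

lemma connPart_apply (s : E.Forms) (x : X) (a : Fin (E.rank x)) :
    (E.connPart T s).1 x a = ∑ j ∈ Finset.range (Module.finrank ℝ V + 1),
      degProj (j + 1) ((T (E.formPart j s)).1 x a) := by
  rw [connPart, LinearMap.sum_apply, AddSubmonoidClass.coe_finsetSum, Finset.sum_apply,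
    Finset.sum_apply]
  rfl

lemma formPart_section {e : E.Forms} (he : E.IsSection e) (j : ℕ) :
    E.formPart j e = if j = 0 then e else 0 := by
  ext x a
  change degProj j (e.1 x a) = _
  split_ifs with h
  · subst h
    obtain ⟨z, hz⟩ := exists_scalar_of_degProj (he x a)
    rw [hz, degProj_algebraMap, if_pos rfl]
  · exact he x a j h

lemma formPart_rmul_section {e : E.Forms} (he : E.IsSection e) (η : smoothForms V X) (j : ℕ) :
    E.formPart j (E.rmul e η) = E.rmul e (degForm j η) := by
  ext x a
  obtain ⟨z, hz⟩ := exists_scalar_of_degProj (he x a)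
  change degProj j (e.1 x a * η.1 x) = e.1 x a * degProj j (η.1 x)
  rw [hz, ← Algebra.smul_def, ← Algebra.smul_def, map_smul]

lemma connPart_section {e : E.Forms} (he : E.IsSection e) (x : X) (a : Fin (E.rank x)) :
    (E.connPart T e).1 x a = degProj 1 ((T e).1 x a) := by
  rw [connPart_apply, Finset.sum_eq_single 0]
  · rw [formPart_section he, if_pos rfl]
  · intro j _ hj
    rw [formPart_section he, if_neg hj, map_zero]
    exact map_zero _
  · simp

/-- The connection component of a superconnection is a superconnection. -/
lemma IsSuperconn.connPart [T2Space X] [CompactSpace X] (hT : E.IsSuperconn T) :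
    E.IsSuperconn (E.connPart T) := by
  refine IsSuperconn.of_sections ?_ ?_
  · intro k e η he hk x a
    obtain ⟨z, hz⟩ := exists_scalar_of_degProj (he x a)
    rw [connPart_apply, connPart_section he]
    have h1 : ∀ j, degProj (j + 1) ((T (E.formPart j (E.rmul e η))).1 x a) =
        degProj 1 ((T e).1 x a) * degProj j (η.1 x) +
          sgn k • (e.1 x a * extD (degForm j η).1 x) := by
      intro j
      have h2 : extD (degForm j η).1 x = degProj (j + 1) (extD η.1 x) :=
        extD_degProj j (smAt_form η x)
      rw [formPart_rmul_section he, hT.leibniz_section he hk, map_add, map_smul, hz,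
        ← Algebra.smul_def, map_smul, h2, degProj_degProj, if_pos rfl, add_comm j 1]
      congr 1
      exact degProj_mul_degProj 1 j _ _
    rw [Finset.sum_congr rfl fun j _ => h1 j, Finset.sum_add_distrib, ← Finset.mul_sum,
      sum_degProj, ← Finset.smul_sum, ← Finset.mul_sum,
      ← extD_sum _ fun j _ => smAt_form (degForm j η) x]
    have h3 : (fun x' => ∑ j ∈ Finset.range (Module.finrank ℝ V + 1), (degForm j η).1 x') = η.1 := by
      funext x'
      exact sum_degProj _
    rw [h3]
    rfl
  · intro k e he hk x a
    rw [connPart_section he, parity_degProj, ← degProj_parity, hT.parity_section he hk, map_smul]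

/-- The local form `ε d + Γ` of a superconnection in the frame `p`, valid on the set `W`. -/
structure HasLocalForm (T : E.Forms →ₗ[ℂ] E.Forms) (p : X) (W : Set X)
    (Γ : X → Matrix (Fin (E.rank p)) (Fin (E.rank p)) (FormAlg V)) : Prop where
  hasPar : ∀ x, HasPar (E.deg p) (-1) (Γ x)
  smMat : ∀ x ∈ W, SmMat Γ x
  coord_eq : ∀ (s : E.Forms), ∀ x ∈ W, ∀ a, E.coord p (T s).1 a x =
    sgn (E.deg p a) • extD (E.coord p s.1 a) x + ∑ b, Γ x a b * E.coord p s.1 b x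

lemma coord_sum {ι : Type*} (u : Finset ι) (f : ι → E.Forms) (p : X) (a : Fin (E.rank p)) (x : X) :
    E.coord p (∑ i ∈ u, f i).1 a x = ∑ i ∈ u, E.coord p (f i).1 a x := by
  simp only [coord, AddSubmonoidClass.coe_finsetSum, Finset.sum_apply, Finset.smul_sum]
  exact Finset.sum_comm

/-- Near each point, all superconnections have a local form, on a common domain: the columns of `Γ`
are the values of the superconnection on the frame vectors, cut off to global sections. -/
lemma exists_hasLocalForm [T2Space X] (E : GradedBundle V X) (p : X) :
    ∃ W : Set X, IsOpen W ∧ p ∈ W ∧ W ⊆ E.dom p ∧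
      ∀ T : E.Forms →ₗ[ℂ] E.Forms, E.IsSuperconn T → ∃ Γ, HasLocalForm T p W Γ := by
  classical
  obtain ⟨g, hg, hU, hg1⟩ := exists_cutoff V p ((E.isOpen_dom p).mem_nhds (E.mem_dom p))
  obtain ⟨W, hWg, hWo, hWp⟩ := mem_nhds_iff.mp hg1
  have hW1 : ∀ x ∈ W, g x = 1 := fun x hx => hWg hx
  have hWd : W ⊆ E.dom p := fun x hx => hU (subset_tsupport _ (by simp [hW1 x hx]))
  refine ⟨W, hWo, hWp, hWd, fun T hT => ?_⟩
  let e : Fin (E.rank p) → E.Forms := fun b => E.frameVec hg hU b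
  -- Outside `W` the matrix is set to zero, so that it is odd everywhere.
  refine ⟨fun x => Matrix.of fun a b => if x ∈ W then E.coord p (T (e b)).1 a x else 0,
    fun x a b => ?_, fun x hx a b => ?_, fun s x hx a => ?_⟩
  · simp only [Matrix.of_apply]
    split_ifs with hx
    · have h1 : ∀ c, parity ((T (e b)).1 x c) =
          (-(sgn (E.deg p b) * sgn (E.deg x c))) • (T (e b)).1 x c := fun c =>
        hT.parity_section (isSection_frameVec b) (hasTotalDegree_frameVec b) x c
      rw [coord, map_sum, Finset.smul_sum]
      refine Finset.sum_congr rfl fun c _ => ?_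
      rw [map_smul, h1, smul_smul, smul_smul]
      congr 1
      linear_combination (-sgn (E.deg p b)) * sgn_smul_trans (hWd hx) (E.mem_dom x) a c
    · simp
  · refine (smAt_coord (T (e b)) (hWd hx) a).congr ?_
    filter_upwards [hWo.mem_nhds hx] with y hy
    simp [hy]
  · have h1 : (T s).1 x = (T (∑ b, E.rmul (e b) (cutCoord hg hU s b))).1 x := by
      refine hT.congr ?_
      filter_upwards [hWo.mem_nhds hx] with y hy
      funext c
      rw [sum_frameVec_cutCoord, hW1 y hy, one_mul, one_smul]
    have h2 : E.coord p (T s).1 a x =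
        E.coord p (T (∑ b, E.rmul (e b) (cutCoord hg hU s b))).1 a x := by
      rw [coord, coord, h1]
    have h3 : ∀ b, (cutCoord hg hU s b).1 =ᶠ[𝓝 x] E.coord p s.1 b := by
      intro b
      filter_upwards [hWo.mem_nhds hx] with y hy
      change g y • _ = _
      rw [hW1 y hy, one_smul]
    rw [h2, map_sum, coord_sum]
    simp only [hT.coord_leibniz _ _ (hWd hx), Finset.sum_add_distrib, extD_congr (h3 _),
      (h3 _).self_of_nhds, Matrix.of_apply, if_pos hx]
    rw [add_comm]
    congr 1
    rw [← Finset.smul_sum]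
    congr 1
    rw [Finset.sum_eq_single a]
    · rw [coord_frameVec (hWd hx), hW1 x hx, Matrix.one_apply_eq, one_mul, map_one, parity_one,
        one_mul]
    · intro b _ hb
      rw [coord_frameVec (hWd hx), Matrix.one_apply_ne hb.symm, mul_zero, map_zero, map_zero,
        zero_mul]
    · simp

variable {p : X} {W : Set X} {Γ Γ' : X → Matrix (Fin (E.rank p)) (Fin (E.rank p)) (FormAlg V)}

/-- The local matrices of an affine combination interpolate linearly: the part `ε d` is common. -/
lemma HasLocalForm.segment {T' : E.Forms →ₗ[ℂ] E.Forms} (h : HasLocalForm T p W Γ)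
    (h' : HasLocalForm T' p W Γ') (t : ℂ) :
    HasLocalForm ((1 - t) • T + t • T') p W (fun x => Γ x + t • (Γ' x - Γ x)) where
  hasPar x := (h.hasPar x).add (((h'.hasPar x).sub (h.hasPar x)).smul t)
  smMat x hx := by
    have h1 := (h.smMat x hx).add ((((h'.smMat x hx).add ((h.smMat x hx).smul (-1)))).smul t)
    refine fun a b => (h1 a b).congr (Eventually.of_forall fun y => ?_)
    simp [sub_eq_add_neg]
  coord_eq s x hx a := by
    have h1 : E.coord p (((1 - t) • T + t • T') s).1 a x =
        (1 - t) • E.coord p (T s).1 a x + t • E.coord p (T' s).1 a x := by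
      simp only [coord, Finset.smul_sum, ← Finset.sum_add_distrib]
      refine Finset.sum_congr rfl fun b _ => ?_
      change _ • ((1 - t) • (T s).1 x b + t • (T' s).1 x b) = _
      rw [smul_add, smul_comm, smul_comm t]
    rw [h1, h.coord_eq s x hx, h'.coord_eq s x hx]
    simp only [Matrix.add_apply, Matrix.smul_apply, Matrix.sub_apply, add_mul, sub_mul,
      smul_mul_assoc, Finset.sum_add_distrib, ← Finset.smul_sum, Finset.sum_sub_distrib]
    module

/-- The square of a superconnection acts through the curvature matrix of its local form: the terms
that differentiate `s` cancel because `Γ` is odd. -/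
lemma HasLocalForm.coord_sq (hW : IsOpen W) (hWd : W ⊆ E.dom p) (h : HasLocalForm T p W Γ)
    (s : E.Forms) {x : X} (hx : x ∈ W) (a : Fin (E.rank p)) :
    E.coord p (T (T s)).1 a x = ∑ b, curvMat (E.deg p) Γ x a b * E.coord p s.1 b x := by
  have hs : ∀ b, SmAt (E.coord p s.1 b) x := fun b => smAt_coord s (hWd hx) b
  let G : Fin (E.rank p) → X → FormAlg V := fun b x' => Γ x' a b
  have hG : ∀ b, SmAt (G b) x := fun b => h.smMat x hx a b
  let P : Fin (E.rank p) → X → FormAlg V := fun b => G b * E.coord p s.1 b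
  have hP : ∀ b, SmAt (P b) x := fun b => (hG b).mul (hs b)
  have h1 : E.coord p (T s).1 a =ᶠ[𝓝 x]
      (sgn (E.deg p a) • extD (E.coord p s.1 a) + fun y => ∑ b, P b y) := by
    filter_upwards [hW.mem_nhds hx] with y hy
    rw [h.coord_eq s y hy]
    rfl
  have h2 : ∀ b, extD (P b) x = extD (fun x' => Γ x' a b) x * E.coord p s.1 b x +
      parity (Γ x a b) * extD (E.coord p s.1 b) x := fun b => extD_mul (hG b) (hs b)
  rw [h.coord_eq _ x hx, extD_congr h1,
    extD_add ((hs a).extD.smul _) (SmAt.sum _ fun b _ => hP b),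
    extD_smul _ (hs a).extD, extD_extD (hs a), smul_zero, zero_add, extD_sum _ fun b _ => hP b]
  simp only [h2, h.coord_eq s x hx, mul_add, Finset.mul_sum, Finset.sum_add_distrib, smul_add,
    Finset.smul_sum, h.hasPar x a _, curvMat, Matrix.add_apply, Matrix.mul_apply, extMat,
    Matrix.of_apply, add_mul, Finset.sum_mul, smul_mul_assoc, mul_smul_comm, smul_smul]
  rw [Finset.sum_comm (f := fun b c => Γ x a b * (Γ x b c * E.coord p s.1 c x))]
  have h3 : ∀ b, (sgn (E.deg p a) * (-1 * sgn (E.deg p a) * sgn (E.deg p b))) •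
      (Γ x a b * extD (E.coord p s.1 b) x) =
      -(sgn (E.deg p b) • (Γ x a b * extD (E.coord p s.1 b) x)) := by
    intro b
    rw [← neg_smul]
    congr 1
    linear_combination (-sgn (E.deg p b)) * sgn_mul_self (E.deg p a)
  simp only [h3, Finset.sum_neg_distrib]
  simp only [mul_assoc]
  abel

end GradedBundle

/-- Chern superconnections are superconnections in the above sense. On a section of degree `k` the
`∂̄`-part raises the total degree by one, and the `∂`-part lowers the exotic degree `-p + q + k` by
one; modulo `2` both degrees agree, so both parts are odd. -/
lemma HermitianCohesiveModule.IsChern.isSuperconn [T2Space X] [CompactSpace X]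
    {E : HermitianCohesiveModule V X} {T : E.Forms →ₗ[ℂ] E.Forms} (hT : E.IsChern T) :
    E.IsSuperconn T := by
  have hsplit : ∀ (s : E.Forms) x a, (T s).1 x a = ((T - E.antiOp) s).1 x a +
      (E.antiOp s).1 x a := by
    intro s x a
    change _ = ((T s).1 x a - (E.antiOp s).1 x a) + _
    rw [sub_add_cancel]
  refine GradedBundle.IsSuperconn.of_sections ?_ ?_
  · intro k e η he hk x a
    rw [hsplit, hsplit, hT.leibniz k e η he hk x a, E.antiOp_leibniz k e η he hk x a,
      ← del_add_delbar, mul_add, smul_add, add_mul]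
    abel
  · intro k e he hk x a
    have hbi : ∀ y b, e.1 y b ∈ bideg V 0 0 := by
      intro y b
      obtain ⟨z, hz⟩ := exists_scalar_of_degProj (he y b)
      rw [hz, bideg, pow_zero, pow_zero, one_mul]
      exact Submodule.algebraMap_mem z
    have h1 : parity ((E.antiOp e).1 x a) =
        (-(sgn k * sgn (E.deg x a))) • (E.antiOp e).1 x a := by
      refine parity_of_degProj fun j hj => ?_
      have hanti : E.IsAntiHolType e := fun y b =>
        Submodule.mem_iSup_of_mem 0 (hbi y b)
      refine E.antiOp_degree k e hanti hk x a j fun h => hj ?_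
      rw [← sgn_natCast, ← eq_sub_iff_add_eq.mpr h |>.symm, sgn_sub, sgn_succ, neg_mul]
    have h2 : parity (((T - E.antiOp) e).1 x a) =
        (-(sgn k * sgn (E.deg x a))) • ((T - E.antiOp) e).1 x a := by
      have hexo : E.HasExoticDegree k e := by
        intro y b
        by_cases h : E.deg y b = k
        · exact Submodule.mem_iSup_of_mem 0 (Submodule.mem_iSup_of_mem 0
            (Submodule.mem_iSup_of_mem (by simpa using h) (hbi y b)))
        · obtain ⟨z, hz⟩ := exists_scalar_of_degProj (he y b)
          have h3 := hk y b 0 (by simpa using h)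
          rw [hz, degProj_algebraMap, if_pos rfl] at h3
          rw [hz, h3]
          exact zero_mem _
      have h4 := hT.exoticDegree k e he hexo x a
      let L : Submodule ℂ (FormAlg V) :=
        LinearMap.ker (parity - (-(sgn k * sgn (E.deg x a))) • LinearMap.id)
      have h5 : (⨆ (p : ℕ) (q : ℕ) (_ : -(p : ℤ) + q + E.deg x a = k - 1), bideg V p q) ≤ L := by
        refine iSup_le fun p => iSup_le fun q => iSup_le fun h => ?_
        intro w hw
        have h6 : (-1 : ℂ) ^ (p + q) = -(sgn k * sgn (E.deg x a)) := by
          have h7 : (p : ℤ) + q = k + 1 - E.deg x a + 2 * (p - 1) := by linarith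
          rw [← sgn_natCast, Nat.cast_add, h7, sgn_add, sgn_sub, sgn_succ,
            sgn_even (even_two_mul _), mul_one, neg_mul]
        rw [LinearMap.mem_ker, LinearMap.sub_apply, LinearMap.smul_apply, LinearMap.id_apply,
          parity_of_mem_bideg hw, h6, sub_self]
      have h8 := h5 h4
      rwa [LinearMap.mem_ker, LinearMap.sub_apply, LinearMap.smul_apply, LinearMap.id_apply,
        sub_eq_zero] at h8
    rw [hsplit, map_add, h1, h2, smul_add]

end LocalForms

/-! ### Characteristic forms and transgression for superconnections -/

section CharacteristicForms

open Filter Topology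

variable {V : Type*} [NormedAddCommGroup V] [NormedSpace ℂ V] [FiniteDimensional ℂ V]
variable {X : Type*} [TopologicalSpace X] [ChartedSpace V X] [IsManifold 𝓘(ℂ, V) ω X]
variable [T2Space X]

namespace GradedBundle

variable {E : GradedBundle V X}

/-- A matrix at a point is determined by its action on global bundle valued forms, because the frame
vectors extend to global sections. -/
lemma eq_of_forall_mulVec {m : ℕ} {x : X} {M N : Matrix (Fin m) (Fin (E.rank x)) (FormAlg V)}
    (h : ∀ s : E.Forms, M.mulVec (s.1 x) = N.mulVec (s.1 x)) : M = N := by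
  obtain ⟨g, hg, hU, hg1⟩ := exists_cutoff V x ((E.isOpen_dom x).mem_nhds (E.mem_dom x))
  ext a b
  have h1 : (E.frameVec hg hU b).1 x = Pi.single b 1 := by
    funext c
    rw [frameVec_apply, hg1.self_of_nhds, Pi.one_apply, one_mul, E.trans_self x x (E.mem_dom x),
      Matrix.one_apply, Pi.single_apply]
    split_ifs
    · exact map_one _
    · exact map_zero _
  have h2 := h (E.frameVec hg hU b)
  rw [h1, Matrix.mulVec_single_one, Matrix.mulVec_single_one] at h2
  exact congrFun h2 a

lemma Represents.ext {U : E.Forms →ₗ[ℂ] E.Forms}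
    {M N : ∀ x, Matrix (Fin (E.rank x)) (Fin (E.rank x)) (FormAlg V)}
    (hM : E.Represents M U) (hN : E.Represents N U) : M = N :=
  funext fun x => eq_of_forall_mulVec fun s => (hM s x).symm.trans (hN s x)

lemma Represents.isTensorial {U : E.Forms →ₗ[ℂ] E.Forms}
    {M : ∀ x, Matrix (Fin (E.rank x)) (Fin (E.rank x)) (FormAlg V)}
    (hM : E.Represents M U) : E.IsTensorial U := ⟨M, hM, fun _ hN => Represents.ext hN hM⟩

lemma IsTensorial.represents_endForm {U : E.Forms →ₗ[ℂ] E.Forms} (h : E.IsTensorial U) :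
    E.Represents (E.endForm U) U := by
  rw [endForm, dif_pos h.exists]
  exact h.exists.choose_spec

/-- If an operator is given in the frame `p` by the matrix `C`, then `C` is the matrix of the
endomorphism valued form of the operator, up to the change of frame. -/
lemma Represents.intertwine {U : E.Forms →ₗ[ℂ] E.Forms}
    {M : ∀ x, Matrix (Fin (E.rank x)) (Fin (E.rank x)) (FormAlg V)}
    (hM : E.Represents M U) {p x : X} {C : Matrix (Fin (E.rank p)) (Fin (E.rank p)) (FormAlg V)}
    (h : ∀ (s : E.Forms) a, E.coord p (U s).1 a x = ∑ b, C a b * E.coord p s.1 b x) :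
    C * scalarMat (V := V) (E.trans p x x) = scalarMat (V := V) (E.trans p x x) * M x := by
  refine eq_of_forall_mulVec fun s => ?_
  rw [← Matrix.mulVec_mulVec, ← Matrix.mulVec_mulVec, ← hM s x, ← coord_mulVec, ← coord_mulVec]
  funext a
  exact (h s a).symm

/-- The supertrace of an endomorphism valued form can be computed in any frame. -/
lemma str_eq_superTr {p x : X} (hx : x ∈ E.dom p)
    {C : Matrix (Fin (E.rank p)) (Fin (E.rank p)) (FormAlg V)}
    {N : Matrix (Fin (E.rank x)) (Fin (E.rank x)) (FormAlg V)}
    (h : C * scalarMat (V := V) (E.trans p x x) = scalarMat (V := V) (E.trans p x x) * N) :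
    E.str x N = superTr (E.deg p) C := by
  have h1 : E.trans x p x * E.trans p x x = 1 := by
    rw [E.trans_mul x p x x ⟨⟨E.mem_dom x, hx⟩, E.mem_dom x⟩, E.trans_self x x (E.mem_dom x)]
  have h2 : E.trans p x x * E.trans x p x = 1 := by
    rw [E.trans_mul p x p x ⟨⟨hx, E.mem_dom x⟩, hx⟩, E.trans_self p x hx]
  have h3 : N = scalarMat (V := V) (E.trans x p x) * C * scalarMat (V := V) (E.trans p x x) := by
    rw [Matrix.mul_assoc, h, ← Matrix.mul_assoc, ← scalarMat_mul, h1, scalarMat_one, Matrix.one_mul]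
  rw [← superTr_conj (V := V) (d := E.deg x) (e := E.deg p) h2 (fun a b hab =>
    E.trans_deg p x x ⟨hx, E.mem_dom x⟩ a b fun h => hab (by rw [h])) C, ← h3]
  rfl

lemma represents_of_apply {T : E.Forms →ₗ[ℂ] E.Forms}
    {M : ∀ x, Matrix (Fin (E.rank x)) (Fin (E.rank x)) (FormAlg V)}
    (h : ∀ (s : E.Forms) (x : X) a, (T s).1 x a = ∑ b, M x a b * s.1 x b) : E.Represents M T := by
  intro s x
  funext a
  exact h s x a

/-- The curvature is given by a unique form with values in the endomorphisms. -/
lemma IsSuperconn.isTensorial_sq {T : E.Forms →ₗ[ℂ] E.Forms} (hT : E.IsSuperconn T) :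
    E.IsTensorial (T ∘ₗ T) := by
  choose W hW hp hWd hΓ using fun p => exists_hasLocalForm E p
  choose Γ hΓ using fun p => hΓ p T hT
  refine Represents.isTensorial (M := fun x => curvMat (E.deg x) (Γ x) x)
    (represents_of_apply fun s x a => ?_)
  have h := (hΓ x).coord_sq (hW x) (hWd x) s (hp x) a
  simp only [coord_self] at h
  exact h

variable {T₀ T₁ : E.Forms →ₗ[ℂ] E.Forms} {p : X} {W : Set X}
  {Γ₀ Γ₁ Γ : X → Matrix (Fin (E.rank p)) (Fin (E.rank p)) (FormAlg V)}

lemma HasLocalForm.coord_sub (h₀ : HasLocalForm T₀ p W Γ₀) (h₁ : HasLocalForm T₁ p W Γ₁)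
    (s : E.Forms) {x : X} (hx : x ∈ W) (a : Fin (E.rank p)) :
    E.coord p ((T₁ - T₀) s).1 a x = ∑ b, (Γ₁ x - Γ₀ x) a b * E.coord p s.1 b x := by
  have h1 : E.coord p ((T₁ - T₀) s).1 a x = E.coord p (T₁ s).1 a x - E.coord p (T₀ s).1 a x := by
    simp only [coord, ← Finset.sum_sub_distrib]
    refine Finset.sum_congr rfl fun b _ => ?_
    rw [← smul_sub]
    rfl
  rw [h1, h₁.coord_eq s x hx, h₀.coord_eq s x hx]
  simp only [Matrix.sub_apply, sub_mul, Finset.sum_sub_distrib]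
  abel

lemma IsSuperconn.isTensorial_sub (h₀ : E.IsSuperconn T₀) (h₁ : E.IsSuperconn T₁) :
    E.IsTensorial (T₁ - T₀) := by
  choose W hW hp hWd hΓ using fun p => exists_hasLocalForm E p
  choose Γ₀ hΓ₀ using fun p => hΓ p T₀ h₀
  choose Γ₁ hΓ₁ using fun p => hΓ p T₁ h₁
  refine Represents.isTensorial (M := fun x => Γ₁ x x - Γ₀ x x)
    (represents_of_apply fun s x a => ?_)
  have h := (hΓ₀ x).coord_sub (hΓ₁ x) s (hp x) a
  simp only [coord_self] at h
  exact h

lemma HasLocalForm.intertwine_curvature {T : E.Forms →ₗ[ℂ] E.Forms} (hT : E.IsSuperconn T)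
    (hW : IsOpen W) (hWd : W ⊆ E.dom p) (h : HasLocalForm T p W Γ) {x : X} (hx : x ∈ W) :
    curvMat (E.deg p) Γ x * scalarMat (V := V) (E.trans p x x) =
      scalarMat (V := V) (E.trans p x x) * E.curvature T x :=
  hT.isTensorial_sq.represents_endForm.intertwine fun s a => h.coord_sq hW hWd s hx a

lemma evalAt_eq_matSeries {n : ℕ} (f : PowerSeries ℂ) (M : Matrix (Fin n) (Fin n) (FormAlg V)) :
    evalAt f M = matSeries (fun k => PowerSeries.coeff k f) M := rfl

variable {f : PowerSeries ℂ}

/-- The characteristic form, a fibrewise definition in the frame at `x` itself, is computed near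
each point by the local form in one fixed frame. -/
lemma HasLocalForm.charForm_eq
    (hf : ∀ z : ℂ, Summable fun n => PowerSeries.coeff n f * z ^ n)
    {T : E.Forms →ₗ[ℂ] E.Forms} (hT : E.IsSuperconn T)
    (hW : IsOpen W) (hWd : W ⊆ E.dom p) (h : HasLocalForm T p W Γ) {x : X} (hx : x ∈ W) :
    E.charForm f T x = superTr (E.deg p)
      (matSeries (fun k => PowerSeries.coeff k f) (curvMat (E.deg p) Γ x)) :=
  str_eq_superTr (hWd hx) (matSeries_conj hf (h.intertwine_curvature hT hW hWd hx))

lemma IsSuperconn.smAt_charForm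
    (hf : ∀ z : ℂ, Summable fun n => PowerSeries.coeff n f * z ^ n)
    {T : E.Forms →ₗ[ℂ] E.Forms} (hT : E.IsSuperconn T) (x : X) :
    SmAt (E.charForm f T) x := by
  obtain ⟨W, hW, hx, hWd, hΓ⟩ := exists_hasLocalForm E x
  obtain ⟨Γ, hΓ⟩ := hΓ T hT
  refine SmAt.congr (SmMat.superTr (d := E.deg x) ((hΓ.smMat x hx).curvMat (d := E.deg x)|>.matSeries hf)) ?_
  filter_upwards [hW.mem_nhds hx] with y hy
  exact (hΓ.charForm_eq hf hT hW hWd hy).symm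

lemma IsSuperconn.extD_charForm
    (hf : ∀ z : ℂ, Summable fun n => PowerSeries.coeff n f * z ^ n)
    {T : E.Forms →ₗ[ℂ] E.Forms} (hT : E.IsSuperconn T) :
    extD (E.charForm f T) = 0 := by
  funext x
  obtain ⟨W, hW, hx, hWd, hΓ⟩ := exists_hasLocalForm E x
  obtain ⟨Γ, hΓ⟩ := hΓ T hT
  rw [extD_congr (τ := fun y => superTr (E.deg x)
    (matSeries (fun k => PowerSeries.coeff k f) (curvMat (E.deg x) Γ y)))]
  · exact extD_superTr_matSeries hf (hΓ.smMat x hx) hΓ.hasPar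
  · filter_upwards [hW.mem_nhds hx] with y hy
    exact hΓ.charForm_eq hf hT hW hWd hy

/-- The integrand `str (A f'(R_t))` of the transgression form between two superconnections, where
`A = T₁ - T₀` and `R_t` is the curvature of `(1 - t) T₀ + t T₁`. -/
def segmentIntegrand (f : PowerSeries ℂ) (T₀ T₁ : E.Forms →ₗ[ℂ] E.Forms) (t : ℝ) (x : X) :
    FormAlg V :=
  E.str x (E.endForm (T₁ - T₀) x * evalAt (PowerSeries.derivative ℂ f)
    (E.curvature ((1 - t : ℂ) • T₀ + (t : ℂ) • T₁) x))

lemma HasLocalForm.segmentIntegrand_eq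
    (hf : ∀ z : ℂ, Summable fun n => PowerSeries.coeff n f * z ^ n)
    (hT₀ : E.IsSuperconn T₀) (hT₁ : E.IsSuperconn T₁)
    (hW : IsOpen W) (hWd : W ⊆ E.dom p) (h₀ : HasLocalForm T₀ p W Γ₀)
    (h₁ : HasLocalForm T₁ p W Γ₁) (t : ℝ) {x : X} (hx : x ∈ W) :
    segmentIntegrand f T₀ T₁ t x = superTr (E.deg p) ((Γ₁ x - Γ₀ x) *
      matSeries (fun k => PowerSeries.coeff k (PowerSeries.derivative ℂ f))
        (curvMat (E.deg p) (fun y => Γ₀ y + (t : ℂ) • (Γ₁ y - Γ₀ y)) x)) := by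
  refine str_eq_superTr (hWd hx) ?_
  have e1 : (Γ₁ x - Γ₀ x) * scalarMat (V := V) (E.trans p x x) =
      scalarMat (V := V) (E.trans p x x) * E.endForm (T₁ - T₀) x :=
    (hT₀.isTensorial_sub hT₁).represents_endForm.intertwine fun s a => h₀.coord_sub h₁ s hx a
  have e2 := matSeries_conj (summable_derivative hf)
    ((h₀.segment h₁ t).intertwine_curvature (hT₀.affine hT₁ t) hW hWd hx)
  rw [Matrix.mul_assoc, e2, ← Matrix.mul_assoc, e1, Matrix.mul_assoc]
  rfl

lemma IsSuperconn.continuous_segmentIntegrand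
    (hf : ∀ z : ℂ, Summable fun n => PowerSeries.coeff n f * z ^ n)
    (hT₀ : E.IsSuperconn T₀) (hT₁ : E.IsSuperconn T₁)
    (x : X) : Continuous fun t => segmentIntegrand f T₀ T₁ t x := by
  obtain ⟨W, hW, hx, hWd, hΓ⟩ := exists_hasLocalForm E x
  obtain ⟨Γ₀, h₀⟩ := hΓ T₀ hT₀
  obtain ⟨Γ₁, h₁⟩ := hΓ T₁ hT₁
  have hA : SmMat (fun y => Γ₁ y - Γ₀ y) x := by
    refine fun a b => (((h₁.smMat x hx).add ((h₀.smMat x hx).smul (-1))) a b).congr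
      (Eventually.of_forall fun y => ?_)
    simp [sub_eq_add_neg]
  exact (continuous_transgression (d := E.deg x) (summable_derivative hf) (h₀.smMat x hx) hA).congr
    fun t => (h₀.segmentIntegrand_eq hf hT₀ hT₁ hW hWd h₁ t hx).symm

/-- The transgression form between two superconnections is smooth, and its differential is the
difference of the characteristic forms. -/
lemma IsSuperconn.transgression
    (hf : ∀ z : ℂ, Summable fun n => PowerSeries.coeff n f * z ^ n)
    (hT₀ : E.IsSuperconn T₀) (hT₁ : E.IsSuperconn T₁) (x : X) :
    SmAt (fun y => ∫ t in (0 : ℝ)..1, segmentIntegrand f T₀ T₁ t y) x ∧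
    extD (fun y => ∫ t in (0 : ℝ)..1, segmentIntegrand f T₀ T₁ t y) x =
      E.charForm f T₁ x - E.charForm f T₀ x := by
  obtain ⟨W, hW, hx, hWd, hΓ⟩ := exists_hasLocalForm E x
  obtain ⟨Γ₀, h₀⟩ := hΓ T₀ hT₀
  obtain ⟨Γ₁, h₁⟩ := hΓ T₁ hT₁
  have hA : ∀ y ∈ W, SmMat (fun y => Γ₁ y - Γ₀ y) y := by
    refine fun y hy a b => (((h₁.smMat y hy).add ((h₀.smMat y hy).smul (-1))) a b).congr
      (Eventually.of_forall fun y => ?_)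
    simp [sub_eq_add_neg]
  have e0 : ∀ᶠ y in 𝓝 x, SmMat Γ₀ y := by
    filter_upwards [hW.mem_nhds hx] with y hy using h₀.smMat y hy
  have eA : ∀ᶠ y in 𝓝 x, SmMat (fun y => Γ₁ y - Γ₀ y) y := by
    filter_upwards [hW.mem_nhds hx] with y hy using hA y hy
  have e : (fun y => ∫ t in (0 : ℝ)..1, superTr (E.deg x) ((Γ₁ y - Γ₀ y) *
      matSeries (fun k => PowerSeries.coeff k (PowerSeries.derivative ℂ f))
        (curvMat (E.deg x) (fun y => Γ₀ y + (t : ℂ) • (Γ₁ y - Γ₀ y)) y))) =ᶠ[𝓝 x]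
      fun y => ∫ t in (0 : ℝ)..1, segmentIntegrand f T₀ T₁ t y := by
    filter_upwards [hW.mem_nhds hx] with y hy
    simp only [h₀.segmentIntegrand_eq hf hT₀ hT₁ hW hWd h₁ _ hy]
  refine ⟨SmAt.congr (smAt_transgression (summable_derivative hf) e0 eA) e, ?_⟩
  rw [← extD_congr e, extD_transgression hf e0 eA h₀.hasPar
    fun y => (h₁.hasPar y).sub (h₀.hasPar y), h₀.charForm_eq hf hT₀ hW hWd hx,
    h₁.charForm_eq hf hT₁ hW hWd hx]
  simp only [add_sub_cancel]

/-- Forms that differ by an exact form have the same de Rham class. -/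
lemma exists_hasDeRhamClass {η τ β : X → FormAlg V} (hη : η ∈ smoothForms V X)
    (hτ : τ ∈ smoothForms V X) (hβ : β ∈ smoothForms V X) (hdη : extD η = 0) (hdτ : extD τ = 0)
    (h : η - τ = extD β) : ∃ c : DeRham V X, HasDeRhamClass η c ∧ HasDeRhamClass τ c := by
  have h1 : η ∈ closedForms V X := ⟨⟨η, hη⟩, hdη, rfl⟩
  have h2 : τ ∈ closedForms V X := ⟨⟨τ, hτ⟩, hdτ, rfl⟩
  refine ⟨_, ⟨h1, rfl⟩, h2, ?_⟩
  refine ((Submodule.Quotient.eq _).mpr ?_).symm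
  exact ⟨⟨β, hβ⟩, h.symm⟩

/-- The de Rham class of the characteristic form does not depend on the superconnection. -/
lemma IsSuperconn.exists_class
    (hf : ∀ z : ℂ, Summable fun n => PowerSeries.coeff n f * z ^ n)
    (hT₀ : E.IsSuperconn T₀) (hT₁ : E.IsSuperconn T₁) :
    ∃ c : DeRham V X, HasDeRhamClass (E.charForm f T₁) c ∧ HasDeRhamClass (E.charForm f T₀) c :=
  exists_hasDeRhamClass (mem_smoothForms_iff.mpr fun x => hT₁.smAt_charForm hf x)
    (mem_smoothForms_iff.mpr fun x => hT₀.smAt_charForm hf x)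
    (mem_smoothForms_iff.mpr fun x => (hT₀.transgression hf hT₁ x).1)
    (hT₁.extD_charForm hf) (hT₀.extD_charForm hf)
    (funext fun x => (hT₀.transgression hf hT₁ x).2.symm)

end GradedBundle

end CharacteristicForms

/-! ### Smooth bundle maps and the transport of superconnections -/

section BundleMaps

open Filter Topology

variable {V : Type*} [NormedAddCommGroup V] [NormedSpace ℂ V] [FiniteDimensional ℂ V]
variable {X : Type*} [TopologicalSpace X] [ChartedSpace V X] [IsManifold 𝓘(ℂ, V) ω X]

variable (V) in
/-- A matrix of complex valued functions has smooth entries at `x`. -/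
def SmScalar {m n : ℕ} (M : X → Matrix (Fin m) (Fin n) ℂ) (x : X) : Prop :=
  ∀ a b, ContMDiffAt 𝓘(ℝ, V) 𝓘(ℝ, ℂ) ∞ (fun y => M y a b) x

variable {l m n : ℕ} {x : X}

lemma contMDiffAt_sum_complex {ι : Type*} (s : Finset ι) {g : ι → X → ℂ}
    (h : ∀ i ∈ s, ContMDiffAt 𝓘(ℝ, V) 𝓘(ℝ, ℂ) ∞ (g i) x) :
    ContMDiffAt 𝓘(ℝ, V) 𝓘(ℝ, ℂ) ∞ (fun y => ∑ i ∈ s, g i y) x := by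
  classical
  induction s using Finset.induction_on with
  | empty => simpa using contMDiffAt_const
  | insert i s hi ih =>
    simp only [Finset.sum_insert hi]
    exact (contDiff_add (𝕜 := ℝ) (F := ℂ)).comp_contMDiffAt
      ((h i (Finset.mem_insert_self i s)).prodMk_space
        (ih fun j hj => h j (Finset.mem_insert_of_mem hj)))

lemma contMDiffAt_mul_complex {g h : X → ℂ} (hg : ContMDiffAt 𝓘(ℝ, V) 𝓘(ℝ, ℂ) ∞ g x)
    (hh : ContMDiffAt 𝓘(ℝ, V) 𝓘(ℝ, ℂ) ∞ h x) :
    ContMDiffAt 𝓘(ℝ, V) 𝓘(ℝ, ℂ) ∞ (fun y => g y * h y) x :=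
  (contDiff_mul (𝕜 := ℝ) (𝔸 := ℂ)).comp_contMDiffAt (hg.prodMk_space hh)

lemma SmScalar.congr {M N : X → Matrix (Fin m) (Fin n) ℂ} (hM : SmScalar V M x)
    (h : M =ᶠ[𝓝 x] N) : SmScalar V N x := fun a b =>
  (hM a b).congr_of_eventuallyEq (h.symm.mono fun y hy => by simp only [hy])

lemma smScalar_const (M : Matrix (Fin m) (Fin n) ℂ) : SmScalar V (fun _ : X => M) x :=
  fun _ _ => contMDiffAt_const

lemma SmScalar.mul {M : X → Matrix (Fin l) (Fin m) ℂ} {N : X → Matrix (Fin m) (Fin n) ℂ}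
    (hM : SmScalar V M x) (hN : SmScalar V N x) : SmScalar V (fun y => M y * N y) x := fun a b => by
  simp only [Matrix.mul_apply]
  exact contMDiffAt_sum_complex _ fun j _ => contMDiffAt_mul_complex (hM a j) (hN j b)

lemma SmScalar.det {M : X → Matrix (Fin n) (Fin n) ℂ} (hM : SmScalar V M x) :
    ContMDiffAt 𝓘(ℝ, V) 𝓘(ℝ, ℂ) ∞ (fun y => (M y).det) x := by
  have h1 : ContDiff ℝ ∞ fun z : Fin n → Fin n → ℂ => (Matrix.of z).det := by
    simp only [Matrix.det_apply']
    refine ContDiff.sum fun σ _ => contDiff_const.mul (contDiff_prod fun i _ => ?_)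
    exact contDiff_apply_apply ℝ ℂ (σ i) i
  have h2 : ContMDiffAt 𝓘(ℝ, V) 𝓘(ℝ, Fin n → Fin n → ℂ) ∞
      (fun y => (fun a b => M y a b : Fin n → Fin n → ℂ)) x :=
    contMDiffAt_pi_space.mpr fun a => contMDiffAt_pi_space.mpr fun b => hM a b
  exact h1.comp_contMDiffAt h2

lemma SmScalar.inv {M : X → Matrix (Fin n) (Fin n) ℂ} (hM : SmScalar V M x)
    (hx : (M x).det ≠ 0) : SmScalar V (fun y => (M y)⁻¹) x := by
  intro a b
  have h1 : ContMDiffAt 𝓘(ℝ, V) 𝓘(ℝ, ℂ) ∞ (fun y => ((M y).det)⁻¹) x :=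
    ContDiffAt.comp_contMDiffAt (g := fun z : ℂ => z⁻¹) (f := fun y => (M y).det)
      (contDiffAt_inv ℝ hx) hM.det
  have h2 : ContMDiffAt 𝓘(ℝ, V) 𝓘(ℝ, ℂ) ∞ (fun y => (M y).adjugate a b) x := by
    simp only [Matrix.adjugate_apply]
    refine SmScalar.det fun i j => ?_
    simp only [Matrix.updateRow_apply]
    split_ifs
    · exact contMDiffAt_const
    · exact hM i j
  have h3 := contMDiffAt_mul_complex h1 h2
  simpa only [Matrix.inv_def, Ring.inverse_eq_inv', Matrix.smul_apply, smul_eq_mul] using h3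

namespace GradedBundle

variable {E F : GradedBundle V X}

/-- A fibrewise linear map whose matrices in the local frames are smooth. -/
def IsSmoothMap (E F : GradedBundle V X) (φ : ∀ x, Matrix (Fin (F.rank x)) (Fin (E.rank x)) ℂ) :
    Prop :=
  ∀ p q, ∀ x ∈ F.dom p ∩ E.dom q, SmScalar V (fun x => F.trans p x x * φ x * E.trans x q x) x

/-- A fibrewise linear map that preserves the parity of degrees: it commutes with the signs
`(-1)^{deg}`. -/
def IsEvenMap (E F : GradedBundle V X) (φ : ∀ x, Matrix (Fin (F.rank x)) (Fin (E.rank x)) ℂ) :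
    Prop :=
  ∀ x a b, sgn (F.deg x a) * φ x a b = sgn (E.deg x b) * φ x a b

variable {φ : ∀ x, Matrix (Fin (F.rank x)) (Fin (E.rank x)) ℂ}
  {ψ : ∀ x, Matrix (Fin (E.rank x)) (Fin (F.rank x)) ℂ}

lemma trans_mul_trans {p x : X} (hx : x ∈ E.dom p) : E.trans p x x * E.trans x p x = 1 := by
  rw [E.trans_mul p x p x ⟨⟨hx, E.mem_dom x⟩, hx⟩, E.trans_self p x hx]

lemma trans_mul_trans' {p x : X} (hx : x ∈ E.dom p) : E.trans x p x * E.trans p x x = 1 := by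
  rw [E.trans_mul x p x x ⟨⟨E.mem_dom x, hx⟩, E.mem_dom x⟩, E.trans_self x x (E.mem_dom x)]

/-- The inverse of a smooth bundle map is smooth. The ranks of `E` and `F` agree only
propositionally, so the rectangular matrices are inverted after composition with a constant one. -/
lemma IsSmoothMap.inverse (hφ : IsSmoothMap E F φ) (h1 : ∀ x, φ x * ψ x = 1)
    (h2 : ∀ x, ψ x * φ x = 1) : IsSmoothMap F E ψ := by
  intro p q x₀ hx₀
  let A : X → Matrix (Fin (F.rank q)) (Fin (E.rank p)) ℂ := fun x =>
    F.trans q x x * φ x * E.trans x p x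
  let B : X → Matrix (Fin (E.rank p)) (Fin (F.rank q)) ℂ := fun x =>
    E.trans p x x * ψ x * F.trans x q x
  have hA : SmScalar V A x₀ := hφ q p x₀ ⟨hx₀.2, hx₀.1⟩
  have hAB : ∀ x ∈ E.dom p ∩ F.dom q, A x * B x = 1 := by
    intro x hx
    calc A x * B x = F.trans q x x * (φ x * ((E.trans x p x * E.trans p x x) * ψ x)) *
          F.trans x q x := by simp only [A, B, Matrix.mul_assoc]
      _ = 1 := by
          rw [trans_mul_trans' hx.1, Matrix.one_mul, h1, Matrix.mul_one, trans_mul_trans hx.2]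
  have hBA : ∀ x ∈ E.dom p ∩ F.dom q, B x * A x = 1 := by
    intro x hx
    calc B x * A x = E.trans p x x * (ψ x * ((F.trans x q x * F.trans q x x) * φ x)) *
          E.trans x p x := by simp only [A, B, Matrix.mul_assoc]
      _ = 1 := by
          rw [trans_mul_trans' hx.2, Matrix.one_mul, h2, Matrix.mul_one, trans_mul_trans hx.1]
  -- A constant left factor turns `A` into a square matrix that is invertible near `x₀`.
  have hM : SmScalar V (fun x => B x₀ * A x) x₀ := (smScalar_const (B x₀)).mul hA
  have hdet : (B x₀ * A x₀).det ≠ 0 := by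
    rw [hBA x₀ hx₀, Matrix.det_one]
    exact one_ne_zero
  refine ((hM.inv hdet).mul (smScalar_const (B x₀))).congr ?_
  filter_upwards [hM.det.continuousAt.eventually_ne hdet, (E.isOpen_dom p).mem_nhds hx₀.1,
    (F.isOpen_dom q).mem_nhds hx₀.2] with x hx hp hq
  have h3 : (B x₀ * A x) * B x = B x₀ := by
    rw [Matrix.mul_assoc, hAB x ⟨hp, hq⟩, Matrix.mul_one]
  change (B x₀ * A x)⁻¹ * B x₀ = B x
  calc (B x₀ * A x)⁻¹ * B x₀ = (B x₀ * A x)⁻¹ * (B x₀ * A x * B x) := by rw [h3]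
    _ = B x := by
      rw [← Matrix.mul_assoc (B x₀ * A x)⁻¹,
        Matrix.nonsing_inv_mul _ (isUnit_iff_ne_zero.mpr hx), Matrix.one_mul]

lemma IsEvenMap.inverse (hφ : IsEvenMap E F φ) (h1 : ∀ x, φ x * ψ x = 1)
    (h2 : ∀ x, ψ x * φ x = 1) : IsEvenMap F E ψ := by
  intro x a b
  have h3 : Matrix.diagonal (fun a => sgn (F.deg x a)) * φ x =
      φ x * Matrix.diagonal (fun b => sgn (E.deg x b)) := by
    ext a b
    rw [Matrix.diagonal_mul, Matrix.mul_diagonal, hφ x a b, mul_comm]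
  have h4 : Matrix.diagonal (fun b => sgn (E.deg x b)) * ψ x =
      ψ x * Matrix.diagonal (fun a => sgn (F.deg x a)) := by
    calc Matrix.diagonal (fun b => sgn (E.deg x b)) * ψ x =
          ψ x * (φ x * Matrix.diagonal (fun b => sgn (E.deg x b))) * ψ x := by
          rw [← Matrix.mul_assoc, h2, Matrix.one_mul]
      _ = ψ x * Matrix.diagonal (fun a => sgn (F.deg x a)) := by
          rw [← h3, Matrix.mul_assoc, Matrix.mul_assoc, h1, Matrix.mul_one]
  have h5 := congrFun (congrFun h4 a) b
  rw [Matrix.diagonal_mul, Matrix.mul_diagonal, mul_comm (ψ x a b)] at h5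
  exact h5

lemma IsEvenMap.eq_zero (hφ : IsEvenMap E F φ) (x : X) (a : Fin (F.rank x)) (b : Fin (E.rank x))
    (h : ¬ (Even (F.deg x a) ↔ Even (E.deg x b))) : φ x a b = 0 := by
  have h1 := hφ x a b
  by_cases ha : Even (F.deg x a) <;> by_cases hb : Even (E.deg x b)
  · exact absurd (iff_of_true ha hb) h
  · rw [sgn_even ha, sgn_odd hb] at h1
    linear_combination (1 / 2 : ℂ) * h1
  · rw [sgn_odd ha, sgn_even hb] at h1
    linear_combination (-1 / 2 : ℂ) * h1
  · exact absurd (iff_of_false ha hb) h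

/-- The action of a smooth bundle map on bundle valued forms. -/
def mapForms (hφ : IsSmoothMap E F φ) : E.Forms →ₗ[ℂ] F.Forms where
  toFun s := ⟨fun x a => ∑ b, φ x a b • s.1 x b, by
    refine mem_forms_of_smAt fun x => ⟨x, F.mem_dom x, fun a => ?_⟩
    have h1 : SmAt (fun y => ∑ b, (F.trans x y y * φ y * E.trans y x y) a b •
        E.coord x s.1 b y) x :=
      SmAt.sum _ fun b _ => SmAt.fun_smul (hφ x x x ⟨F.mem_dom x, E.mem_dom x⟩ a b)
        (smAt_coord s (E.mem_dom x) b)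
    refine h1.congr ?_
    filter_upwards [(E.isOpen_dom x).mem_nhds (E.mem_dom x)] with y hy
    have h2 : s.1 y = (scalarMat (V := V) (E.trans y x y)).mulVec (fun b => E.coord x s.1 b y) := by
      funext c
      rw [scalarMat_mulVec, ← eq_sum_coord hy]
    calc ∑ b, (F.trans x y y * φ y * E.trans y x y) a b • E.coord x s.1 b y =
          (scalarMat (V := V) (F.trans x y y * φ y * E.trans y x y)).mulVec
            (fun b => E.coord x s.1 b y) a := (scalarMat_mulVec _ _ a).symm
      _ = (scalarMat (V := V) (F.trans x y y)).mulVec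
            ((scalarMat (V := V) (φ y)).mulVec (s.1 y)) a := by
          rw [scalarMat_mul, scalarMat_mul, ← Matrix.mulVec_mulVec, ← h2, ← Matrix.mulVec_mulVec]
      _ = F.coord x (fun x a => ∑ b, φ x a b • s.1 x b) a y := by
          rw [scalarMat_mulVec, coord]
          simp only [scalarMat_mulVec]⟩
  map_add' s t := by ext x a; simp [Finset.sum_add_distrib]
  map_smul' c s := by ext x a; simp [Finset.smul_sum, smul_comm c]

lemma mapForms_apply (hφ : IsSmoothMap E F φ) (s : E.Forms) (x : X) (a : Fin (F.rank x)) :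
    (mapForms hφ s).1 x a = ∑ b, φ x a b • s.1 x b := rfl

lemma mapForms_mulVec (hφ : IsSmoothMap E F φ) (s : E.Forms) (x : X) :
    (mapForms hφ s).1 x = (scalarMat (V := V) (φ x)).mulVec (s.1 x) := by
  funext a
  rw [scalarMat_mulVec, mapForms_apply]

lemma mapForms_rmul (hφ : IsSmoothMap E F φ) (s : E.Forms) (η : smoothForms V X) :
    mapForms hφ (E.rmul s η) = F.rmul (mapForms hφ s) η := by
  ext x a
  simp only [mapForms_apply, rmul_apply, Finset.sum_mul, smul_mul_assoc]

lemma mapForms_parityOp (hφ : IsSmoothMap E F φ) (he : IsEvenMap E F φ) (s : E.Forms) :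
    mapForms hφ (E.parityOp s) = F.parityOp (mapForms hφ s) := by
  ext x a
  simp only [mapForms_apply, parityOp_apply, map_sum, map_smul, Finset.smul_sum, smul_smul]
  refine Finset.sum_congr rfl fun b _ => ?_
  rw [he x a b, mul_comm]

lemma mapForms_mapForms (hφ : IsSmoothMap E F φ) (hψ : IsSmoothMap F E ψ)
    (h : ∀ x, φ x * ψ x = 1) (s : F.Forms) : mapForms hφ (mapForms hψ s) = s := by
  ext x a
  rw [mapForms_mulVec, mapForms_mulVec, Matrix.mulVec_mulVec, ← scalarMat_mul, h, scalarMat_one,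
    Matrix.one_mulVec]

/-- The transport of a superconnection along an even isomorphism of bundles. -/
lemma IsSuperconn.transport {S : F.Forms →ₗ[ℂ] F.Forms} (hS : F.IsSuperconn S)
    (hφ : IsSmoothMap E F φ) (hψ : IsSmoothMap F E ψ) (eφ : IsEvenMap E F φ)
    (eψ : IsEvenMap F E ψ) (h : ∀ x, ψ x * φ x = 1) :
    E.IsSuperconn (mapForms hψ ∘ₗ S ∘ₗ mapForms hφ) where
  leibniz s η x a := by
    simp only [LinearMap.comp_apply, mapForms_rmul, mapForms_apply, hS.leibniz, smul_add,
      Finset.sum_add_distrib, Finset.sum_mul, smul_mul_assoc]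
    congr 1
    have h1 : ∀ b, ψ x a b • sgn (F.deg x b) • (parity ((mapForms hφ s).1 x b) * extD η.1 x) =
        sgn (E.deg x a) • (parity (ψ x a b • (mapForms hφ s).1 x b) * extD η.1 x) := by
      intro b
      rw [map_smul, smul_mul_assoc, smul_smul, smul_smul, eψ x a b, mul_comm]
    have h2 : ∑ b, ψ x a b • (mapForms hφ s).1 x b = s.1 x a := by
      rw [← mapForms_apply hψ, mapForms_mapForms hψ hφ h]
    simp only [mapForms_apply] at h1 h2
    rw [Finset.sum_congr rfl fun b _ => h1 b, ← Finset.smul_sum, ← Finset.sum_mul, ← map_sum, h2]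
  odd s := by
    simp only [LinearMap.comp_apply]
    rw [mapForms_parityOp hφ eφ, hS.odd, map_neg, mapForms_parityOp hψ eψ]

/-- The characteristic form is invariant under transport along an even isomorphism. -/
lemma IsSuperconn.charForm_transport [T2Space X] {f : PowerSeries ℂ}
    (hf : ∀ z : ℂ, Summable fun n => PowerSeries.coeff n f * z ^ n)
    {S : F.Forms →ₗ[ℂ] F.Forms} (hS : F.IsSuperconn S)
    (hφ : IsSmoothMap E F φ) (hψ : IsSmoothMap F E ψ) (eφ : IsEvenMap E F φ)
    (h : ∀ x, ψ x * φ x = 1) (h' : ∀ x, φ x * ψ x = 1) :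
    E.charForm f (mapForms hψ ∘ₗ S ∘ₗ mapForms hφ) = F.charForm f S := by
  let T := mapForms hψ ∘ₗ S ∘ₗ mapForms hφ
  let N : ∀ x, Matrix (Fin (E.rank x)) (Fin (E.rank x)) (FormAlg V) := fun x =>
    scalarMat (V := V) (ψ x) * F.curvature S x * scalarMat (V := V) (φ x)
  have hN : E.Represents N (T ∘ₗ T) := by
    intro s x
    have h1 : (T ∘ₗ T) s = mapForms hψ ((S ∘ₗ S) (mapForms hφ s)) := by
      simp only [T, LinearMap.comp_apply]
      rw [mapForms_mapForms hφ hψ h']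
    have h2 := hS.isTensorial_sq.represents_endForm (mapForms hφ s) x
    rw [h1, mapForms_mulVec, h2, mapForms_mulVec, Matrix.mulVec_mulVec, Matrix.mulVec_mulVec]
    rfl
  funext x
  have h3 : E.curvature T x = N x :=
    congrFun (Represents.ext hN.isTensorial.represents_endForm hN) x
  have g1 : scalarMat (V := V) (φ x) * scalarMat (V := V) (ψ x) = 1 := by
    rw [← scalarMat_mul, h', scalarMat_one]
  have g2 : scalarMat (V := V) (ψ x) * scalarMat (V := V) (φ x) = 1 := by
    rw [← scalarMat_mul, h, scalarMat_one]
  have h4 : F.curvature S x * scalarMat (V := V) (φ x) = scalarMat (V := V) (φ x) * N x := by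
    simp only [N]
    rw [Matrix.mul_assoc (scalarMat (V := V) (ψ x)), ← Matrix.mul_assoc, g1, Matrix.one_mul]
  have h5 := matSeries_conj hf h4
  have h6 : matSeries (fun k => PowerSeries.coeff k f) (N x) = scalarMat (V := V) (ψ x) *
      matSeries (fun k => PowerSeries.coeff k f) (F.curvature S x) * scalarMat (V := V) (φ x) := by
    rw [Matrix.mul_assoc, h5, ← Matrix.mul_assoc, g2, Matrix.one_mul]
  change E.str x (evalAt f (E.curvature T x)) = F.str x (evalAt f (F.curvature S x))
  rw [h3, evalAt_eq_matSeries, evalAt_eq_matSeries, h6]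
  exact superTr_conj (h' x) (fun a b hab => eφ.eq_zero x a b hab) _

end GradedBundle

end BundleMaps

/-! ### Smoothing of topological isomorphisms -/

section Smoothing

open Filter Topology

/-- Positivity of the real part of a sesquilinear form is an open condition. The unit sphere is
compact, so positivity persists on it near `p`, and it extends to all vectors by homogeneity. -/
lemma eventually_re_form_pos {X : Type*} [TopologicalSpace X] {n : ℕ}
    {K : X → Matrix (Fin n) (Fin n) ℂ} {p : X} (hK : ∀ a b, ContinuousAt (fun x => K x a b) p)
    (h : ∀ u ≠ 0, 0 < (star u ⬝ᵥ (K p).mulVec u).re) :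
    ∀ᶠ x in 𝓝 p, ∀ u ≠ 0, 0 < (star u ⬝ᵥ (K x).mulVec u).re := by
  have h1 : ∀ᶠ x in 𝓝 p, ∀ u ∈ Metric.sphere (0 : Fin n → ℂ) 1,
      0 < (star u ⬝ᵥ (K x).mulVec u).re := by
    refine (isCompact_sphere 0 1).eventually_forall_of_forall_eventually fun u hu => ?_
    have hu0 : u ≠ 0 := by
      rintro rfl
      simp at hu
    have h2 : ∀ a b, ContinuousAt (fun z : X × (Fin n → ℂ) => K z.1 a b) (p, u) := fun a b =>
      ContinuousAt.comp (f := Prod.fst) (g := fun x => K x a b) (hK a b) continuousAt_fst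
    have h4 : ∀ a, ContinuousAt (fun z : X × (Fin n → ℂ) => z.2 a) (p, u) := fun a =>
      ((continuous_apply a).comp continuous_snd).continuousAt
    have h5 : ContinuousAt (fun z : X × (Fin n → ℂ) =>
        ∑ a, star (z.2 a) * ∑ b, K z.1 a b * z.2 b) (p, u) :=
      tendsto_finsetSum _ fun a _ => (h4 a).star.mul
        (tendsto_finsetSum _ fun b _ => (h2 a b).mul (h4 b))
    have h3 : ContinuousAt (fun z : X × (Fin n → ℂ) => (star z.2 ⬝ᵥ (K z.1).mulVec z.2).re)
        (p, u) := (Complex.continuous_re.tendsto _).comp h5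
    exact h3.eventually (lt_mem_nhds (h u hu0))
  filter_upwards [h1] with x hx u hu
  have hn : 0 < ‖u‖ := norm_pos_iff.mpr hu
  have h2 := hx (((‖u‖⁻¹ : ℝ) : ℂ) • u) (by
    rw [mem_sphere_zero_iff_norm, norm_smul, Complex.norm_real, norm_inv, norm_norm,
      inv_mul_cancel₀ hn.ne'])
  rw [star_smul, Matrix.mulVec_smul, smul_dotProduct, dotProduct_smul, smul_eq_mul, smul_eq_mul,
    Complex.star_def, Complex.conj_ofReal, Complex.re_ofReal_mul, Complex.re_ofReal_mul] at h2
  have h3 : 0 < ‖u‖⁻¹ := inv_pos.mpr hn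
  exact (mul_pos_iff_of_pos_left h3).mp ((mul_pos_iff_of_pos_left h3).mp h2)

lemma continuousAt_conjTranspose_mul_mul {X : Type*} [TopologicalSpace X] {m n : ℕ}
    {B : X → Matrix (Fin m) (Fin n) ℂ} {H : X → Matrix (Fin m) (Fin m) ℂ} {p : X}
    (hB : ∀ a b, ContinuousAt (fun x => B x a b) p)
    (hH : ∀ a b, ContinuousAt (fun x => H x a b) p) (C : Matrix (Fin m) (Fin n) ℂ) (a b : Fin n) :
    ContinuousAt (fun x => ((B x).conjTranspose * H x * C) a b) p := by
  simp only [Matrix.mul_apply, Matrix.conjTranspose_apply]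
  exact tendsto_finsetSum _ fun c _ => Filter.Tendsto.mul
    (tendsto_finsetSum _ fun d _ => (hB d a).star.mul (hH d c)) tendsto_const_nhds

variable {V : Type*} [NormedAddCommGroup V] [NormedSpace ℂ V] [FiniteDimensional ℂ V]
variable {X : Type*} [TopologicalSpace X] [ChartedSpace V X] [IsManifold 𝓘(ℂ, V) ω X]

namespace GradedBundle

variable {E : GradedBundle V X} {F : HermitianCohesiveModule V X}
  {φ : ∀ x, Matrix (Fin (F.rank x)) (Fin (E.rank x)) ℂ}
  {ψ : ∀ x, Matrix (Fin (E.rank x)) (Fin (F.rank x)) ℂ}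

/-- The bundle map that is constant, with value `φ p`, in the frames at `p`. -/
def frozenMap (φ : ∀ x, Matrix (Fin (F.rank x)) (Fin (E.rank x)) ℂ) (p x : X) :
    Matrix (Fin (F.rank x)) (Fin (E.rank x)) ℂ :=
  F.trans x p x * φ p * E.trans p x x

/-- Near `p`, the continuous map `φ` and its constant extension from `p` are close enough for
`Re h(φ v, φ_p v)` to be positive. -/
lemma exists_frozenMap_pos
    (hψφ : ∀ x, ψ x * φ x = 1)
    (hφ : ∀ p q, ContinuousOn (fun x => F.trans p x x * φ x * E.trans x q x)
      (F.dom p ∩ E.dom q)) (p : X) :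
    ∃ W : Set X, IsOpen W ∧ p ∈ W ∧ W ⊆ F.dom p ∩ E.dom p ∧ ∀ x ∈ W, ∀ v ≠ 0,
      0 < (star ((φ x).mulVec v) ⬝ᵥ (F.metric x).mulVec ((frozenMap φ p x).mulVec v)).re := by
  let B : X → Matrix (Fin (F.rank p)) (Fin (E.rank p)) ℂ := fun x =>
    F.trans p x x * φ x * E.trans x p x
  let H : X → Matrix (Fin (F.rank p)) (Fin (F.rank p)) ℂ := fun x =>
    (F.trans x p x).conjTranspose * F.metric x * F.trans x p x
  let K : X → Matrix (Fin (E.rank p)) (Fin (E.rank p)) ℂ := fun x =>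
    (B x).conjTranspose * H x * φ p
  have hFp : F.trans p p p = 1 := F.trans_self p p (F.mem_dom p)
  have hEp : E.trans p p p = 1 := E.trans_self p p (E.mem_dom p)
  have hB : ∀ a b, ContinuousAt (fun x => B x a b) p := fun a b =>
    continuousAt_pi.mp (continuousAt_pi.mp ((hφ p p).continuousAt
      (((F.isOpen_dom p).inter (E.isOpen_dom p)).mem_nhds ⟨F.mem_dom p, E.mem_dom p⟩)) a) b
  have hH : ∀ a b, ContinuousAt (fun x => H x a b) p := by
    intro a b
    exact (F.metric_smooth p a b).continuousOn.continuousAt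
      ((F.isOpen_dom p).mem_nhds (F.mem_dom p))
  have hK : ∀ a b, ContinuousAt (fun x => K x a b) p := continuousAt_conjTranspose_mul_mul hB hH (φ p)
  have hpos : ∀ u ≠ 0, 0 < (star u ⬝ᵥ (K p).mulVec u).re := by
    intro u hu
    have h1 : (φ p).mulVec u ≠ 0 := by
      intro h0
      apply hu
      rw [← Matrix.one_mulVec u, ← hψφ p, ← Matrix.mulVec_mulVec, h0, Matrix.mulVec_zero]
    have h2 := (F.metric_posDef p).dotProduct_mulVec_pos h1
    have h3 : K p = (φ p).conjTranspose * F.metric p * φ p := by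
      simp only [K, B, H, hFp, hEp, Matrix.one_mul, Matrix.mul_one, Matrix.conjTranspose_one]
    have h4 : star u ⬝ᵥ (K p).mulVec u =
        star ((φ p).mulVec u) ⬝ᵥ (F.metric p).mulVec ((φ p).mulVec u) := by
      rw [h3, Matrix.star_mulVec, ← Matrix.dotProduct_mulVec, Matrix.mulVec_mulVec,
        Matrix.mulVec_mulVec, Matrix.mul_assoc]
    rw [h4]
    exact (Complex.lt_def.mp h2).1
  obtain ⟨W, hWs, hWo, hWp⟩ := mem_nhds_iff.mp (inter_mem (eventually_re_form_pos hK hpos)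
    (((F.isOpen_dom p).inter (E.isOpen_dom p)).mem_nhds ⟨F.mem_dom p, E.mem_dom p⟩))
  refine ⟨W, hWo, hWp, fun x hx => (hWs hx).2, fun x hx v hv => ?_⟩
  obtain ⟨hFx, hEx⟩ := (hWs hx).2
  let u := (E.trans p x x).mulVec v
  have hvu : v = (E.trans x p x).mulVec u := by
    rw [Matrix.mulVec_mulVec, trans_mul_trans' hEx, Matrix.one_mulVec]
  have hu : u ≠ 0 := by
    intro h0
    rw [h0, Matrix.mulVec_zero] at hvu
    exact hv hvu
  have h1 := (hWs hx).1 u hu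
  have h2 : (φ x).mulVec v = (F.trans x p x * B x).mulVec u := by
    have h3 : F.trans x p x * B x = φ x * E.trans x p x := by
      simp only [B]
      rw [← Matrix.mul_assoc, ← Matrix.mul_assoc, trans_mul_trans' hFx, Matrix.one_mul]
    rw [h3, ← Matrix.mulVec_mulVec, ← hvu]
  have h3 : (frozenMap φ p x).mulVec v = (F.trans x p x * φ p).mulVec u := by
    rw [frozenMap, ← Matrix.mulVec_mulVec]
  rw [h2, h3, Matrix.star_mulVec, ← Matrix.dotProduct_mulVec, Matrix.mulVec_mulVec,
    Matrix.mulVec_mulVec]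
  have h4 : (F.trans x p x * B x).conjTranspose * F.metric x * (F.trans x p x * φ p) = K x := by
    simp only [K, H, Matrix.conjTranspose_mul, Matrix.mul_assoc]
  rw [h4]
  exact h1

/-- A topological isomorphism `φ` that preserves the parity can be replaced by a smooth one: glue the
frozen maps with a partition of unity. The result `θ` is injective because `Re h(φ v, θ v) > 0` for
`v ≠ 0`, a condition that is stable under convex combinations. -/
lemma exists_smooth_iso [T2Space X] [CompactSpace X]
    (h : Z2TopIso E F.toGradedBundle) :
    ∃ (φ : ∀ x, Matrix (Fin (F.rank x)) (Fin (E.rank x)) ℂ)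
      (ψ : ∀ x, Matrix (Fin (E.rank x)) (Fin (F.rank x)) ℂ),
      IsSmoothMap E F.toGradedBundle φ ∧ IsEvenMap E F.toGradedBundle φ ∧
      (∀ x, φ x * ψ x = 1) ∧ ∀ x, ψ x * φ x = 1 := by
  obtain ⟨φ, ψ, hφψ, hψφ, heven, hcont⟩ := h
  choose W hWo hWp hWd hWpos using exists_frozenMap_pos hψφ hcont
  obtain ⟨t, ρ, hρ, hρW, hρ0, hsum⟩ := exists_finite_partition V hWo hWp
  have hW0 : ∀ p x, ρ p x ≠ 0 → x ∈ W p := fun p x hx =>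
    hρW p (subset_tsupport _ (by simpa using hx))
  let θ : ∀ x, Matrix (Fin (F.rank x)) (Fin (E.rank x)) ℂ := fun x =>
    ∑ p ∈ t, (ρ p x : ℂ) • frozenMap φ p x
  have hinj : ∀ x v, v ≠ 0 → (θ x).mulVec v ≠ 0 := by
    intro x v hv h0
    have h1 : (star ((φ x).mulVec v) ⬝ᵥ (F.metric x).mulVec ((θ x).mulVec v)).re =
        ∑ p ∈ t, ρ p x *
          (star ((φ x).mulVec v) ⬝ᵥ (F.metric x).mulVec ((frozenMap φ p x).mulVec v)).re := by
      simp only [θ, Matrix.sum_mulVec, Matrix.mulVec_sum, dotProduct_sum, Complex.re_sum,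
        Matrix.smul_mulVec, Matrix.mulVec_smul, dotProduct_smul, smul_eq_mul,
        Complex.re_ofReal_mul]
    have h2 : 0 < ∑ p ∈ t, ρ p x *
        (star ((φ x).mulVec v) ⬝ᵥ (F.metric x).mulVec ((frozenMap φ p x).mulVec v)).re := by
      refine Finset.sum_pos' (fun p _ => ?_) ?_
      · by_cases hp : ρ p x = 0
        · rw [hp, zero_mul]
        · exact mul_nonneg (hρ0 p x) (hWpos p x (hW0 p x hp) v hv).le
      · obtain ⟨p, hpt, hp⟩ := Finset.exists_ne_zero_of_sum_ne_zero
          (s := t) (f := fun p => ρ p x) (by rw [hsum]; exact one_ne_zero)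
        exact ⟨p, hpt, mul_pos ((hρ0 p x).lt_of_ne' hp) (hWpos p x (hW0 p x hp) v hv)⟩
    rw [← h1, h0, Matrix.mulVec_zero, dotProduct_zero, Complex.zero_re] at h2
    exact lt_irrefl _ h2
  -- The composite `ψ θ` is an injective endomorphism, which yields the inverse of `θ`.
  have hunit : ∀ x, IsUnit (ψ x * θ x).det := by
    intro x
    rw [← Matrix.isUnit_iff_isUnit_det, ← Matrix.mulVec_injective_iff_isUnit]
    refine (injective_iff_map_eq_zero (Matrix.mulVecLin (ψ x * θ x))).mpr fun v hv => ?_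
    by_contra hv0
    refine hinj x v hv0 ?_
    rw [Matrix.mulVecLin_apply, ← Matrix.mulVec_mulVec] at hv
    rw [← Matrix.one_mulVec ((θ x).mulVec v), ← hφψ x, ← Matrix.mulVec_mulVec, hv,
      Matrix.mulVec_zero]
  refine ⟨θ, fun x => (ψ x * θ x)⁻¹ * ψ x, ?_, ?_, fun x => ?_, fun x => ?_⟩
  · intro p q x₀ hx₀
    have h1 : SmScalar V (fun x => ∑ i ∈ t, (ρ i x : ℂ) •
        (F.trans p i x * φ i * E.trans i q x)) x₀ := by
      intro a b
      simp only [Matrix.sum_apply, Matrix.smul_apply, smul_eq_mul]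
      refine contMDiffAt_sum_complex _ fun i _ =>
        contMDiffAt_cutoff_mul (hρ i) (hρW i) fun hx => ?_
      have h2 : SmScalar V (fun x => F.trans p i x) x₀ := fun a b =>
        contMDiffAt_trans hx₀.1 (hWd i hx).1 a b
      have h3 : SmScalar V (fun x => E.trans i q x) x₀ := fun a b =>
        contMDiffAt_trans (hWd i hx).2 hx₀.2 a b
      exact ((h2.mul (smScalar_const (φ i))).mul h3) a b
    refine h1.congr ?_
    filter_upwards [(F.isOpen_dom p).mem_nhds hx₀.1, (E.isOpen_dom q).mem_nhds hx₀.2] with x hp hq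
    simp only [θ, Matrix.mul_sum, Matrix.sum_mul]
    refine Finset.sum_congr rfl fun i _ => ?_
    by_cases hi : ρ i x = 0
    · simp [hi]
    · obtain ⟨hF, hE⟩ := hWd i (hW0 i x hi)
      rw [Matrix.mul_smul, Matrix.smul_mul, frozenMap,
        ← F.trans_mul p x i x ⟨⟨hp, F.mem_dom x⟩, hF⟩,
        ← E.trans_mul i x q x ⟨⟨hE, E.mem_dom x⟩, hq⟩]
      simp only [Matrix.mul_assoc]
  · intro x a b
    simp only [θ, Matrix.sum_apply, Matrix.smul_apply, smul_eq_mul, Finset.mul_sum]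
    refine Finset.sum_congr rfl fun i _ => ?_
    by_cases hi : ρ i x = 0
    · simp [hi]
    · obtain ⟨hF, hE⟩ := hWd i (hW0 i x hi)
      have h1 : sgn (F.deg x a) * frozenMap φ i x a b = sgn (E.deg x b) * frozenMap φ i x a b := by
        simp only [frozenMap, Matrix.mul_apply, Finset.sum_mul, Finset.mul_sum]
        refine Finset.sum_congr rfl fun d _ => Finset.sum_congr rfl fun c _ => ?_
        have e1 := sgn_smul_trans (F.mem_dom x) hF a c
        have e2 := sgn_smul_trans hE (E.mem_dom x) d b
        have e3 : sgn (F.deg i c) * φ i c d = sgn (E.deg i d) * φ i c d := by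
          by_cases hcd : Even (F.deg i c) ↔ Even (E.deg i d)
          · have h2 : sgn (F.deg i c) = sgn (E.deg i d) := by
              by_cases hc : Even (F.deg i c)
              · rw [sgn_even hc, sgn_even (hcd.mp hc)]
              · rw [sgn_odd hc, sgn_odd fun hd => hc (hcd.mpr hd)]
            rw [h2]
          · rw [heven i c d hcd, mul_zero, mul_zero]
        linear_combination (-(φ i c d * E.trans i x x d b)) * e1 +
          (F.trans x i x a c * E.trans i x x d b) * e3 - (F.trans x i x a c * φ i c d) * e2
      rw [mul_left_comm, h1, mul_left_comm]
  · calc θ x * ((ψ x * θ x)⁻¹ * ψ x) = (φ x * ψ x) * (θ x * ((ψ x * θ x)⁻¹ * ψ x)) := by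
          rw [hφψ, Matrix.one_mul]
      _ = φ x * ((ψ x * θ x) * (ψ x * θ x)⁻¹) * ψ x := by simp only [Matrix.mul_assoc]
      _ = 1 := by rw [Matrix.mul_nonsing_inv _ (hunit x), Matrix.mul_one, hφψ]
  · rw [Matrix.mul_assoc, Matrix.nonsing_inv_mul _ (hunit x)]

end GradedBundle

end Smoothing

end Cohesive

end

theorem mainTheorem10
    {V : Type*} [NormedAddCommGroup V] [NormedSpace ℂ V] [FiniteDimensional ℂ V]
    {X : Type*} [TopologicalSpace X] [T2Space X] [CompactSpace X] [ChartedSpace V X]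
    [IsManifold 𝓘(ℂ, V) ω X]
    (f : PowerSeries ℂ) (hf : ∀ z : ℂ, Summable fun n => PowerSeries.coeff n f * z ^ n) :
    (∀ (E : Cohesive.HermitianCohesiveModule V X) (T : E.Forms →ₗ[ℂ] E.Forms), E.IsChern T →
      -- all the objects that occur are well defined
      (∀ t : ℝ, E.IsTensorial (E.path T t ∘ₗ E.path T t)) ∧
      E.IsTensorial (T - E.connPart T) ∧
      (∀ (t : ℝ) (x : X),
        Summable (fun n => PowerSeries.coeff n f • E.curvature (E.path T t) x ^ n) ∧
        Summable (fun n => PowerSeries.coeff n (PowerSeries.derivative ℂ f) •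
          E.curvature (E.path T t) x ^ n)) ∧
      (∀ x, Continuous fun t => E.transgressionIntegrand f T t x) ∧
      -- the characteristic form is smooth and closed
      E.charForm f T ∈ Cohesive.smoothForms V X ∧
      Cohesive.extD (E.charForm f T) = 0 ∧
      -- the transgression formula
      E.transgression f T ∈ Cohesive.smoothForms V X ∧
      E.charForm f T - E.charForm f (E.connPart T) = Cohesive.extD (E.transgression f T) ∧
      -- equality of the de Rham classes
      ∃ c : Cohesive.DeRham V X, Cohesive.HasDeRhamClass (E.charForm f T) c ∧
        Cohesive.HasDeRhamClass (E.charForm f (E.connPart T)) c) ∧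
    -- the class depends only on the topological bundle with its grading modulo two
    (∀ (E F : Cohesive.HermitianCohesiveModule V X) (T : E.Forms →ₗ[ℂ] E.Forms)
      (S : F.Forms →ₗ[ℂ] F.Forms), E.IsChern T → F.IsChern S →
      Cohesive.GradedBundle.Z2TopIso E.toGradedBundle F.toGradedBundle →
      ∃ c : Cohesive.DeRham V X, Cohesive.HasDeRhamClass (E.charForm f T) c ∧
        Cohesive.HasDeRhamClass (F.charForm f S) c) := by
  refine ⟨fun E T hT => ?_, fun E F T S hT hS hiso => ?_⟩
  · have h₁ := hT.isSuperconn
    have h₀ := h₁.connPart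
    have hsm := fun x => h₀.transgression hf h₁ x
    refine ⟨fun t => (h₀.affine h₁ t).isTensorial_sq, h₀.isTensorial_sub h₁,
      fun t x => ⟨Cohesive.summable_matSeries hf _,
        Cohesive.summable_matSeries (Cohesive.summable_derivative hf) _⟩,
      h₀.continuous_segmentIntegrand hf h₁,
      Cohesive.mem_smoothForms_iff.mpr (h₁.smAt_charForm hf), h₁.extD_charForm hf,
      Cohesive.mem_smoothForms_iff.mpr fun x => (hsm x).1, funext fun x => (hsm x).2.symm,
      h₀.exists_class hf h₁⟩
  · obtain ⟨φ, ψ, hφ, eφ, h1, h2⟩ := Cohesive.GradedBundle.exists_smooth_iso hiso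
    have hψ := hφ.inverse h1 h2
    have eψ := eφ.inverse h1 h2
    have h := (hS.isSuperconn.transport hφ hψ eφ eψ h2).exists_class hf hT.isSuperconn
    rwa [hS.isSuperconn.charForm_transport hf hφ hψ eφ h2 h1] at h
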